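/- Let $\sigma^2>0$, $\vartheta_2>0$, $\vartheta_1,\vartheta_0\in\mathbb R$, put $\kappa=\vartheta_1/\vartheta_2$, $\Gamma=\frac{\vartheta_1^2}{4\vartheta_2^2}-\frac{\vartheta_0}{\vartheta_2}$ and assume $\Gamma+\pi^2>0$. Consider on $[0,1]$ the linear parabolic SPDE $$dX_t(x)=\Big(\vartheta_2\tfrac{\partial^2}{\partial x^2}X_t(x)+\vartheta_1\tfrac{\partial}{\partial x}X_t(x)+\vartheta_0X_t(x)\Big)dt+\sigma\,dW_t(x),\qquad X_t(0)=X_t(1)=0,$$ driven by a cylindrical Brownian motion $W$, and let $X$ be its stationary solution, given by the spectral representation $$X_t(x)=\sum_{\ell\ge1}u_\ell(t)e_\ell(x),\qquad e_\ell(x)=\sqrt2\sin(\pi\ell x)e^{-\kappa x/2},\qquad du_\ell(t)=-\lambda_\ell u_\ell(t)\,dt+\sigma\,d\beta_\ell(t),\qquad \lambda_\ell=\vartheta_2(\pi^2\ell^2+\Gamma),$$ where the $\beta_\ell$ are standard Brownian motions, $u_\ell(0)\sim\mathcal N(0,\sigma^2/(2\lambda_\ell))$, and the family $\{\beta_\ell,u_\ell(0):\ell\ge1\}$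 is independent (the series for $X_t(x)$ converging in probability for each $t\ge 0$, $x\in[0,1]$). Fix $T>0$ and $b\in(0,1/2)$. For $M,N\in\mathbb N$ let $\delta=\frac{1-2b}{M}$, $\Delta=\frac TN$, $y_k=b+k\delta$, $t_i=i\Delta$, let $$D_{ik}=X_{t_{i+1}}(y_{k+1})-X_{t_{i+1}}(y_k)-X_{t_i}(y_{k+1})+X_{t_i}(y_k)$$ and $$\mathbb V_r=\frac1{MN\sqrt\Delta}\sum_{k=0}^{M-1}\sum_{i=0}^{N-1}\exp\Big(\frac\kappa2(y_k+y_{k+1})\Big)D_{ik}^2 .$$ Let $M,N\to\infty$ along sequences with $\delta/\sqrt\Delta= r$ for all members of the sequence, for a fixed $r\in(0,\infty)$. Then $$\sqrt{MN}\,\big(\mathbb V_r-\psi_{\vartheta_2}(r)\sigma^2\big)\ \overset{\mathcal D}{\longrightarrow}\ \mathcal N\Big(0,\;C\big(r/\sqrt{\vartheta_2}\big)\,\psi_{\vartheta_2}(r)^2\,\sigma^4\Big),$$ where $$\psi_{\vartheta_2}(r)=\frac2{\sqrt{\pi\vartheta_2}}\Big(1-e^{-\frac{r^2}{4\vartheta_2}}+\frac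 r{\sqrt{\vartheta_2}}\int_{\frac r{2\sqrt{\vartheta_2}}}^\infty e^{-z^2}dz\Big)$$ and, for $h>0$, $$C(h)=\frac2{\Lambda_{0,0}(h)^2}\sum_{j,l\in\mathbb Z}\Lambda_{j,l}(h)^2,\qquad \Lambda_{j,l}(h)=(D_x^2D_y^2G_h)(|j|-1,|l|-1),$$ with $D_x^2f(x,y)=f(x+2,y)+f(x,y)-2f(x+1,y)$, $D_y^2f(x,y)=f(x,y+2)+f(x,y)-2f(x,y+1)$, $G_h(x,y)=\sqrt{|x|}\,H\big(h|y|/\sqrt{|x|}\big)$ for $x\ne0$, $G_h(0,y)=0$, and $H(x)=\frac1{2\sqrt\pi}\big(e^{-x^2/4}-x\int_{x/2}^\infty e^{-z^2}dz\big)$. In particular, the double series in $C(r/\sqrt{\vartheta_2})$ converges. -/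

import Mathlib

open MeasureTheory ProbabilityTheory Filter Set
open scoped NNReal Topology

noncomputable section

/-! ### The operator `ϑ₂ ∂² + ϑ₁ ∂ + ϑ₀` on `[0,1]` with Dirichlet boundary conditions -/

/-- `κ = ϑ₁ / ϑ₂`. -/
def spdeKappa (ϑ₂ ϑ₁ : ℝ) : ℝ := ϑ₁ / ϑ₂

/-- `Γ = ϑ₁² / (4 ϑ₂²) - ϑ₀ / ϑ₂`. -/
def spdeGamma (ϑ₂ ϑ₁ ϑ₀ : ℝ) : ℝ := ϑ₁ ^ 2 / (4 * ϑ₂ ^ 2) - ϑ₀ / ϑ₂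

/-- `λ_ℓ = ϑ₂ (π² ℓ² + Γ)`; the eigenvalues of the operator are `-λ_ℓ`, `ℓ ≥ 1`. -/
def spdeEigenvalue (ϑ₂ ϑ₁ ϑ₀ : ℝ) (l : ℕ) : ℝ :=
  ϑ₂ * (Real.pi ^ 2 * (l : ℝ) ^ 2 + spdeGamma ϑ₂ ϑ₁ ϑ₀)

/-- The eigenfunction `e_ℓ(y) = √2 sin(π ℓ y) exp(-κ y / 2)`, `ℓ ≥ 1`. -/
def spdeEigenfunction (ϑ₂ ϑ₁ : ℝ) (l : ℕ) (y : ℝ) : ℝ :=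
  √2 * Real.sin (Real.pi * (l : ℝ) * y) * Real.exp (-(spdeKappa ϑ₂ ϑ₁ * y) / 2)

/-! ### The solution field

The families `β` (driving Brownian motions) and `u` (Fourier modes) are indexed by `ℕ`; the index
`l` stands for the mode with number `l + 1`. -/

/-- `X` is the stationary solution of
`dX = (ϑ₂ ∂²X + ϑ₁ ∂X + ϑ₀ X) dt + σ dW`, `X_t(0) = X_t(1) = 0`, given by its spectral
representation `X_t(x) = ∑_{ℓ ≥ 1} u_ℓ(t) e_ℓ(x)`, where the cylindrical Brownian motion `W` has
the coordinate processes `β_ℓ` and the modes solve `du_ℓ = -λ_ℓ u_ℓ dt + σ dβ_ℓ`. -/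
structure IsStationarySPDESolution {Ω : Type*} [MeasurableSpace Ω] (σ ϑ₂ ϑ₁ ϑ₀ : ℝ)
    (β u : ℕ → ℝ≥0 → Ω → ℝ) (X : ℝ≥0 → ℝ → Ω → ℝ) (μ : Measure Ω) : Prop where
  measurable_noise : ∀ l t, Measurable (β l t)
  measurable_mode : ∀ l t, Measurable (u l t)
  /-- Every `β_ℓ` is a standard Brownian motion. -/
  isBrownian : ∀ l, IsBrownianReal (β l) μ
  /-- The initial values have the stationary law `N(0, σ² / (2 λ_ℓ))`. -/
  initial_law : ∀ l, HasLaw (u l 0)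
    (gaussianReal 0 (Real.toNNReal (σ ^ 2 / (2 * spdeEigenvalue ϑ₂ ϑ₁ ϑ₀ (l + 1))))) μ
  /-- Together with `indep_initial`: the family `{β_ℓ, u_ℓ(0) : ℓ ≥ 1}` is independent. -/
  indep_modes : iIndepFun (fun l ω => ((fun t => β l t ω : ℝ≥0 → ℝ), u l 0 ω)) μ
  indep_initial : ∀ l, IndepFun (fun ω => (fun t => β l t ω : ℝ≥0 → ℝ)) (u l 0) μ
  /-- The modes have almost surely continuous paths. -/
  continuous_mode : ∀ l, ∀ᵐ ω ∂μ, Continuous fun t => u l t ω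
  /-- The Ornstein-Uhlenbeck equation `du_ℓ = -λ_ℓ u_ℓ dt + σ dβ_ℓ`, in integrated form. -/
  ornstein_uhlenbeck : ∀ l, ∀ᵐ ω ∂μ, ∀ t : ℝ≥0,
    u l t ω = u l 0 ω
      - spdeEigenvalue ϑ₂ ϑ₁ ϑ₀ (l + 1) * (∫ s in (0 : ℝ)..(t : ℝ), u l (Real.toNNReal s) ω)
      + σ * β l t ω
  /-- `X_t(x) = ∑_{ℓ ≥ 1} u_ℓ(t) e_ℓ(x)`: the partial sums converge in probability (which is
  implied by convergence in mean square, and by almost sure convergence). -/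
  series : ∀ (t : ℝ≥0), ∀ x ∈ Icc (0 : ℝ) 1,
    TendstoInMeasure μ
      (fun (n : ℕ) ω => ∑ l ∈ Finset.range n, u l t ω * spdeEigenfunction ϑ₂ ϑ₁ (l + 1) x)
      atTop (X t x)

/-! ### Observation grid and realized space-time variation -/

/-- `δ = (1 - 2b) / M`. -/
def spaceStep (b : ℝ) (M : ℕ) : ℝ := (1 - 2 * b) / (M : ℝ)

/-- `Δ = T / N`. -/
def timeStep (T : ℝ≥0) (N : ℕ) : ℝ≥0 := T / (N : ℝ≥0)

/-- `y_k = b + k δ`. -/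
def spacePoint (b : ℝ) (M k : ℕ) : ℝ := b + (k : ℝ) * spaceStep b M

/-- `t_i = i Δ`. -/
def timePoint (T : ℝ≥0) (N i : ℕ) : ℝ≥0 := (i : ℝ≥0) * timeStep T N

/-- The double increment
`D_{ik} = X_{t_{i+1}}(y_{k+1}) - X_{t_{i+1}}(y_k) - X_{t_i}(y_{k+1}) + X_{t_i}(y_k)`. -/
def doubleIncrement {Ω : Type*} (X : ℝ≥0 → ℝ → Ω → ℝ) (b : ℝ) (T : ℝ≥0) (M N i k : ℕ)
    (ω : Ω) : ℝ :=
  X (timePoint T N (i + 1)) (spacePoint b M (k + 1)) ω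
    - X (timePoint T N (i + 1)) (spacePoint b M k) ω
    - X (timePoint T N i) (spacePoint b M (k + 1)) ω
    + X (timePoint T N i) (spacePoint b M k) ω

/-- `𝕍_r = (M N √Δ)⁻¹ ∑_{k < M} ∑_{i < N} exp(κ (y_k + y_{k+1}) / 2) D_{ik}²`. -/
def realizedVariation {Ω : Type*} (X : ℝ≥0 → ℝ → Ω → ℝ) (κ b : ℝ) (T : ℝ≥0) (M N : ℕ)
    (ω : Ω) : ℝ :=
  1 / ((M : ℝ) * (N : ℝ) * √(timeStep T N : ℝ)) *
    ∑ k ∈ Finset.range M, ∑ i ∈ Finset.range N,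
      Real.exp (κ / 2 * (spacePoint b M k + spacePoint b M (k + 1)))
        * doubleIncrement X b T M N i k ω ^ 2

/-! ### The constants in the limit theorem -/

/-- `ψ_{ϑ₂}(r) = 2 / √(π ϑ₂) (1 - exp(-r² / (4 ϑ₂)) + r / √ϑ₂ ∫_{r / (2√ϑ₂)}^∞ exp(-z²) dz)`. -/
def psiFun (ϑ₂ r : ℝ) : ℝ :=
  2 / √(Real.pi * ϑ₂) *
    (1 - Real.exp (-(r ^ 2 / (4 * ϑ₂)))
      + r / √ϑ₂ * ∫ z in Ioi (r / (2 * √ϑ₂)), Real.exp (-z ^ 2))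

/-- `H(x) = (2√π)⁻¹ (exp(-x² / 4) - x ∫_{x/2}^∞ exp(-z²) dz)`. -/
def HFun (x : ℝ) : ℝ :=
  1 / (2 * √Real.pi) * (Real.exp (-(x ^ 2 / 4)) - x * ∫ z in Ioi (x / 2), Real.exp (-z ^ 2))

/-- `G_h(x, y) = √|x| H(h |y| / √|x|)` for `x ≠ 0`, and `G_h(0, y) = 0`. -/
def GFun (h x y : ℝ) : ℝ :=
  if x = 0 then 0 else √|x| * HFun (h * |y| / √|x|)

/-- `(D_x² f)(x, y) = f(x+2, y) + f(x, y) - 2 f(x+1, y)`. -/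
def secondDiffX (f : ℝ → ℝ → ℝ) (x y : ℝ) : ℝ := f (x + 2) y + f x y - 2 * f (x + 1) y

/-- `(D_y² f)(x, y) = f(x, y+2) + f(x, y) - 2 f(x, y+1)`. -/
def secondDiffY (f : ℝ → ℝ → ℝ) (x y : ℝ) : ℝ := f x (y + 2) + f x y - 2 * f x (y + 1)

/-- `Λ_{j,l}(h) = (D_x² D_y² G_h)(|j| - 1, |l| - 1)`, `j, l ∈ ℤ`. -/
def LambdaFun (h : ℝ) (j l : ℤ) : ℝ :=
  secondDiffX (secondDiffY (GFun h)) (|(j : ℝ)| - 1) (|(l : ℝ)| - 1)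

/-- `C(h) = 2 / Λ_{0,0}(h)² ∑_{j,l ∈ ℤ} Λ_{j,l}(h)²`. -/
def CFun (h : ℝ) : ℝ :=
  2 / LambdaFun h 0 0 ^ 2 * ∑' p : ℤ × ℤ, LambdaFun h p.1 p.2 ^ 2

end

/-! The weight exp(κ(y_k + y_{k+1})/2) splits as a square, so the statistic is a normalised sum of
squares of a centred Gaussian array, the weighted double increments. Two ingredients are needed: the
asymptotic covariance of this array and a central limit theorem for sums of squares of Gaussian
vectors.

Covariance. Each mode is a stationary Ornstein-Uhlenbeck process, so its time increments at lag n
have covariance σ²/2 times a second difference of t ↦ ∫₀ᵗ exp(-λs) ds (`timeDiff`). Summing over the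
modes turns exp(-λs) into a Dirichlet heat kernel, which Poisson summation writes as Gaussian
kernels over x - y + 2ℤ minus those over x + y + 2ℤ. As the grid stays in [b, 1-b], only the kernel
at x - y itself is singular. All other images, the damping factor exp(-ϑ₂Γs) and the weights
contribute O(Δ^{3/2}). Since δ = r√Δ, parabolic scaling makes the main term √Δ · (-σ²/√ϑ₂)
Λ_{j,l}(r/√ϑ₂), because `GFun` is half the time integral of the heat kernel (`LambdaFun_eq`,
`exists_abs_incrementCov_sub_le`).

Limit theorem. For a Gaussian vector with covariance S, the sum of squares minus tr S equals Σ √2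
μ_i ξ_i, with μ_i the eigenvalues of S and ξ_i independent normalised chi-square variables. It is
asymptotically N(0, 2 lim Σ μ_i²) as soon as max |μ_i| → 0. Here √(MN) S is, uniformly in the
entries and up to o((MN)^{-1/2}), a Toeplitz array with square-summable v. Row sums control max
|μ_i|, the Frobenius norm gives Σ μ_i² → Σ v², and the trace gives the centring √(MN) v(0)
(`tendstoInDistribution_sum_sq_of_toeplitz`). With v = -(σ²/√ϑ₂) Λ one has v(0) = ψσ², and the error
is O(Δ) with Δ√(MN) of order M^{-1/2}.

Gaussianity is obtained without stochastic integrals: the integrated equation is solved pathwise by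
a discrete variation of constants, a finite sum of Brownian increments, and characteristic functions
pass to the limit in the mesh and then in the number of modes. -/

/-! ### Characteristic function of the normalised chi-square law -/

theorem integral_pow_four_gaussianReal : ∫ x, x ^ 4 ∂gaussianReal 0 1 = 3 := by
  rw [integral_gaussianReal_eq_integral_smul one_ne_zero]
  have h1 : ∀ x : ℝ, gaussianPDFReal 0 1 x • x ^ 4 =
      (fun y => (√(2 * Real.pi))⁻¹ * (y ^ (4:ℝ) * Real.exp (-(1/2) * y ^ (2:ℝ)))) |x| := by
    intro x
    have e4 : |x| ^ (4:ℝ) = x ^ 4 := by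
      rw [show (4:ℝ) = ((4:ℕ):ℝ) by norm_num, Real.rpow_natCast, Even.pow_abs (by decide)]
    have e2 : |x| ^ (2:ℝ) = x ^ 2 := by
      rw [show (2:ℝ) = ((2:ℕ):ℝ) by norm_num, Real.rpow_natCast, sq_abs]
    simp only [gaussianPDFReal, smul_eq_mul, e4, e2]
    simp only [NNReal.coe_one, mul_one, sub_zero]
    rw [show -x ^ 2 / 2 = -(1/2) * x ^ 2 by ring]
    ring
  simp_rw [h1]
  rw [integral_comp_abs (f := fun y => (√(2 * Real.pi))⁻¹ * (y ^ (4:ℝ) * Real.exp (-(1/2) * y ^ (2:ℝ)))),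
    integral_const_mul, integral_rpow_mul_exp_neg_mul_rpow (by norm_num) (by norm_num) (by norm_num)]
  have g : Real.Gamma ((4 + 1) / 2) = 3 / 4 * √Real.pi := by
    rw [show ((4:ℝ) + 1) / 2 = (1/2 + 1) + 1 by norm_num, Real.Gamma_add_one (by norm_num),
      Real.Gamma_add_one (by norm_num), Real.Gamma_one_half_eq]
    ring
  rw [g]
  have h2 : ((1:ℝ) / 2) ^ (-(4 + 1) / 2 : ℝ) = 4 * √2 := by
    rw [show (-(4 + 1) / 2 : ℝ) = -2 + -(1/2) by norm_num, Real.rpow_add (by norm_num),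
      Real.rpow_neg (by norm_num), Real.rpow_neg (by norm_num), ← Real.sqrt_eq_rpow]
    norm_num
  rw [h2, Real.sqrt_mul (by norm_num)]
  have := Real.sqrt_pos.2 Real.pi_pos
  have : (0:ℝ) < √2 := by positivity
  field_simp

/-- Standardised chi-square variable with one degree of freedom. -/
noncomputable def stdChiSq (x : ℝ) : ℝ := (x ^ 2 - 1) / √2

theorem integrable_pow_gaussianReal (n : ℕ) : Integrable (fun x : ℝ => x ^ n) (gaussianReal 0 1) := by
  have := (memLp_id_gaussianReal' (μ := 0) (v := 1) (n : ENNReal) (by simp)).integrable_norm_pow'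
  refine this.mono' (by fun_prop) (ae_of_all _ fun x => by simp)

theorem integral_sq_gaussianReal : ∫ x, x ^ 2 ∂gaussianReal 0 1 = 1 := by
  have h := variance_fun_id_gaussianReal (μ := 0) (v := 1)
  rw [variance_eq_integral (by fun_prop)] at h
  simpa using h

theorem measurable_stdChiSq : Measurable stdChiSq := by unfold stdChiSq; fun_prop

/-- Second-order Taylor expansion for a law with mean 0 and variance (3 - 2 + 1)/2 = 1; the fourth
Gaussian moment enters here. -/
theorem charFun_stdChiSq_isLittleO :
    (fun t : ℝ => charFun ((gaussianReal 0 1).map stdChiSq) t - (1 - t ^ 2 / 2))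
      =o[𝓝 0] fun t => (t : ℂ) ^ 2 := by
  have h0 : (gaussianReal 0 1)[stdChiSq] = 0 := by
    simp only [stdChiSq]
    rw [integral_div, integral_sub (integrable_pow_gaussianReal 2) (by simp), integral_sq_gaussianReal]
    simp
  have h1 : (gaussianReal 0 1)[stdChiSq ^ 2] = 1 := by
    have : ∀ x, (stdChiSq ^ 2) x = (x ^ 4 - 2 * x ^ 2 + 1) / 2 := by
      intro x
      simp only [stdChiSq, Pi.pow_apply, div_pow]
      rw [Real.sq_sqrt (by norm_num)]; ring
    simp_rw [this]
    have hi : Integrable (fun x : ℝ => x ^ 4 - 2 * x ^ 2) (gaussianReal 0 1) :=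
      (integrable_pow_gaussianReal 4).sub ((integrable_pow_gaussianReal 2).const_mul 2)
    rw [integral_div, integral_add hi (by simp), integral_sub (integrable_pow_gaussianReal 4) ((integrable_pow_gaussianReal 2).const_mul 2),
      integral_const_mul, integral_sq_gaussianReal, integral_pow_four_gaussianReal]
    norm_num
  have := taylor_charFun_two measurable_stdChiSq.aemeasurable h0 h1
  refine this.trans_isBigO ?_
  exact_mod_cast Asymptotics.isBigO_of_le _ (fun x => by simp)

/-- Telescoping: the factors are exchanged one at a time, and the others have modulus at most 1. -/
theorem norm_prod_sub_prod_le {ι : Type*} (s : Finset ι) (a b : ι → ℂ)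
    (ha : ∀ i ∈ s, ‖a i‖ ≤ 1) (hb : ∀ i ∈ s, ‖b i‖ ≤ 1) :
    ‖∏ i ∈ s, a i - ∏ i ∈ s, b i‖ ≤ ∑ i ∈ s, ‖a i - b i‖ := by
  classical
  induction s using Finset.induction_on with
  | empty => simp
  | insert i s hi ih =>
    rw [Finset.prod_insert hi, Finset.prod_insert hi, Finset.sum_insert hi]
    have h1 : a i * ∏ j ∈ s, a j - b i * ∏ j ∈ s, b j
        = (a i - b i) * ∏ j ∈ s, a j + b i * (∏ j ∈ s, a j - ∏ j ∈ s, b j) := by ring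
    have h2 : ‖∏ j ∈ s, a j‖ ≤ 1 := by
      rw [norm_prod]
      exact Finset.prod_le_one (fun _ _ => norm_nonneg _)
        fun j hj => ha j (Finset.mem_insert_of_mem hj)
    have ih' := ih (fun j hj => ha j (Finset.mem_insert_of_mem hj))
      fun j hj => hb j (Finset.mem_insert_of_mem hj)
    rw [h1]
    refine (norm_add_le _ _).trans (add_le_add ?_ ?_)
    · rw [norm_mul]; exact mul_le_of_le_one_right (norm_nonneg _) h2
    · rw [norm_mul]
      exact (mul_le_of_le_one_left (norm_nonneg _) (hb i (Finset.mem_insert_self _ _))).trans ih'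

/-- The Lindeberg estimate. The characteristic function and exp(-t²/2) differ by o(t²), and the
errors add over the factors; η does not depend on their number. -/
theorem exists_prod_charFun_stdChiSq_bound {ε : ℝ} (hε : 0 < ε) :
    ∃ η > 0, ∀ {ι : Type} (s : Finset ι) (x : ι → ℝ), (∀ i ∈ s, |x i| ≤ η) →
      ‖∏ i ∈ s, charFun ((gaussianReal 0 1).map stdChiSq) (x i)
        - Complex.exp (-((∑ i ∈ s, x i ^ 2 : ℝ) : ℂ) / 2)‖ ≤ ε * ∑ i ∈ s, x i ^ 2 := by
  have hexp : (fun t : ℝ => Complex.exp (-(t : ℂ) ^ 2 / 2) - (1 - t ^ 2 / 2))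
      =o[𝓝 0] fun t : ℝ => (t : ℂ) ^ 2 := by
    have h1 : (fun z : ℂ => Complex.exp z - (1 + z)) =o[𝓝 0] fun z => z := by
      have h := (Complex.hasDerivAt_exp 0).isLittleO
      simp only [Complex.exp_zero, sub_zero, smul_eq_mul, mul_one] at h
      refine h.congr_left fun z => by ring
    have h2 : Tendsto (fun t : ℝ => -(t : ℂ) ^ 2 / 2) (𝓝 0) (𝓝 0) := by
      have : Continuous fun t : ℝ => -(t : ℂ) ^ 2 / 2 := by fun_prop
      simpa using this.tendsto 0
    have h3 := h1.comp_tendsto h2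
    have h4 : (fun t : ℝ => -(t : ℂ) ^ 2 / 2) =O[𝓝 0] fun t : ℝ => (t : ℂ) ^ 2 := by
      refine Asymptotics.isBigO_of_le _ fun t => ?_
      simp only [norm_div, norm_neg, Complex.norm_ofNat]
      linarith [norm_nonneg ((t : ℂ) ^ 2)]
    refine (h3.trans_isBigO h4).congr_left fun t => ?_
    simp only [Function.comp]; ring
  have hd := charFun_stdChiSq_isLittleO.sub hexp
  have hb := hd.bound hε
  rw [Metric.eventually_nhds_iff] at hb
  obtain ⟨η, hη, hb⟩ := hb
  -- Halving turns the open ball of radius η into a condition with ≤.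
  refine ⟨η / 2, by positivity, fun s x hx => ?_⟩
  have : IsProbabilityMeasure ((gaussianReal 0 1).map stdChiSq) :=
    Measure.isProbabilityMeasure_map measurable_stdChiSq.aemeasurable
  have he : Complex.exp (-((∑ i ∈ s, x i ^ 2 : ℝ) : ℂ) / 2)
      = ∏ i ∈ s, Complex.exp (-(x i : ℂ) ^ 2 / 2) := by
    rw [← Complex.exp_sum]; push_cast
    rw [← Finset.sum_div, Finset.sum_neg_distrib]
  rw [he]
  refine (norm_prod_sub_prod_le s _ _ (fun i _ => norm_charFun_le_one _) fun i _ => ?_).trans ?_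
  · have : (-(x i : ℂ) ^ 2 / 2) = ((-(x i) ^ 2 / 2 : ℝ) : ℂ) := by push_cast; ring
    rw [this, Complex.norm_exp_ofReal]
    exact Real.exp_le_one_iff.2 (by nlinarith [sq_nonneg (x i)])
  · rw [Finset.mul_sum]
    refine Finset.sum_le_sum fun i hi => ?_
    have := hb (y := x i) (by rw [Real.dist_eq, sub_zero]; linarith [hx i hi])
    simpa using this

/-! ### Symmetric matrices and Gaussian quadratic forms -/

-- The eigenvector equation is read at the coordinate where the eigenvector is largest in modulus,
-- as in Gershgorin's theorem.
open Matrix in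
theorem eigenvalues_abs_le_of_row_sum {ι : Type} [Fintype ι] [DecidableEq ι] {S : Matrix ι ι ℝ}
    (hS : S.IsHermitian) {R : ℝ} (hR : ∀ i, ∑ j, |S i j| ≤ R) (k : ι) :
    |hS.eigenvalues k| ≤ R := by
  set v : ι → ℝ := ⇑(hS.eigenvectorBasis k) with hv
  have hev : S *ᵥ v = hS.eigenvalues k • v := hS.mulVec_eigenvectorBasis k
  obtain ⟨i, -, hi⟩ := Finset.exists_max_image Finset.univ (fun i => |v i|) ⟨k, Finset.mem_univ k⟩
  have hpos : 0 < |v i| := by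
    by_contra hcon
    have h0 : ∀ j, v j = 0 := fun j => abs_eq_zero.1
      (le_antisymm ((hi j (Finset.mem_univ j)).trans (not_lt.1 hcon)) (abs_nonneg _))
    have : hS.eigenvectorBasis k = 0 := by ext j; exact h0 j
    exact hS.eigenvectorBasis.orthonormal.ne_zero k this
  have h1 := congrFun hev i
  simp only [Matrix.mulVec, dotProduct, Pi.smul_apply, smul_eq_mul] at h1
  have h2 : |hS.eigenvalues k| * |v i| ≤ R * |v i| := by
    rw [← abs_mul, ← h1]
    calc |∑ j, S i j * v j| ≤ ∑ j, |S i j * v j| := Finset.abs_sum_le_sum_abs _ _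
      _ ≤ ∑ j, |S i j| * |v i| := Finset.sum_le_sum fun j hj => by
          rw [abs_mul]; exact mul_le_mul_of_nonneg_left (hi j hj) (abs_nonneg _)
      _ = (∑ j, |S i j|) * |v i| := by rw [Finset.sum_mul]
      _ ≤ R * |v i| := mul_le_mul_of_nonneg_right (hR i) hpos.le
  exact le_of_mul_le_mul_right h2 hpos

/-- Both sides are the trace of S². -/
theorem sum_sq_eigenvalues {ι : Type} [Fintype ι] [DecidableEq ι] {S : Matrix ι ι ℝ}
    (hS : S.IsHermitian) : ∑ k, hS.eigenvalues k ^ 2 = ∑ i, ∑ j, S i j ^ 2 := by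
  have hsp := hS.spectral_theorem
  set U := hS.eigenvectorUnitary
  have h1 : (S * S).trace = ∑ k, hS.eigenvalues k ^ 2 := by
    have h2 : S * S = Unitary.conjStarAlgAut ℝ (Matrix ι ι ℝ) U
        (Matrix.diagonal (RCLike.ofReal ∘ hS.eigenvalues) *
          Matrix.diagonal (RCLike.ofReal ∘ hS.eigenvalues)) := by
      rw [map_mul, ← hsp]
    rw [h2, Unitary.conjStarAlgAut_apply, Matrix.trace_mul_cycle]
    simp [Matrix.diagonal_mul_diagonal, Matrix.trace_diagonal, sq]
  rw [← h1]
  simp only [Matrix.trace, Matrix.diag, Matrix.mul_apply]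
  refine Finset.sum_congr rfl fun i _ => Finset.sum_congr rfl fun j _ => ?_
  have : S j i = S i j := by simpa using hS.apply i j
  rw [this, sq]

-- A characteristic function has modulus at most 1, so the quadratic form in the exponent cannot be
-- negative.
open Matrix in
theorem posSemidef_of_charFun {Ω ι : Type*} [Fintype ι] [DecidableEq ι] [MeasurableSpace Ω]
    (P : Measure Ω) [IsProbabilityMeasure P] (Y : Ω → ι → ℝ) (S : Matrix ι ι ℝ) (hS : S.IsHermitian)
    (hchar : ∀ w : ι → ℝ, ∫ ω, Complex.exp (((∑ i, w i * Y ω i : ℝ) : ℂ) * Complex.I) ∂P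
      = Complex.exp (-((∑ i, ∑ j, w i * w j * S i j : ℝ) : ℂ) / 2)) : S.PosSemidef := by
  refine Matrix.PosSemidef.of_dotProduct_mulVec_nonneg hS fun w => ?_
  have h1 : star w ⬝ᵥ (S *ᵥ w) = ∑ i, ∑ j, w i * w j * S i j := by
    simp only [dotProduct, mulVec, Pi.star_apply, star_trivial, Finset.mul_sum]
    refine Finset.sum_congr rfl fun i _ => Finset.sum_congr rfl fun j _ => by ring
  rw [h1]
  have h2 := congrArg norm (hchar w)
  have h3 : ‖∫ ω, Complex.exp (((∑ i, w i * Y ω i : ℝ) : ℂ) * Complex.I) ∂P‖ ≤ 1 := by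
    refine (norm_integral_le_of_norm_le_const (C := 1) (ae_of_all _ fun ω => ?_)).trans ?_
    · rw [Complex.norm_exp_ofReal_mul_I]
    · simp
  rw [h2, show -((∑ i, ∑ j, w i * w j * S i j : ℝ) : ℂ) / 2
    = ((-(∑ i, ∑ j, w i * w j * S i j) / 2 : ℝ) : ℂ) by push_cast; ring,
    Complex.norm_exp_ofReal, Real.exp_le_one_iff] at h3
  linarith

open Matrix in
theorem map_toLp_eq_multivariateGaussian {Ω ι : Type*} [Fintype ι] [DecidableEq ι]
    [MeasurableSpace Ω]
    (P : Measure Ω) [IsProbabilityMeasure P] (Y : Ω → ι → ℝ) (hY : AEMeasurable Y P)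
    (S : Matrix ι ι ℝ) (hS : S.IsHermitian)
    (hchar : ∀ w : ι → ℝ, ∫ ω, Complex.exp (((∑ i, w i * Y ω i : ℝ) : ℂ) * Complex.I) ∂P
      = Complex.exp (-((∑ i, ∑ j, w i * w j * S i j : ℝ) : ℂ) / 2)) :
    P.map (fun ω => WithLp.toLp 2 (Y ω)) = multivariateGaussian 0 S := by
  have hps := posSemidef_of_charFun P Y S hS hchar
  have hm : AEMeasurable (fun ω => WithLp.toLp 2 (Y ω)) P :=
    (WithLp.measurable_toLp 2 (ι → ℝ)).comp_aemeasurable hY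
  have : IsProbabilityMeasure (P.map (fun ω => WithLp.toLp 2 (Y ω))) :=
    Measure.isProbabilityMeasure_map hm
  refine Measure.ext_of_charFun (funext fun w => ?_)
  rw [charFun_multivariateGaussian hps, charFun_apply, integral_map hm (by fun_prop)]
  have h1 : ∀ ω, inner ℝ (WithLp.toLp 2 (Y ω)) w = ∑ i, w i * Y ω i := by
    intro ω; simp [PiLp.inner_apply]
  simp_rw [h1]
  rw [hchar w.ofLp]
  congr 1
  simp only [inner_zero_right, Complex.ofReal_zero, zero_mul, zero_sub, neg_div]
  congr 3
  simp only [dotProduct, mulVec, Finset.mul_sum]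
  refine Finset.sum_congr rfl fun i _ => Finset.sum_congr rfl fun j _ => by ring

-- Write y = √S x with x standard Gaussian, and take coordinates of x in an eigenbasis of S. Then
-- |y|² = Σ μ_i x_i², whence |y|² - tr S = Σ √2 μ_i ξ_i with independent ξ_i of law `stdChiSq`.
open Matrix MatrixOrder in
theorem charFun_sum_sq_multivariateGaussian {ι : Type} [Fintype ι] [DecidableEq ι]
    {S : Matrix ι ι ℝ} (hS : S.PosSemidef) (t : ℝ) :
    ∫ y, Complex.exp (((t * (∑ i, y i ^ 2 - S.trace) : ℝ) : ℂ) * Complex.I)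
        ∂(multivariateGaussian 0 S)
      = ∏ i, charFun ((gaussianReal 0 1).map stdChiSq) (√2 * t * hS.1.eigenvalues i) := by
  set b := hS.1.eigenvectorBasis
  set μ := hS.1.eigenvalues
  have hq : ∀ x : ι → ℝ, ∑ k, (toEuclideanCLM (𝕜 := ℝ) (CFC.sqrt S) (∑ i, x i • b i)) k ^ 2
      = ∑ i, μ i * x i ^ 2 := by
    intro x
    have e1 : ∀ z : EuclideanSpace ℝ ι, ∑ k, z k ^ 2 = inner ℝ z z := by
      intro z; simp only [PiLp.inner_apply, sq]; rfl
    have hSb : toEuclideanCLM (𝕜 := ℝ) S (∑ i, x i • b i) = ∑ i, (μ i * x i) • b i := by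
      rw [map_sum]
      refine Finset.sum_congr rfl fun i _ => ?_
      rw [map_smul]
      have : toEuclideanCLM (𝕜 := ℝ) S (b i) = μ i • b i := by
        ext k
        have := congrFun (hS.1.mulVec_eigenvectorBasis i) k
        simpa [Matrix.ofLp_toEuclideanCLM] using this
      rw [this, smul_smul, mul_comm]
    rw [e1, ← ContinuousLinearMap.adjoint_inner_right, IsSelfAdjoint.adjoint_eq,
      ← ContinuousLinearMap.comp_apply, ← ContinuousLinearMap.mul_def, ← map_mul,
      CFC.sqrt_mul_sqrt_self _ hS.nonneg, hSb]
    · rw [b.orthonormal.inner_sum]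
      simp only [conj_trivial]
      exact Finset.sum_congr rfl fun i _ => by ring
    · exact (CFC.sqrt_nonneg S).isSelfAdjoint.map _
  have htr : S.trace = ∑ i, μ i := by simpa using hS.1.trace_eq_sum_eigenvalues
  rw [multivariateGaussian, integral_map (by fun_prop) (by fun_prop),
    stdGaussian_eq_map_pi_orthonormalBasis b,
    integral_map (Measurable.aemeasurable (by fun_prop)) (by fun_prop)]
  simp only [zero_add, hq, htr]
  have hprod : ∀ x : ι → ℝ,
      Complex.exp (((t * (∑ i, μ i * x i ^ 2 - ∑ i, μ i) : ℝ) : ℂ) * Complex.I)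
      = ∏ i, Complex.exp (((√2 * t * μ i : ℝ) : ℂ) * (stdChiSq (x i) : ℂ) * Complex.I) := by
    intro x
    rw [← Complex.exp_sum, ← Finset.sum_mul]
    congr 2
    rw [← Finset.sum_sub_distrib, Finset.mul_sum, Complex.ofReal_sum]
    refine Finset.sum_congr rfl fun i _ => ?_
    rw [← Complex.ofReal_mul]
    congr 1
    have : (0:ℝ) < √2 := by positivity
    simp only [stdChiSq]; field_simp
  simp_rw [hprod]
  rw [integral_fintype_prod_eq_prod
    (f := fun i (y : ℝ) => Complex.exp (((√2 * t * μ i : ℝ) : ℂ) * (stdChiSq y : ℂ) * Complex.I))]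
  refine Finset.prod_congr rfl fun i _ => ?_
  rw [charFun_apply_real, integral_map measurable_stdChiSq.aemeasurable (by fun_prop)]

/-! ### Nearly Toeplitz covariances on growing grids -/

/-- A finite set carries all but ε² of the square sum and gives C; the remainder is handled by
Cauchy-Schwarz. This makes row sums o(√(MN)) for v that is only square summable. -/
theorem exists_sum_abs_le_of_summable_sq {α : Type*} {v : α → ℝ}
    (hv : Summable fun z => v z ^ 2) {ε : ℝ} (hε : 0 < ε) :
    ∃ C : ℝ, ∀ s : Finset α, ∑ z ∈ s, |v z| ≤ C + ε * √(s.card : ℝ) := by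
  classical
  obtain ⟨F, hF⟩ := (summable_iff_vanishing_norm.1 hv) (ε ^ 2) (by positivity)
  refine ⟨∑ z ∈ F, |v z|, fun s => ?_⟩
  rw [← Finset.sum_inter_add_sum_sdiff s F]
  refine add_le_add (Finset.sum_le_sum_of_subset_of_nonneg Finset.inter_subset_right
    fun _ _ _ => abs_nonneg _) ?_
  have h1 := hF (s \ F) Finset.sdiff_disjoint
  rw [Real.norm_of_nonneg (Finset.sum_nonneg fun _ _ => sq_nonneg _)] at h1
  have h2 := sq_sum_le_card_mul_sum_sq (s := s \ F) (f := fun z => |v z|)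
  simp only [sq_abs] at h2
  have h3 : ((s \ F).card : ℝ) ≤ s.card := by
    exact_mod_cast Finset.card_le_card Finset.sdiff_subset
  refine abs_le_of_sq_le_sq' ?_ (by positivity) |>.2
  rw [mul_pow, Real.sq_sqrt (by positivity)]
  calc _ ≤ _ := h2
    _ ≤ (s.card : ℝ) * ε ^ 2 := mul_le_mul h3 h1.le (Finset.sum_nonneg fun _ _ => sq_nonneg _)
        (by positivity)
    _ = _ := by ring

/-- Difference of two grid indices, as an integer vector. -/
def gridSub {N M : ℕ} (p q : Fin N × Fin M) : ℤ × ℤ :=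
  ((p.1 : ℤ) - (q.1 : ℤ), (p.2 : ℤ) - (q.2 : ℤ))

theorem gridSub_injective {N M : ℕ} (p : Fin N × Fin M) : Function.Injective (gridSub p) := by
  rintro ⟨a, b⟩ ⟨c, d⟩ h
  simp only [gridSub, Prod.mk.injEq] at h
  ext <;> simp <;> omega

theorem sum_gridSub_eq {N M : ℕ} (p : Fin N × Fin M) (f : ℤ × ℤ → ℝ) :
    ∑ q, f (gridSub p q) = ∑ z ∈ Finset.univ.image (gridSub p), f z := by
  rw [Finset.sum_image fun _ _ _ _ h => gridSub_injective p h]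

theorem sub_le_card_interior (N K : ℕ) :
    (N : ℝ) - 2 * K ≤ (Finset.univ.filter fun i : Fin N => K ≤ (i : ℕ) ∧ (i : ℕ) + K < N).card := by
  have h : N - 2 * K ≤ (Finset.univ.filter fun i : Fin N => K ≤ (i : ℕ) ∧ (i : ℕ) + K < N).card := by
    have := Finset.card_le_card_of_injOn (s := (Finset.univ : Finset (Fin (N - 2 * K))))
      (t := Finset.univ.filter fun i : Fin N => K ≤ (i : ℕ) ∧ (i : ℕ) + K < N)
      (fun i => ⟨i + K, by omega⟩) (fun i _ => by simp; omega)
      (fun i _ j _ h => by simp only [Fin.mk.injEq] at h; ext; omega)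
    simpa using this
  have h2 : N ≤ (Finset.univ.filter fun i : Fin N => K ≤ (i : ℕ) ∧ (i : ℕ) + K < N).card + 2 * K := by
    omega
  have h3 : (N : ℝ) ≤ (Finset.univ.filter fun i : Fin N => K ≤ (i : ℕ) ∧ (i : ℕ) + K < N).card
      + 2 * K := by exact_mod_cast h2
  linarith

/-- Each row is a partial sum of the series, which gives the upper bound. For the lower one, rows at
distance at least K from the border see every difference in a fixed finite set F, and they make up a
proportion tending to 1. -/
theorem tendsto_average_gridSub {M N : ℕ → ℕ} (hM : Tendsto M atTop atTop)
    (hN : Tendsto N atTop atTop) {f : ℤ × ℤ → ℝ} (hf0 : ∀ z, 0 ≤ f z) (hf : Summable f) :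
    Tendsto (fun n => 1 / ((M n : ℝ) * N n) *
      ∑ p : Fin (N n) × Fin (M n), ∑ q, f (gridSub p q)) atTop (𝓝 (∑' z, f z)) := by
  have hMr : Tendsto (fun n => (M n : ℝ)) atTop atTop := tendsto_natCast_atTop_atTop.comp hM
  have hNr : Tendsto (fun n => (N n : ℝ)) atTop atTop := tendsto_natCast_atTop_atTop.comp hN
  have hup : ∀ᶠ n in atTop, 1 / ((M n : ℝ) * N n) *
      ∑ p : Fin (N n) × Fin (M n), ∑ q, f (gridSub p q) ≤ ∑' z, f z := by
    filter_upwards [hMr.eventually_gt_atTop 0, hNr.eventually_gt_atTop 0] with n h1 h2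
    rw [one_div, inv_mul_le_iff₀ (by positivity)]
    calc _ ≤ ∑ p : Fin (N n) × Fin (M n), ∑' z, f z := Finset.sum_le_sum fun p _ => by
          rw [sum_gridSub_eq]; exact hf.sum_le_tsum _ fun _ _ => hf0 _
      _ = _ := by
          rw [Finset.sum_const, nsmul_eq_mul, Finset.card_univ, Fintype.card_prod, Fintype.card_fin,
            Fintype.card_fin]
          push_cast; ring
  refine tendsto_order.2 ⟨fun a ha => ?_, fun a ha => hup.mono fun n hn => hn.trans_lt ha⟩
  obtain ⟨F, hF⟩ := ((tendsto_order.1 hf.hasSum).1 a ha).exists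
  -- Any common bound will do; the sum of all absolute coordinates avoids a maximum over a possibly
  -- empty set.
  obtain ⟨K, hK⟩ : ∃ K : ℕ, ∀ z ∈ F, |z.1| ≤ K ∧ |z.2| ≤ K := by
    refine ⟨∑ z ∈ F, (z.1.natAbs + z.2.natAbs), fun z hz => ?_⟩
    have := Finset.single_le_sum (f := fun z : ℤ × ℤ => z.1.natAbs + z.2.natAbs)
      (fun _ _ => Nat.zero_le _) hz
    rw [abs_le, abs_le]
    constructor <;> omega
  have hlow : ∀ᶠ n in atTop, (1 - 2 * K / (N n : ℝ)) * (1 - 2 * K / (M n : ℝ)) * ∑ z ∈ F, f z ≤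
      1 / ((M n : ℝ) * N n) * ∑ p : Fin (N n) × Fin (M n), ∑ q, f (gridSub p q) := by
    filter_upwards [hMr.eventually_gt_atTop (2 * K), hNr.eventually_gt_atTop (2 * K)] with n h1 h2
    have hM0 : (0:ℝ) < M n := lt_of_le_of_lt (by positivity) h1
    have hN0 : (0:ℝ) < N n := lt_of_le_of_lt (by positivity) h2
    set A := Finset.univ.filter fun i : Fin (N n) => K ≤ (i : ℕ) ∧ (i : ℕ) + K < N n
    set B := Finset.univ.filter fun i : Fin (M n) => K ≤ (i : ℕ) ∧ (i : ℕ) + K < M n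
    have hA := sub_le_card_interior (N n) K
    have hB := sub_le_card_interior (M n) K
    have hs0 : 0 ≤ ∑ z ∈ F, f z := Finset.sum_nonneg fun _ _ => hf0 _
    have h3 : ((A ×ˢ B).card : ℝ) * ∑ z ∈ F, f z ≤
        ∑ p : Fin (N n) × Fin (M n), ∑ q, f (gridSub p q) := by
      calc ((A ×ˢ B).card : ℝ) * ∑ z ∈ F, f z = ∑ p ∈ A ×ˢ B, ∑ z ∈ F, f z := by
            rw [Finset.sum_const, nsmul_eq_mul]
        _ ≤ ∑ p ∈ A ×ˢ B, ∑ q, f (gridSub p q) := Finset.sum_le_sum fun p hp => by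
            rw [sum_gridSub_eq]
            refine Finset.sum_le_sum_of_subset_of_nonneg (fun z hz => ?_) fun _ _ _ => hf0 _
            obtain ⟨hz1, hz2⟩ := hK z hz
            rw [abs_le] at hz1 hz2
            simp only [Finset.mem_product, A, B, Finset.mem_filter, Finset.mem_univ, true_and] at hp
            simp only [Finset.mem_image, Finset.mem_univ, true_and]
            refine ⟨(⟨((p.1 : ℤ) - z.1).toNat, by omega⟩, ⟨((p.2 : ℤ) - z.2).toNat, by omega⟩), ?_⟩
            simp only [gridSub]
            ext <;> simp <;> omega
        _ ≤ _ := Finset.sum_le_sum_of_subset_of_nonneg (Finset.subset_univ _)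
            fun _ _ _ => Finset.sum_nonneg fun _ _ => hf0 _
    have h4 : ((N n : ℝ) - 2 * K) * ((M n : ℝ) - 2 * K) ≤ ((A ×ˢ B).card : ℝ) := by
      rw [Finset.card_product]; push_cast
      exact mul_le_mul hA hB (by linarith) (by positivity)
    rw [one_div, le_inv_mul_iff₀ (by positivity)]
    refine le_trans (le_of_eq ?_) ((mul_le_mul_of_nonneg_right h4 hs0).trans h3)
    field_simp
  have hlim : Tendsto (fun n => (1 - 2 * K / (N n : ℝ)) * (1 - 2 * K / (M n : ℝ)) * ∑ z ∈ F, f z)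
      atTop (𝓝 ((1 - 0) * (1 - 0) * ∑ z ∈ F, f z)) :=
    ((tendsto_const_nhds.sub (hNr.const_div_atTop _)).mul
      (tendsto_const_nhds.sub (hMr.const_div_atTop _))).mul_const _
  rw [sub_zero, one_mul, one_mul] at hlim
  filter_upwards [hlow, (tendsto_order.1 hlim).1 a hF] with n h1 h2 using h2.trans_le h1

/-- Expand the square and apply Cauchy-Schwarz to the cross term: a perturbation that is small in
mean square hardly changes a mean square. -/
theorem abs_mean_sq_sub_le {κ : Type*} [Fintype κ] {m D : ℝ} (hm : 0 < m) (w e : κ → ℝ)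
    (hD : 1 / m * ∑ x, e x ^ 2 ≤ D) :
    |1 / m * ∑ x, (w x + e x) ^ 2 - 1 / m * ∑ x, w x ^ 2|
      ≤ 2 * √((1 / m * ∑ x, w x ^ 2) * D) + D := by
  have e3 : 1 / m * ∑ x, (w x + e x) ^ 2 - 1 / m * ∑ x, w x ^ 2
      = 2 * (1 / m * ∑ x, w x * e x) + 1 / m * ∑ x, e x ^ 2 := by
    have : ∑ x, (w x + e x) ^ 2 = ∑ x, w x ^ 2 + 2 * ∑ x, w x * e x + ∑ x, e x ^ 2 := by
      rw [Finset.mul_sum, ← Finset.sum_add_distrib, ← Finset.sum_add_distrib]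
      exact Finset.sum_congr rfl fun x _ => by ring
    rw [this]; ring
  have h0 : 0 ≤ 1 / m * ∑ x, e x ^ 2 :=
    mul_nonneg (by positivity) (Finset.sum_nonneg fun _ _ => sq_nonneg _)
  have h4 : |1 / m * ∑ x, w x * e x| ≤ √((1 / m * ∑ x, w x ^ 2) * D) := by
    refine Real.abs_le_sqrt ?_
    calc (1 / m * ∑ x, w x * e x) ^ 2 = (1 / m) ^ 2 * (∑ x, w x * e x) ^ 2 := by ring
      _ ≤ (1 / m) ^ 2 * ((∑ x, w x ^ 2) * ∑ x, e x ^ 2) :=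
          mul_le_mul_of_nonneg_left (Finset.sum_mul_sq_le_sq_mul_sq _ _ _) (by positivity)
      _ = (1 / m * ∑ x, w x ^ 2) * (1 / m * ∑ x, e x ^ 2) := by ring
      _ ≤ _ := mul_le_mul_of_nonneg_left hD
          (mul_nonneg (by positivity) (Finset.sum_nonneg fun _ _ => sq_nonneg _))
  rw [e3]
  calc _ ≤ |2 * (1 / m * ∑ x, w x * e x)| + |1 / m * ∑ x, e x ^ 2| := abs_add_le _ _
    _ ≤ _ := by
      rw [abs_mul, abs_of_nonneg h0, abs_two]
      exact add_le_add (mul_le_mul_of_nonneg_left h4 (by norm_num)) hD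

theorem abs_sum_sq_sub_mean_le {ι : Type*} [Fintype ι] {m ε : ℝ} (hm : 0 < m)
    (hcard : (Fintype.card ι : ℝ) = m) (S g : ι → ι → ℝ) (h : ∀ p q, |√m * S p q - g p q| ≤ ε) :
    |∑ p, ∑ q, S p q ^ 2 - 1 / m * ∑ p, ∑ q, g p q ^ 2|
      ≤ 2 * √((1 / m * ∑ p, ∑ q, g p q ^ 2) * (ε * √m) ^ 2) + (ε * √m) ^ 2 := by
  have e1 : ∑ p, ∑ q, S p q ^ 2 =
      1 / m * ∑ x : ι × ι, (g x.1 x.2 + (√m * S x.1 x.2 - g x.1 x.2)) ^ 2 := by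
    rw [Fintype.sum_prod_type, Finset.mul_sum]
    refine Finset.sum_congr rfl fun p _ => ?_
    rw [Finset.mul_sum]
    refine Finset.sum_congr rfl fun q _ => ?_
    rw [add_sub_cancel, mul_pow, Real.sq_sqrt hm.le]
    field_simp
  have e2 : ∑ p, ∑ q, g p q ^ 2 = ∑ x : ι × ι, g x.1 x.2 ^ 2 := by rw [Fintype.sum_prod_type]
  rw [e1, e2]
  refine abs_mean_sq_sub_le hm _ _ ?_
  have h3 : ∑ x : ι × ι, (√m * S x.1 x.2 - g x.1 x.2) ^ 2 ≤ ∑ _x : ι × ι, ε ^ 2 :=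
    Finset.sum_le_sum fun x _ =>
      sq_le_sq' (abs_le.1 (h x.1 x.2)).1 (abs_le.1 (h x.1 x.2)).2
  rw [Finset.sum_const, nsmul_eq_mul, Finset.card_univ, Fintype.card_prod] at h3
  push_cast at h3
  rw [hcard] at h3
  rw [one_div, inv_mul_le_iff₀ hm]
  refine h3.trans (le_of_eq ?_)
  rw [mul_pow, Real.sq_sqrt hm.le]; ring

theorem tendsto_sum_sq_of_toeplitz {M N : ℕ → ℕ} (hM : Tendsto M atTop atTop)
    (hN : Tendsto N atTop atTop) {v : ℤ × ℤ → ℝ} (hv : Summable fun z => v z ^ 2)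
    (S : ∀ n, Matrix (Fin (N n) × Fin (M n)) (Fin (N n) × Fin (M n)) ℝ) (ε : ℕ → ℝ)
    (hε : Tendsto (fun n => ε n * √((M n : ℝ) * N n)) atTop (𝓝 0))
    (hS : ∀ n p q, |√((M n : ℝ) * N n) * S n p q - v (gridSub p q)| ≤ ε n) :
    Tendsto (fun n => ∑ p, ∑ q, S n p q ^ 2) atTop (𝓝 (∑' z, v z ^ 2)) := by
  have hMr : Tendsto (fun n => (M n : ℝ)) atTop atTop := tendsto_natCast_atTop_atTop.comp hM
  have hNr : Tendsto (fun n => (N n : ℝ)) atTop atTop := tendsto_natCast_atTop_atTop.comp hN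
  set A : ℕ → ℝ := fun n => 1 / ((M n : ℝ) * N n) *
      ∑ p : Fin (N n) × Fin (M n), ∑ q, v (gridSub p q) ^ 2
  have hA : Tendsto A atTop (𝓝 (∑' z, v z ^ 2)) :=
    tendsto_average_gridSub hM hN (f := fun z => v z ^ 2) (fun _ => sq_nonneg _) hv
  set D : ℕ → ℝ := fun n => (ε n * √((M n : ℝ) * N n)) ^ 2
  have hD : Tendsto D atTop (𝓝 0) := by
    have h := hε.pow 2
    rwa [zero_pow two_ne_zero] at h
  have hlim : Tendsto (fun n => 2 * √(A n * D n) + D n) atTop (𝓝 0) := by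
    have := (((hA.mul hD).sqrt).const_mul 2).add hD
    simpa using this
  have hdiff : ∀ᶠ n in atTop, ‖∑ p, ∑ q, S n p q ^ 2 - A n‖ ≤ 2 * √(A n * D n) + D n := by
    filter_upwards [hMr.eventually_gt_atTop 0, hNr.eventually_gt_atTop 0] with n h1 h2
    have hm : 0 < (M n : ℝ) * N n := by positivity
    have hcard : (Fintype.card (Fin (N n) × Fin (M n)) : ℝ) = (M n : ℝ) * N n := by simp [mul_comm]
    rw [Real.norm_eq_abs]
    exact abs_sum_sq_sub_mean_le hm hcard (S n) (fun p q => v (gridSub p q)) (hS n)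
  have h := (squeeze_zero_norm' hdiff hlim).add hA
  rw [zero_add] at h
  exact h.congr fun n => sub_add_cancel _ _

/-- Multiplied by √(MN), a row sum is at most C + (η/2)√(MN) + MN ε; dividing by √(MN) leaves η/2
plus a null sequence. By `eigenvalues_abs_le_of_row_sum` all eigenvalues then tend to 0 uniformly.
-/
theorem eventually_row_sum_le_of_toeplitz {M N : ℕ → ℕ} (hM : Tendsto M atTop atTop)
    (hN : Tendsto N atTop atTop) {v : ℤ × ℤ → ℝ} (hv : Summable fun z => v z ^ 2)
    (S : ∀ n, Matrix (Fin (N n) × Fin (M n)) (Fin (N n) × Fin (M n)) ℝ) (ε : ℕ → ℝ)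
    (hε : Tendsto (fun n => ε n * √((M n : ℝ) * N n)) atTop (𝓝 0))
    (hS : ∀ n p q, |√((M n : ℝ) * N n) * S n p q - v (gridSub p q)| ≤ ε n) {η : ℝ} (hη : 0 < η) :
    ∀ᶠ n in atTop, ∀ p, ∑ q, |S n p q| ≤ η := by
  have hMr : Tendsto (fun n => (M n : ℝ)) atTop atTop := tendsto_natCast_atTop_atTop.comp hM
  have hNr : Tendsto (fun n => (N n : ℝ)) atTop atTop := tendsto_natCast_atTop_atTop.comp hN
  obtain ⟨C, hC⟩ := exists_sum_abs_le_of_summable_sq hv (half_pos hη)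
  have hsq : Tendsto (fun n => √((M n : ℝ) * N n)) atTop atTop :=
    Real.tendsto_sqrt_atTop.comp (hMr.atTop_mul_atTop₀ hNr)
  have hlim : Tendsto (fun n => C / √((M n : ℝ) * N n) + ε n * √((M n : ℝ) * N n))
      atTop (𝓝 0) := by simpa using (hsq.const_div_atTop C).add hε
  filter_upwards [hsq.eventually_gt_atTop 0, (tendsto_order.1 hlim).2 _ (half_pos hη)]
    with n h1 h2 p
  set s := √((M n : ℝ) * N n) with hs
  have hss : s * s = (M n : ℝ) * N n := Real.mul_self_sqrt (by positivity)
  have h3 : s * ∑ q, |S n p q| ≤ C + η / 2 * s + s * s * ε n := by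
    rw [Finset.mul_sum]
    calc ∑ q, s * |S n p q| ≤ ∑ q, (|v (gridSub p q)| + ε n) := Finset.sum_le_sum fun q _ => by
          have h5 : s * |S n p q| = |s * S n p q| := by rw [abs_mul, abs_of_pos h1]
          have := abs_sub_abs_le_abs_sub (s * S n p q) (v (gridSub p q))
          linarith [hS n p q]
      _ = ∑ z ∈ Finset.univ.image (gridSub p), |v z| + s * s * ε n := by
          rw [Finset.sum_add_distrib, sum_gridSub_eq p (fun z => |v z|), hss]
          simp [mul_comm]
      _ ≤ _ := by
          have h4 := hC (Finset.univ.image (gridSub p))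
          rw [Finset.card_image_of_injective _ (gridSub_injective p), Finset.card_univ,
            Fintype.card_prod, Fintype.card_fin, Fintype.card_fin] at h4
          push_cast at h4
          rw [mul_comm (N n : ℝ), ← hs] at h4
          linarith
  have h5 : s * ∑ q, |S n p q| ≤ s * (C / s + η / 2 + ε n * s) := by
    refine h3.trans (le_of_eq ?_)
    field_simp
  have := le_of_mul_le_mul_left h5 h1
  linarith

/-! ### Central limit theorem for sums of squares -/

/-- The characteristic function is a phase, carrying the difference between trace and centring,
times a product over the eigenvalues. The phase tends to 1 and the product is compared with exp(-Σ
x_i²/2), where x_i = √2 t μ_i. -/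
theorem tendstoInDistribution_sum_sq_of_toeplitz {Ω : Type*} [MeasurableSpace Ω] (P : Measure Ω)
    [IsProbabilityMeasure P] {M N : ℕ → ℕ} (hM : Tendsto M atTop atTop)
    (hN : Tendsto N atTop atTop) {v : ℤ × ℤ → ℝ} (hv : Summable fun z => v z ^ 2)
    (Y : ∀ n, Ω → Fin (N n) × Fin (M n) → ℝ) (hY : ∀ n, AEMeasurable (Y n) P)
    (S : ∀ n, Matrix (Fin (N n) × Fin (M n)) (Fin (N n) × Fin (M n)) ℝ)
    (hSh : ∀ n, (S n).IsHermitian)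
    (hchar : ∀ n (w : Fin (N n) × Fin (M n) → ℝ),
      ∫ ω, Complex.exp (((∑ i, w i * Y n ω i : ℝ) : ℂ) * Complex.I) ∂P
        = Complex.exp (-((∑ i, ∑ j, w i * w j * S n i j : ℝ) : ℂ) / 2))
    (ε : ℕ → ℝ) (hε : Tendsto (fun n => ε n * √((M n : ℝ) * N n)) atTop (𝓝 0))
    (hS : ∀ n p q, |√((M n : ℝ) * N n) * S n p q - v (gridSub p q)| ≤ ε n) :
    TendstoInDistribution
      (fun n ω => ∑ p, Y n ω p ^ 2 - √((M n : ℝ) * N n) * v 0) atTop (id : ℝ → ℝ) (fun _ => P)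
      (gaussianReal 0 (Real.toNNReal (2 * ∑' z, v z ^ 2))) := by
  set V := ∑' z, v z ^ 2
  have hV0 : 0 ≤ V := tsum_nonneg fun _ => sq_nonneg _
  have hmeas : ∀ n, AEMeasurable (fun ω => ∑ p, Y n ω p ^ 2 - √((M n : ℝ) * N n) * v 0) P :=
    fun n => (Finset.aemeasurable_fun_sum _ fun p _ =>
      ((measurable_pi_apply p).comp_aemeasurable (hY n)).pow_const 2).sub_const _
  refine ⟨hmeas, by fun_prop, ?_⟩
  refine ProbabilityMeasure.tendsto_iff_tendsto_charFun.2 fun t => ?_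
  simp only [ProbabilityMeasure.coe_mk, Measure.map_id, charFun_gaussianReal]
  have hMr : Tendsto (fun n => (M n : ℝ)) atTop atTop := tendsto_natCast_atTop_atTop.comp hM
  have hNr : Tendsto (fun n => (N n : ℝ)) atTop atTop := tendsto_natCast_atTop_atTop.comp hN
  set c : ℕ → ℝ := fun n => √((M n : ℝ) * N n)
  have hps := fun n => posSemidef_of_charFun P (Y n) (S n) (hSh n) (hchar n)
  set x : ∀ n, Fin (N n) × Fin (M n) → ℝ := fun n i => √2 * t * (hps n).1.eigenvalues i
  have hcf : ∀ n, charFun (P.map fun ω => ∑ p, Y n ω p ^ 2 - c n * v 0) t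
      = Complex.exp (((t * ((S n).trace - c n * v 0) : ℝ) : ℂ) * Complex.I) *
        ∏ i, charFun ((gaussianReal 0 1).map stdChiSq) (x n i) := by
    intro n
    have hm1 : AEMeasurable (fun ω => WithLp.toLp 2 (Y n ω)) P :=
      (WithLp.measurable_toLp 2 _).comp_aemeasurable (hY n)
    rw [← charFun_sum_sq_multivariateGaussian (hps n) t,
      ← map_toLp_eq_multivariateGaussian P (Y n) (hY n) (S n) (hSh n) (hchar n),
      integral_map hm1 (by fun_prop),
      charFun_apply_real, integral_map (hmeas n) (by fun_prop), ← integral_const_mul]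
    refine integral_congr_ae (ae_of_all _ fun ω => ?_)
    simp only []
    rw [← Complex.exp_add]
    congr 1
    push_cast
    ring
  -- The trace has MN diagonal entries, each within ε/√(MN) of v(0)/√(MN), so the total error is
  -- ε√(MN).
  have htr : Tendsto (fun n => (S n).trace - c n * v 0) atTop (𝓝 0) := by
    refine squeeze_zero_norm' ?_ hε
    filter_upwards [hMr.eventually_gt_atTop 0, hNr.eventually_gt_atTop 0] with n h1 h2
    have hm : 0 < (M n : ℝ) * N n := by positivity
    have hc : 0 < c n := Real.sqrt_pos.2 hm
    have hcc : c n * c n = (M n : ℝ) * N n := Real.mul_self_sqrt hm.le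
    have h3 : (S n).trace - c n * v 0
        = (∑ p, (c n * S n p p - v (gridSub p p))) / c n := by
      have hz : ∀ p : Fin (N n) × Fin (M n), v (gridSub p p) = v 0 := fun p => by
        simp [gridSub]; rfl
      simp only [hz, Finset.sum_sub_distrib, Finset.sum_const, ← Finset.mul_sum, Finset.card_univ,
        Fintype.card_prod, Fintype.card_fin, nsmul_eq_mul, Matrix.trace, Matrix.diag]
      push_cast
      rw [mul_comm (N n : ℝ), ← hcc]
      field_simp
    rw [h3, Real.norm_eq_abs, abs_div, abs_of_pos hc, div_le_iff₀ hc]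
    calc _ ≤ ∑ p, |c n * S n p p - v (gridSub p p)| := Finset.abs_sum_le_sum_abs _ _
      _ ≤ ∑ _p : Fin (N n) × Fin (M n), ε n := Finset.sum_le_sum fun p _ => hS n p p
      _ = ε n * (c n * c n) := by
        rw [hcc, Finset.sum_const, Finset.card_univ, Fintype.card_prod, Fintype.card_fin,
          Fintype.card_fin, nsmul_eq_mul]
        push_cast; ring
      _ = _ := by ring
  have hx2 : Tendsto (fun n => ∑ i, x n i ^ 2) atTop (𝓝 (2 * t ^ 2 * V)) := by
    have := (tendsto_sum_sq_of_toeplitz hM hN hv S ε hε hS).const_mul (2 * t ^ 2)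
    refine this.congr fun n => ?_
    rw [← sum_sq_eigenvalues (hps n).1, Finset.mul_sum]
    refine Finset.sum_congr rfl fun i _ => ?_
    simp only [x, mul_pow, Real.sq_sqrt (show (0:ℝ) ≤ 2 by norm_num)]
  have hprod : Tendsto (fun n => ∏ i, charFun ((gaussianReal 0 1).map stdChiSq) (x n i)
      - Complex.exp (-((∑ i, x n i ^ 2 : ℝ) : ℂ) / 2)) atTop (𝓝 0) := by
    rw [tendsto_zero_iff_norm_tendsto_zero]
    refine tendsto_order.2 ⟨fun a ha => Eventually.of_forall fun n => ha.trans_le (norm_nonneg _),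
      fun a ha => ?_⟩
    have hW : 0 < 2 * t ^ 2 * V + 1 := by positivity
    obtain ⟨η, hη, hb⟩ := exists_prod_charFun_stdChiSq_bound
      (show 0 < a / (2 * t ^ 2 * V + 1) by positivity)
    -- This threshold forces |x_i| = √2 |t| |μ_i| ≤ η; the added 1 covers t = 0.
    have hr := eventually_row_sum_le_of_toeplitz hM hN hv S ε hε hS
      (show 0 < η / (√2 * |t| + 1) by positivity)
    filter_upwards [hr, (tendsto_order.1 hx2).2 _ (lt_add_one _)] with n h1 h2
    refine (hb Finset.univ (x n) fun i _ => ?_).trans_lt ?_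
    · have := eigenvalues_abs_le_of_row_sum (hps n).1 h1 i
      simp only [x, abs_mul, abs_of_pos (show (0:ℝ) < √2 by positivity)]
      calc _ ≤ √2 * |t| * (η / (√2 * |t| + 1)) :=
            mul_le_mul_of_nonneg_left this (by positivity)
        _ ≤ (√2 * |t| + 1) * (η / (√2 * |t| + 1)) :=
            mul_le_mul_of_nonneg_right (by linarith) (by positivity)
        _ = η := by field_simp
    · calc _ < a / (2 * t ^ 2 * V + 1) * (2 * t ^ 2 * V + 1) :=
            mul_lt_mul_of_pos_left h2 (by positivity)
        _ = a := by field_simp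
  have hexp : Tendsto (fun n => Complex.exp (-((∑ i, x n i ^ 2 : ℝ) : ℂ) / 2)) atTop
      (𝓝 (Complex.exp (-((2 * t ^ 2 * V : ℝ) : ℂ) / 2))) := by
    have hcont : Continuous fun y : ℝ => Complex.exp (-(y : ℂ) / 2) := by fun_prop
    exact (hcont.tendsto _).comp hx2
  have hph : Tendsto (fun n => Complex.exp (((t * ((S n).trace - c n * v 0) : ℝ) : ℂ) * Complex.I))
      atTop (𝓝 1) := by
    have hcont : Continuous fun y : ℝ => Complex.exp (((t * y : ℝ) : ℂ) * Complex.I) := by fun_prop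
    rw [show (1:ℂ) = Complex.exp (((t * 0 : ℝ) : ℂ) * Complex.I) by simp]
    exact (hcont.tendsto 0).comp htr
  have hfin := hph.mul (hprod.add hexp)
  rw [one_mul, zero_add] at hfin
  refine (hfin.congr fun n => ?_).trans (le_of_eq ?_)
  · rw [hcf n, sub_add_cancel]
  · congr 2
    have : ((2 * V).toNNReal : ℂ) = ((2 * V : ℝ) : ℂ) := by
      rw [← Real.coe_toNNReal (2 * V) (by positivity)]; simp
    rw [this]; push_cast; ring

/-! ### Bounds for the heat kernel -/

/-- The heat kernel `(4πs)^{-1/2} exp(-w²/(4s))`; it vanishes for `s ≤ 0`. -/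
noncomputable def heatK (s w : ℝ) : ℝ := (√(4 * Real.pi * s))⁻¹ * Real.exp (-w ^ 2 / (4 * s))

theorem heatK_zero (w : ℝ) : heatK 0 w = 0 := by simp [heatK]

theorem heatK_nonneg (s w : ℝ) : 0 ≤ heatK s w := by unfold heatK; positivity

theorem heatK_abs (s w : ℝ) : heatK s |w| = heatK s w := by simp [heatK]

theorem inv_sqrt_four_pi_le {s : ℝ} (hs : 0 < s) : (√(4 * Real.pi * s))⁻¹ ≤ (√s)⁻¹ := by
  refine inv_anti₀ (Real.sqrt_pos.2 hs) (Real.sqrt_le_sqrt ?_)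
  nlinarith [Real.pi_gt_three]

theorem heatK_le {s : ℝ} (hs : 0 < s) (w : ℝ) : heatK s w ≤ (√s)⁻¹ := by
  unfold heatK
  refine (mul_le_of_le_one_right (by positivity) ?_).trans (inv_sqrt_four_pi_le hs)
  rw [Real.exp_le_one_iff, neg_div]
  exact neg_nonpos.2 (by positivity)

/-- Taylor polynomial of degree 3; the factor 48 is chosen so that 48/3! matches the leading
coefficient 8. -/
theorem exp_cubic_bound {q : ℝ} (hq : 0 ≤ q) :
    (2 * q + 8 * q ^ 2) * (q + 1) ≤ 48 * Real.exp q := by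
  have h := Real.sum_le_exp_of_nonneg hq 4
  simp [Finset.sum_range_succ, Nat.factorial] at h
  nlinarith [mul_nonneg hq hq, mul_nonneg (mul_nonneg hq hq) hq]

/-- With a = |w|/√s and q = a²/4 the left side is s · a³(q + 1)exp(-q), and the last factor is
bounded. The power |w|³ makes the resulting bounds both summable over images and linear in s. -/
theorem heatK_aux {s w : ℝ} (hs : 0 < s) :
    (√s)⁻¹ * Real.exp (-w ^ 2 / (4 * s)) * (w ^ 2 / (4 * s) + 1) * |w| ^ 3 ≤ 48 * s := by
  have hsq : 0 < √s := Real.sqrt_pos.2 hs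
  set a := |w| / √s with ha
  have ha0 : 0 ≤ a := by positivity
  have hw : |w| = a * √s := by rw [ha]; field_simp
  set q := a ^ 2 / 4 with hq
  have hq0 : 0 ≤ q := by positivity
  have hss : √s * √s = s := Real.mul_self_sqrt hs.le
  have hwq : w ^ 2 / (4 * s) = q := by
    rw [← sq_abs, hw, hq, mul_pow, sq (√s), hss]; field_simp
  have hneg : -w ^ 2 / (4 * s) = -q := by rw [neg_div, hwq]
  rw [hneg, hwq, hw, Real.exp_neg]
  -- Since 2a³ ≤ a² + a⁴, and a²/2 = 2q, a⁴/2 = 8q².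
  have ha3 : a ^ 3 ≤ 2 * q + 8 * q ^ 2 := by
    rw [hq]; nlinarith [sq_nonneg (a - 1), mul_nonneg (sq_nonneg a) (sq_nonneg (a - 1))]
  have h1 : a ^ 3 * (q + 1) ≤ 48 * Real.exp q :=
    (mul_le_mul_of_nonneg_right ha3 (by positivity)).trans (exp_cubic_bound hq0)
  have hE := Real.exp_pos q
  have : (√s)⁻¹ * (Real.exp q)⁻¹ * (q + 1) * (a * √s) ^ 3
      = s * ((a ^ 3 * (q + 1)) / Real.exp q) := by
    rw [mul_pow, show √s ^ 3 = √s * (√s * √s) by ring, hss]; field_simp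
  rw [this, mul_comm 48 s]
  refine mul_le_mul_of_nonneg_left ?_ hs.le
  rwa [div_le_iff₀ hE]

theorem heatK_le_cube {s w : ℝ} (hs : 0 ≤ s) (hw : w ≠ 0) : heatK s w ≤ 48 / |w| ^ 3 * s := by
  rcases hs.eq_or_lt with rfl | hs
  · simp [heatK_zero]
  have hw' : 0 < |w| ^ 3 := by positivity
  rw [div_mul_eq_mul_div, le_div_iff₀ hw']
  refine le_trans ?_ (heatK_aux (w := w) hs)
  unfold heatK
  refine mul_le_mul_of_nonneg_right ?_ hw'.le
  calc _ ≤ (√s)⁻¹ * Real.exp (-w ^ 2 / (4 * s)) :=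
        mul_le_mul_of_nonneg_right (inv_sqrt_four_pi_le hs) (by positivity)
    _ ≤ _ := le_mul_of_one_le_right (by positivity) (by linarith [show 0 ≤ w ^ 2 / (4 * s) by positivity])

theorem hasDerivAt_heatK {s : ℝ} (hs : 0 < s) (w : ℝ) :
    HasDerivAt (fun s => heatK s w) (heatK s w * (w ^ 2 / (4 * s ^ 2) - 1 / (2 * s))) s := by
  have hp : 0 < 4 * Real.pi * s := by positivity
  have h1 : HasDerivAt (fun s : ℝ => 4 * Real.pi * s) (4 * Real.pi) s := by
    simpa using (hasDerivAt_id s).const_mul (4 * Real.pi)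
  have h2 := (h1.sqrt hp.ne').inv (Real.sqrt_pos.2 hp).ne'
  have h3 : HasDerivAt (fun s : ℝ => -w ^ 2 / (4 * s)) (w ^ 2 / (4 * s ^ 2)) s := by
    have := ((hasDerivAt_inv hs.ne').const_mul (-w ^ 2 / 4))
    refine (this.congr_deriv ?_).congr_of_eventuallyEq ?_
    · field_simp
    · filter_upwards with y; simp only [div_eq_mul_inv, mul_inv]; ring
  refine (h2.mul h3.exp).congr_deriv ?_
  unfold heatK
  rw [Real.sq_sqrt hp.le]
  have hsq := Real.sqrt_pos.2 hp
  simp only [Pi.inv_apply]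
  field_simp
  ring

theorem abs_deriv_heatK_le {s : ℝ} (hs : 0 < s) (w : ℝ) :
    |heatK s w * (w ^ 2 / (4 * s ^ 2) - 1 / (2 * s))| ≤
      (√s)⁻¹ * Real.exp (-w ^ 2 / (4 * s)) * (w ^ 2 / (4 * s) + 1) * s⁻¹ := by
  rw [abs_mul, abs_of_nonneg (heatK_nonneg _ _), mul_assoc]
  have hq : 0 ≤ w ^ 2 / (4 * s) := by positivity
  refine mul_le_mul ?_ ?_ (abs_nonneg _) (by positivity)
  · exact mul_le_mul_of_nonneg_right (inv_sqrt_four_pi_le hs) (by positivity)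
  · have : w ^ 2 / (4 * s ^ 2) - 1 / (2 * s) = (w ^ 2 / (4 * s) - 1 / 2) * s⁻¹ := by field_simp
    rw [this, abs_mul, abs_of_pos (inv_pos.2 hs)]
    refine mul_le_mul_of_nonneg_right ?_ (by positivity)
    rw [abs_le]; constructor <;> linarith

theorem abs_heatK_sub_le {s s' w C : ℝ} (hs : 0 < s) (hss : s ≤ s')
    (hC : ∀ u, s ≤ u →
      (√u)⁻¹ * Real.exp (-w ^ 2 / (4 * u)) * (w ^ 2 / (4 * u) + 1) * u⁻¹ ≤ C) :
    |heatK s' w - heatK s w| ≤ C * (s' - s) := by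
  have := Convex.norm_image_sub_le_of_norm_hasDerivWithin_le
    (f := fun s => heatK s w) (s := Icc s s') (C := C)
    (fun u hu => (hasDerivAt_heatK (hs.trans_le hu.1) w).hasDerivWithinAt)
    (fun u hu => (abs_deriv_heatK_le (hs.trans_le hu.1) w).trans (hC u hu.1)) (convex_Icc _ _)
    (left_mem_Icc.2 hss) (right_mem_Icc.2 hss)
  rwa [Real.norm_eq_abs, Real.norm_eq_abs, abs_of_nonneg (sub_nonneg.2 hss)] at this

/-- The time derivative is at most u^{-3/2} uniformly in w, because (1 + q)exp(-q) ≤ 1. -/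
theorem abs_heatK_sub_le_inv {s s' : ℝ} (w : ℝ) (hs : 0 < s) (hss : s ≤ s') :
    |heatK s' w - heatK s w| ≤ (√s * s)⁻¹ * (s' - s) := by
  refine abs_heatK_sub_le hs hss fun u hu => ?_
  have hu0 := hs.trans_le hu
  have h1 : Real.exp (-w ^ 2 / (4 * u)) * (w ^ 2 / (4 * u) + 1) ≤ 1 := by
    rw [neg_div, Real.exp_neg, inv_mul_le_iff₀ (Real.exp_pos _), mul_one]
    exact Real.add_one_le_exp _
  calc _ = (√u)⁻¹ * u⁻¹ * (Real.exp (-w ^ 2 / (4 * u)) * (w ^ 2 / (4 * u) + 1)) := by ring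
    _ ≤ (√u)⁻¹ * u⁻¹ := mul_le_of_le_one_right (by positivity) h1
    _ ≤ (√s)⁻¹ * s⁻¹ := mul_le_mul (inv_anti₀ (Real.sqrt_pos.2 hs) (Real.sqrt_le_sqrt hu))
        (inv_anti₀ hs hu) (by positivity) (by positivity)
    _ = _ := by rw [mul_inv]

/-- Away from w = 0 the kernel is Lipschitz in time down to s = 0, where it vanishes; the constant
decays cubically in w. -/
theorem abs_heatK_sub_le_cube {s s' w : ℝ} (hs : 0 ≤ s) (hs' : 0 ≤ s') (hw : w ≠ 0) :
    |heatK s' w - heatK s w| ≤ 48 / |w| ^ 3 * |s' - s| := by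
  wlog hss : s ≤ s' generalizing s s'
  · rw [abs_sub_comm, abs_sub_comm s']; exact this hs' hs (not_le.1 hss).le
  rw [abs_of_nonneg (sub_nonneg.2 hss)]
  rcases hs.eq_or_lt with rfl | hs
  · rw [heatK_zero, sub_zero, sub_zero, abs_of_nonneg (heatK_nonneg _ _)]
    exact heatK_le_cube hs' hw
  refine abs_heatK_sub_le hs hss fun u hu => ?_
  have hu0 := hs.trans_le hu
  rw [le_div_iff₀ (by positivity), mul_right_comm, mul_inv_le_iff₀ hu0]
  exact heatK_aux hu0

theorem measurable_heatK (w : ℝ) : Measurable fun s => heatK s w := by unfold heatK; fun_prop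

theorem intervalIntegrable_inv_sqrt {c d : ℝ} (hc : 0 ≤ c) (hd : 0 ≤ d) :
    IntervalIntegrable (fun s : ℝ => (√s)⁻¹) volume c d := by
  have h := intervalIntegral.intervalIntegrable_rpow' (a := c) (b := d) (r := -(1 / 2 : ℝ))
    (by norm_num)
  refine h.mono_fun' (by fun_prop) ?_
  refine (ae_restrict_iff' measurableSet_uIoc).2 (ae_of_all _ fun s hs => ?_)
  have hs0 : 0 < s := (le_min hc hd).trans_lt hs.1
  dsimp only
  rw [Real.norm_of_nonneg (by positivity), Real.rpow_neg hs0.le, Real.sqrt_eq_rpow]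

theorem intervalIntegrable_heatK {a : ℝ} (ha : 0 ≤ a) (w : ℝ) {c d : ℝ} (hc : 0 ≤ c) (hd : 0 ≤ d) :
    IntervalIntegrable (fun s => heatK (a * s) w) volume c d := by
  refine ((intervalIntegrable_inv_sqrt hc hd).const_mul (√a)⁻¹).mono_fun'
    ((measurable_heatK w).comp (measurable_const_mul a)).aestronglyMeasurable ?_
  refine (ae_restrict_iff' measurableSet_uIoc).2 (ae_of_all _ fun s hs => ?_)
  have hs0 : 0 < s := (le_min hc hd).trans_lt hs.1
  dsimp only
  rw [Real.norm_of_nonneg (heatK_nonneg _ _)]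
  rcases ha.eq_or_lt with rfl | ha
  · simp [heatK_zero]
  · rw [← mul_inv, ← Real.sqrt_mul ha.le]
    exact heatK_le (by positivity) w

/-! ### Second differences in time -/

/-- Second difference with step `Δ` at `nΔ` of the even extension of `t ↦ ∫₀ᵗ f`. -/
noncomputable def timeDiff (f : ℝ → ℝ) (Δ : ℝ) (n : ℕ) : ℝ :=
  (∫ s in (0:ℝ)..((n:ℝ) + 1) * Δ, f s) + (∫ s in (0:ℝ)..|(n:ℝ) - 1| * Δ, f s)
    - 2 * ∫ s in (0:ℝ)..(n:ℝ) * Δ, f s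

theorem timeDiff_zero (f : ℝ → ℝ) (Δ : ℝ) : timeDiff f Δ 0 = 2 * ∫ s in (0:ℝ)..Δ, f s := by
  simp [timeDiff]; ring

theorem timeDiff_succ {f : ℝ → ℝ} {Δ : ℝ} (hΔ : 0 ≤ Δ) (n : ℕ)
    (hf : ∀ t, 0 ≤ t → t ≤ ((n:ℝ) + 2) * Δ → IntervalIntegrable f volume 0 t) :
    timeDiff f Δ (n + 1) = ∫ s in ((n:ℝ) * Δ)..(((n:ℝ) + 1) * Δ), (f (s + Δ) - f s) := by
  have i0 := hf (n * Δ) (by positivity) (by nlinarith)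
  have i1 := hf ((n + 1) * Δ) (by positivity) (by nlinarith)
  have i2 := hf ((n + 2) * Δ) (by positivity) le_rfl
  have j12 := (i1.symm.trans i2).comp_add_right Δ
  rw [show ((n:ℝ) + 1) * Δ - Δ = n * Δ by ring, show ((n:ℝ) + 2) * Δ - Δ = (n + 1) * Δ by ring] at j12
  rw [intervalIntegral.integral_sub j12 (i0.symm.trans i1),
    intervalIntegral.integral_comp_add_right (fun s => f s) Δ,
    ← intervalIntegral.integral_interval_sub_left i1 i0,
    show (n:ℝ) * Δ + Δ = (n + 1) * Δ by ring, show ((n:ℝ) + 1) * Δ + Δ = (n + 2) * Δ by ring,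
    ← intervalIntegral.integral_interval_sub_left i2 i1]
  unfold timeDiff
  push_cast
  rw [show |(n:ℝ) + 1 - 1| = n by simp, show (n:ℝ) + 1 + 1 = n + 2 by ring]
  ring

/-- For n ≥ 1 the second difference is an integral of f(s + Δ) - f(s) over one cell. For n = 0 the
even extension may have a kink at the origin, and the size of f itself on (0, Δ] is what matters. -/
theorem abs_timeDiff_le {f : ℝ → ℝ} {Δ A : ℝ} (hΔ : 0 ≤ Δ) (hA : 0 ≤ A) (n : ℕ)
    (hf : ∀ t, 0 ≤ t → t ≤ ((n:ℝ) + 1) * Δ → IntervalIntegrable f volume 0 t)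
    (h0 : ∀ s, 0 < s → s ≤ Δ → |f s| ≤ A)
    (h1 : ∀ s, 0 < s → s ≤ n * Δ → |f (s + Δ) - f s| ≤ A) :
    |timeDiff f Δ n| ≤ 2 * A * Δ := by
  rcases n with _ | n
  · rw [timeDiff_zero, abs_mul, abs_two, mul_assoc]
    refine mul_le_mul_of_nonneg_left ?_ zero_le_two
    have := intervalIntegral.norm_integral_le_of_norm_le_const (a := 0) (b := Δ) (f := f) (C := A)
      fun s hs => by rw [uIoc_of_le hΔ] at hs; exact h0 s hs.1 hs.2
    rwa [sub_zero, abs_of_nonneg hΔ] at this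
  · rw [timeDiff_succ hΔ n (by push_cast at hf; intro t h2 h3; exact hf t h2 (by linarith))]
    have := intervalIntegral.norm_integral_le_of_norm_le_const (a := (n:ℝ) * Δ)
      (b := ((n:ℝ) + 1) * Δ) (f := fun s => f (s + Δ) - f s) (C := A)
      fun s hs => by
        rw [uIoc_of_le (by nlinarith)] at hs
        exact h1 s (lt_of_le_of_lt (by positivity) hs.1) (by push_cast; exact hs.2)
    rw [show ((n:ℝ) + 1) * Δ - n * Δ = Δ by ring, abs_of_nonneg hΔ] at this
    exact this.trans (by nlinarith)

theorem timeDiff_add {f g : ℝ → ℝ} {Δ : ℝ} (hΔ : 0 ≤ Δ) (n : ℕ)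
    (hf : ∀ t, 0 ≤ t → t ≤ ((n:ℝ) + 1) * Δ → IntervalIntegrable f volume 0 t)
    (hg : ∀ t, 0 ≤ t → t ≤ ((n:ℝ) + 1) * Δ → IntervalIntegrable g volume 0 t) :
    timeDiff (fun s => f s + g s) Δ n = timeDiff f Δ n + timeDiff g Δ n := by
  have h1 : |(n:ℝ) - 1| ≤ n + 1 := by rw [abs_le]; constructor <;> linarith [n.cast_nonneg (α := ℝ)]
  have a1 : |(n:ℝ) - 1| * Δ ≤ (n + 1) * Δ := mul_le_mul_of_nonneg_right h1 hΔ
  have a2 : (n:ℝ) * Δ ≤ (n + 1) * Δ := by nlinarith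
  unfold timeDiff
  rw [intervalIntegral.integral_add (hf _ (by positivity) le_rfl) (hg _ (by positivity) le_rfl),
    intervalIntegral.integral_add (hf _ (by positivity) a1) (hg _ (by positivity) a1),
    intervalIntegral.integral_add (hf _ (by positivity) a2) (hg _ (by positivity) a2)]
  ring

/-! ### Λ and ψ as differences of the integrated heat kernel -/

theorem integrable_exp_neg_sq : Integrable fun z : ℝ => Real.exp (-z ^ 2) := by
  simpa using integrable_exp_neg_mul_sq (b := 1) one_pos

theorem hasDerivAt_integral_Ioi_exp (x : ℝ) :
    HasDerivAt (fun x => ∫ z in Ioi x, Real.exp (-z ^ 2)) (-Real.exp (-x ^ 2)) x := by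
  have hi := integrable_exp_neg_sq
  have h1 : ∀ y, ∫ z in Ioi y, Real.exp (-z ^ 2)
      = (∫ z in Ioi x, Real.exp (-z ^ 2)) - ∫ z in x..y, Real.exp (-z ^ 2) := fun y => by
    rw [← intervalIntegral.integral_interval_add_Ioi (a := x) (b := y) hi.integrableOn hi.integrableOn]
    ring
  have hc : Continuous fun z : ℝ => Real.exp (-z ^ 2) := by fun_prop
  have h2 := (hc.integral_hasStrictDerivAt x x).hasDerivAt.const_sub
    (∫ z in Ioi x, Real.exp (-z ^ 2))
  exact h2.congr_of_eventuallyEq (Eventually.of_forall h1)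

theorem hasDerivAt_HFun (x : ℝ) :
    HasDerivAt HFun (-(1 / (2 * √Real.pi) * ∫ z in Ioi (x / 2), Real.exp (-z ^ 2))) x := by
  have h1 : HasDerivAt (fun x : ℝ => ∫ z in Ioi (x / 2), Real.exp (-z ^ 2))
      (-Real.exp (-(x / 2) ^ 2) * (1 / 2)) x :=
    HasDerivAt.comp (h := fun x : ℝ => x / 2) (h₂ := fun x => ∫ z in Ioi x, Real.exp (-z ^ 2)) x
      (hasDerivAt_integral_Ioi_exp (x / 2)) ((hasDerivAt_id x).div_const 2)
  have h2 : HasDerivAt (fun x : ℝ => Real.exp (-(x ^ 2 / 4)))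
      (Real.exp (-(x ^ 2 / 4)) * (-(2 * x / 4))) x := by
    have := (((hasDerivAt_pow 2 x).div_const 4).neg).exp
    simpa using this
  have h3 := (h2.sub ((hasDerivAt_id x).mul h1)).const_mul (1 / (2 * √Real.pi))
  refine h3.congr_deriv ?_
  rw [show -(x / 2) ^ 2 = -(x ^ 2 / 4) by ring]
  simp only [id]
  ring

theorem exists_abs_HFun_le : ∃ B : ℝ, 0 ≤ B ∧ ∀ x, 0 ≤ x → |HFun x| ≤ B := by
  have hi : Integrable fun z : ℝ => z * Real.exp (-z ^ 2) := by
    simpa using integrable_mul_exp_neg_mul_sq (b := 1) one_pos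
  set J := ∫ z in Ioi (0:ℝ), z * Real.exp (-z ^ 2)
  have hJ : 0 ≤ J := setIntegral_nonneg measurableSet_Ioi fun z hz => by
    have : (0:ℝ) < z := hz
    positivity
  refine ⟨1 + 2 * J, by positivity, fun x hx => ?_⟩
  have h0 : 0 ≤ ∫ z in Ioi (x / 2), Real.exp (-z ^ 2) :=
    setIntegral_nonneg measurableSet_Ioi fun z _ => (Real.exp_pos _).le
  have h1 : x * ∫ z in Ioi (x / 2), Real.exp (-z ^ 2) ≤ 2 * J := by
    rw [← integral_const_mul]
    calc ∫ z in Ioi (x / 2), x * Real.exp (-z ^ 2)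
        ≤ ∫ z in Ioi (x / 2), 2 * (z * Real.exp (-z ^ 2)) := by
          refine setIntegral_mono_on (integrable_exp_neg_sq.const_mul x).integrableOn
            (hi.const_mul 2).integrableOn measurableSet_Ioi fun z hz => ?_
          have : x / 2 < z := hz
          nlinarith [Real.exp_pos (-z ^ 2)]
      _ ≤ ∫ z in Ioi 0, 2 * (z * Real.exp (-z ^ 2)) := by
          refine setIntegral_mono_set (hi.const_mul 2).integrableOn ?_
            (Ioi_subset_Ioi (by positivity)).eventuallyLE
          refine (ae_restrict_iff' measurableSet_Ioi).2 (ae_of_all _ fun z hz => ?_)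
          have : (0:ℝ) < z := hz
          simp only [Pi.zero_apply]; positivity
      _ = _ := by rw [integral_const_mul]
  have h2 : Real.exp (-(x ^ 2 / 4)) ≤ 1 := by
    rw [Real.exp_le_one_iff]; exact neg_nonpos.2 (by positivity)
  have h3 : 1 / (2 * √Real.pi) ≤ 1 := by
    rw [div_le_one (by positivity)]
    have : 1 ≤ √Real.pi := Real.one_le_sqrt.2 (by linarith [Real.pi_gt_three])
    linarith
  unfold HFun
  rw [abs_mul, abs_of_pos (show 0 < 1 / (2 * √Real.pi) by positivity)]
  refine (mul_le_of_le_one_left (abs_nonneg _) h3).trans ?_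
  have := Real.exp_pos (-(x ^ 2 / 4))
  rw [abs_le]
  constructor <;> nlinarith [mul_nonneg hx h0]

/-- The terms with the Gaussian tail integral cancel, which leaves a pure exponential. -/
theorem hasDerivAt_sqrt_mul_HFun {t : ℝ} (ht : 0 < t) (a : ℝ) :
    HasDerivAt (fun t => √t * HFun (a / √t)) (1 / 2 * heatK t a) t := by
  have hs := Real.sqrt_pos.2 ht
  have hss : √t * √t = t := Real.mul_self_sqrt ht.le
  have h1 : HasDerivAt (fun t => √t) (1 / (2 * √t)) t := Real.hasDerivAt_sqrt ht.ne'
  have h2 : HasDerivAt (fun t => a / √t) (-(a * (1 / (2 * √t))) / √t ^ 2) t := by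
    have := (hasDerivAt_const t a).div h1 hs.ne'
    exact this.congr_deriv (by simp)
  have h3 := h1.mul ((hasDerivAt_HFun (a / √t)).comp t h2)
  refine h3.congr_deriv ?_
  simp only [Function.comp]
  have hp := Real.sqrt_pos.2 Real.pi_pos
  have e1 : √(4 * Real.pi * t) = 2 * √Real.pi * √t := by
    rw [Real.sqrt_mul (by positivity), Real.sqrt_mul (by positivity),
      show (4:ℝ) = 2 ^ 2 by norm_num, Real.sqrt_sq (by norm_num)]
  have e2 : -((a / √t) ^ 2 / 4) = -a ^ 2 / (4 * t) := by
    rw [div_pow, sq (√t), hss]; field_simp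
  unfold HFun heatK
  rw [e1, e2]
  field_simp
  ring

theorem integral_heatK {t : ℝ} (ht : 0 ≤ t) {a : ℝ} (ha : 0 ≤ a) :
    ∫ s in (0:ℝ)..t, heatK s a = 2 * (√t * HFun (a / √t)) := by
  obtain ⟨B, hB0, hB⟩ := exists_abs_HFun_le
  have hint : IntervalIntegrable (fun s => heatK s a) volume 0 t := by
    simpa using intervalIntegrable_heatK zero_le_one a le_rfl ht
  -- At s = 0 the derivative is unavailable; continuity follows from √s → 0 and the boundedness of
  -- `HFun`.
  have hcont : ContinuousOn (fun t => 2 * (√t * HFun (a / √t))) (Icc 0 t) := by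
    intro s hs
    rcases hs.1.eq_or_lt with rfl | hs0
    · have : Tendsto (fun t => 2 * (√t * HFun (a / √t))) (𝓝 0) (𝓝 0) := by
        have h1 : Tendsto (fun t : ℝ => 2 * (√t * B)) (𝓝 0) (𝓝 0) := by
          have : Continuous fun t : ℝ => 2 * (√t * B) := by fun_prop
          simpa using this.tendsto 0
        refine squeeze_zero_norm (fun s => ?_) h1
        rw [Real.norm_eq_abs, abs_mul, abs_mul, abs_two, abs_of_nonneg (Real.sqrt_nonneg _)]
        gcongr
        exact hB _ (by positivity)
      have h2 : ContinuousAt (fun t => 2 * (√t * HFun (a / √t))) 0 := by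
        simpa [ContinuousAt] using this
      exact h2.continuousWithinAt
    · exact ((hasDerivAt_sqrt_mul_HFun hs0 a).const_mul 2).continuousAt.continuousWithinAt
  have := intervalIntegral.integral_eq_sub_of_hasDerivAt_of_le ht hcont
    (f' := fun s => heatK s a) (fun s hs => ?_) hint
  · simpa using this
  · exact ((hasDerivAt_sqrt_mul_HFun hs.1 a).const_mul 2).congr_deriv (by ring)

theorem integral_heatK_eq_GFun {t h : ℝ} (ht : 0 ≤ t) (hh : 0 ≤ h) (y : ℝ) :
    ∫ s in (0:ℝ)..t, heatK s (h * y) = 2 * GFun h t y := by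
  have : ∀ s, heatK s (h * y) = heatK s (h * |y|) := fun s => by
    rw [← heatK_abs, abs_mul, abs_of_nonneg hh]
  simp_rw [this]
  rw [integral_heatK ht (by positivity)]
  unfold GFun
  split_ifs with h0
  · simp [h0]
  · rw [abs_of_nonneg ht]

theorem GFun_abs_left (h x y : ℝ) : GFun h |x| y = GFun h x y := by simp [GFun]

/-- The shift by 1 centres the second difference at n. For n = 0 it reaches x = -1, where the
evenness of `GFun` in x matches |n - 1| in `timeDiff`. -/
theorem secondDiffX_GFun {h : ℝ} (hh : 0 ≤ h) (n : ℕ) (y : ℝ) :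
    2 * secondDiffX (GFun h) ((n:ℝ) - 1) y = timeDiff (fun s => heatK s (h * y)) 1 n := by
  unfold secondDiffX timeDiff
  rw [mul_one, mul_one, mul_one, integral_heatK_eq_GFun (by positivity) hh,
    integral_heatK_eq_GFun (by positivity) hh, integral_heatK_eq_GFun (by positivity) hh,
    GFun_abs_left, show (n:ℝ) - 1 + 2 = n + 1 by ring, show (n:ℝ) - 1 + 1 = n by ring]
  ring

theorem LambdaFun_eq {h : ℝ} (hh : 0 ≤ h) (j l : ℤ) :
    2 * LambdaFun h j l = timeDiff (fun s => heatK s (h * (l + 1))) 1 j.natAbs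
      + timeDiff (fun s => heatK s (h * (l - 1))) 1 j.natAbs
      - 2 * timeDiff (fun s => heatK s (h * l)) 1 j.natAbs := by
  have key : ∀ m : ℝ, 2 * secondDiffX (secondDiffY (GFun h)) (|(j:ℝ)| - 1) (m - 1)
      = timeDiff (fun s => heatK s (h * (m + 1))) 1 j.natAbs
      + timeDiff (fun s => heatK s (h * (m - 1))) 1 j.natAbs
      - 2 * timeDiff (fun s => heatK s (h * m)) 1 j.natAbs := by
    intro m
    have hj : |(j:ℝ)| = (j.natAbs : ℝ) := by rw [Nat.cast_natAbs]; simp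
    rw [← secondDiffX_GFun hh, ← secondDiffX_GFun hh, ← secondDiffX_GFun hh, ← hj]
    simp only [secondDiffX, secondDiffY]
    rw [show m - 1 + 2 = m + 1 by ring, show m - 1 + 1 = m by ring]
    ring
  unfold LambdaFun
  rw [key]
  -- For negative l the two neighbours l ± 1 are exchanged, as the kernel is even in space.
  rcases abs_cases (l:ℝ) with ⟨h1, -⟩ | ⟨h1, -⟩
  · rw [h1]
  · rw [h1]
    have e : ∀ x y : ℝ, x = -y → (fun s => heatK s (h * x)) = fun s => heatK s (h * y) := by
      rintro x y rfl; ext s; rw [← heatK_abs, mul_neg, abs_neg, heatK_abs]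
    rw [e (-(l:ℝ) + 1) (l - 1) (by ring), e (-(l:ℝ) - 1) (l + 1) (by ring), e (-(l:ℝ)) l rfl]
    ring

theorem LambdaFun_zero_zero (h : ℝ) :
    LambdaFun h 0 0 = 4 * (HFun h - 1 / (2 * √Real.pi)) := by
  have h0 : HFun 0 = 1 / (2 * √Real.pi) := by simp [HFun]
  rw [← h0]
  simp [LambdaFun, secondDiffX, secondDiffY, GFun]
  norm_num
  ring

/-- Since `GFun` vanishes at x = 0, Λ_{0,0} reduces to 4(H(h) - H(0)). This identifies the centring
and shows Λ_{0,0} ≠ 0. -/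
theorem psiFun_eq {ϑ₂ r : ℝ} (hϑ : 0 < ϑ₂) (hr : 0 < r) :
    psiFun ϑ₂ r = -(LambdaFun (r / √ϑ₂) 0 0 / √ϑ₂) := by
  have hs := Real.sqrt_pos.2 hϑ
  have hp := Real.sqrt_pos.2 Real.pi_pos
  rw [LambdaFun_zero_zero]
  unfold psiFun HFun
  rw [Real.sqrt_mul Real.pi_pos.le, show r / √ϑ₂ / 2 = r / (2 * √ϑ₂) by field_simp,
    show (r / √ϑ₂) ^ 2 / 4 = r ^ 2 / (4 * ϑ₂) by
      rw [div_pow, Real.sq_sqrt hϑ.le]; field_simp]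
  field_simp
  ring

theorem exists_abs_timeDiff_heatK_le : ∃ A : ℝ, 0 ≤ A ∧ ∀ (n : ℕ) (w : ℝ),
    |timeDiff (fun s => heatK s w) 1 n| ≤ A / ((1 + n) * √(1 + n)) := by
  obtain ⟨B, hB0, hB⟩ := exists_abs_HFun_le
  -- The part 30B covers n = 0 and n = 1, where only boundedness of `HFun` is used; 6 comes from the
  -- derivative bound for n ≥ 2.
  refine ⟨6 + 30 * B, by positivity, fun n w => ?_⟩
  have hI : ∀ t, 0 ≤ t → |∫ s in (0:ℝ)..t, heatK s w| ≤ 2 * (√t * B) := fun t ht => by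
    have : ∀ s, heatK s w = heatK s |w| := fun s => (heatK_abs s w).symm
    simp_rw [this]
    rw [integral_heatK ht (abs_nonneg w), abs_mul, abs_mul, abs_two,
      abs_of_nonneg (Real.sqrt_nonneg _)]
    gcongr
    exact hB _ (by positivity)
  have hsqrt2 : √2 ≤ 3 / 2 := by
    rw [Real.sqrt_le_left (by norm_num)]; norm_num
  rcases n with _ | _ | n
  · rw [timeDiff_zero, abs_mul, abs_two]
    have := hI 1 zero_le_one
    simp at this ⊢
    linarith
  · have h1 := hI 2 (by norm_num)
    have h2 := hI 1 (by norm_num)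
    rw [le_div_iff₀ (by positivity)]
    simp only [timeDiff]
    norm_num
    rw [Real.sqrt_one] at h2
    rw [abs_le] at h1 h2
    have h3 : |(∫ s in (0:ℝ)..2, heatK s w) - 2 * ∫ s in (0:ℝ)..1, heatK s w| ≤ 7 * B := by
      rw [abs_le]; constructor <;> nlinarith
    nlinarith [abs_nonneg ((∫ s in (0:ℝ)..2, heatK s w) - 2 * ∫ s in (0:ℝ)..1, heatK s w),
      Real.sqrt_nonneg 2]
  · rw [timeDiff_succ zero_le_one _ fun t ht _ => by
      simpa using intervalIntegrable_heatK zero_le_one w le_rfl ht]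
    have hm : (0:ℝ) < ((n + 1 : ℕ) : ℝ) := by positivity
    have := intervalIntegral.norm_integral_le_of_norm_le_const (a := ((n + 1 : ℕ) : ℝ) * 1)
      (b := (((n + 1 : ℕ) : ℝ) + 1) * 1) (f := fun s => heatK (s + 1) w - heatK s w)
      (C := (√((n + 1 : ℕ) : ℝ) * ((n + 1 : ℕ) : ℝ))⁻¹) fun s hs => by
        rw [uIoc_of_le (by linarith), mul_one] at hs
        have hs0 := hm.trans hs.1
        refine (abs_heatK_sub_le_inv w hs0 (by linarith)).trans ?_
        rw [add_sub_cancel_left, mul_one]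
        refine inv_anti₀ (by positivity) ?_
        exact mul_le_mul (Real.sqrt_le_sqrt hs.1.le) hs.1.le hm.le (Real.sqrt_nonneg _)
    rw [Real.norm_eq_abs] at this
    refine this.trans ?_
    rw [show (((n + 1 : ℕ) : ℝ) + 1) * 1 - ((n + 1 : ℕ) : ℝ) * 1 = 1 by ring, abs_one, mul_one,
      le_div_iff₀ (by positivity), inv_mul_le_iff₀ (by positivity)]
    have e1 : (1 : ℝ) + ((n + 1 + 1 : ℕ) : ℝ) ≤ 3 * ((n + 1 : ℕ) : ℝ) := by
      push_cast; linarith [n.cast_nonneg (α := ℝ)]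
    have e2 : √(1 + ((n + 1 + 1 : ℕ) : ℝ)) ≤ 2 * √((n + 1 : ℕ) : ℝ) := by
      rw [Real.sqrt_le_left (by positivity), mul_pow, Real.sq_sqrt hm.le]; linarith
    calc _ ≤ (3 * ((n + 1 : ℕ) : ℝ)) * (2 * √((n + 1 : ℕ) : ℝ)) :=
          mul_le_mul e1 e2 (Real.sqrt_nonneg _) (by positivity)
      _ = √((n + 1 : ℕ) : ℝ) * ((n + 1 : ℕ) : ℝ) * 6 := by ring
      _ ≤ _ := mul_le_mul_of_nonneg_left (by linarith) (by positivity)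

/-- One factor of the square is bounded by its decay n^{-3/2} in time, the other by its cubic decay
in space. The product bound separates the variables and is summable. -/
theorem exists_sq_timeDiff_heatK_le : ∃ A : ℝ, 0 ≤ A ∧ ∀ (n : ℕ) (w : ℝ),
    timeDiff (fun s => heatK s w) 1 n ^ 2 ≤ A * (1 / ((1 + n) * √(1 + n)) * (1 / (1 + |w|) ^ 3)) := by
  obtain ⟨A, hA0, hA⟩ := exists_abs_timeDiff_heatK_le
  refine ⟨A * (768 + 8 * A), by positivity, fun n w => ?_⟩
  have h2 : |timeDiff (fun s => heatK s w) 1 n| ≤ (768 + 8 * A) / (1 + |w|) ^ 3 := by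
    rcases le_or_gt |w| 1 with h | h
    · have e1 : |timeDiff (fun s => heatK s w) 1 n| ≤ A := by
        refine (hA n w).trans (div_le_self hA0 ?_)
        have : 1 ≤ √(1 + (n:ℝ)) := Real.one_le_sqrt.2 (by linarith [n.cast_nonneg (α := ℝ)])
        nlinarith [n.cast_nonneg (α := ℝ)]
      rw [le_div_iff₀ (by positivity)]
      have e2 : (1 + |w|) ^ 3 ≤ 2 ^ 3 := pow_le_pow_left₀ (by positivity) (by linarith) 3
      nlinarith [abs_nonneg (timeDiff (fun s => heatK s w) 1 n)]
    · have hw : w ≠ 0 := by rintro rfl; simp at h; linarith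
      have e1 := abs_timeDiff_le (f := fun s => heatK s w) (Δ := 1) (A := 48 / |w| ^ 3) zero_le_one
        (by positivity) n
        (fun t ht _ => by simpa using intervalIntegrable_heatK zero_le_one w le_rfl ht)
        (fun s hs hs1 => by
          rw [abs_of_nonneg (heatK_nonneg _ _)]
          exact (heatK_le_cube hs.le hw).trans (mul_le_of_le_one_right (by positivity) hs1))
        (fun s hs _ => by
          have := abs_heatK_sub_le_cube (s := s) (s' := s + 1) hs.le (by linarith) hw
          simpa using this)
      refine e1.trans ?_
      have hw3 : 0 < |w| ^ 3 := by positivity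
      rw [mul_one, ← mul_div_assoc, div_le_div_iff₀ hw3 (by positivity)]
      have e2 : (1 + |w|) ^ 3 ≤ (2 * |w|) ^ 3 := pow_le_pow_left₀ (by positivity) (by linarith) 3
      rw [mul_pow] at e2
      nlinarith [mul_nonneg hA0 hw3.le]
  rw [← sq_abs, sq]
  calc _ ≤ (A / ((1 + n) * √(1 + n))) * ((768 + 8 * A) / (1 + |w|) ^ 3) :=
        mul_le_mul (hA n w) h2 (abs_nonneg _) (by positivity)
    _ = _ := by ring

theorem summable_inv_three_halves :
    Summable fun j : ℤ => 1 / ((1 + (j.natAbs : ℝ)) * √(1 + (j.natAbs : ℝ))) := by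
  refine Summable.of_nonneg_of_le (fun _ => by positivity) (fun j => ?_)
    ((Real.summable_one_div_int_add_rpow (1 / 2) (3 / 2)).2 (by norm_num))
  have hj : ((j.natAbs : ℝ)) = |(j:ℝ)| := by rw [Nat.cast_natAbs]; simp
  have hpos : 0 < |(j:ℝ) + 1 / 2| := by
    rw [abs_pos]; intro h
    have : (2 * j + 1 : ℝ) = 0 := by linarith
    have : (2 * j + 1 : ℤ) = 0 := by exact_mod_cast this
    omega
  have h1 : |(j:ℝ) + 1 / 2| ≤ 1 + |(j:ℝ)| :=
    (abs_add_le _ _).trans (by rw [abs_of_pos (show (0:ℝ) < 1 / 2 by norm_num)]; linarith)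
  rw [hj, show (3:ℝ) / 2 = 1 + 1 / 2 by norm_num, Real.rpow_add hpos, Real.rpow_one,
    ← Real.sqrt_eq_rpow]
  refine one_div_le_one_div_of_le (by positivity) ?_
  exact mul_le_mul h1 (Real.sqrt_le_sqrt h1) (Real.sqrt_nonneg _) (by positivity)

theorem summable_inv_int_cube (a : ℝ) : Summable fun j : ℤ => 1 / |(j:ℝ) + a| ^ 3 := by
  have := (Real.summable_one_div_int_add_rpow a 3).2 (by norm_num)
  refine this.congr fun j => ?_
  rw [show (3:ℝ) = ((3:ℕ):ℝ) by norm_num, Real.rpow_natCast]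

theorem summable_inv_one_add_cube {h : ℝ} (hh : 0 < h) :
    Summable fun l : ℤ => 1 / (1 + |h * (l:ℝ)|) ^ 3 := by
  set c := min 1 h
  have hc : 0 < c := lt_min one_pos hh
  refine Summable.of_nonneg_of_le (fun _ => by positivity) (fun l => ?_)
    ((summable_inv_int_cube (1 / 2)).mul_left (1 / c ^ 3))
  have hpos : 0 < |(l:ℝ) + 1 / 2| := by
    rw [abs_pos]; intro h
    have : (2 * l + 1 : ℝ) = 0 := by linarith
    have : (2 * l + 1 : ℤ) = 0 := by exact_mod_cast this
    omega
  have h1 : |(l:ℝ) + 1 / 2| ≤ 1 + |(l:ℝ)| :=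
    (abs_add_le _ _).trans (by rw [abs_of_pos (show (0:ℝ) < 1 / 2 by norm_num)]; linarith)
  rw [div_mul_div_comm, one_mul, ← mul_pow]
  refine one_div_le_one_div_of_le (by positivity) (pow_le_pow_left₀ (by positivity) ?_ 3)
  rw [abs_mul, abs_of_pos hh]
  calc _ ≤ c * (1 + |(l:ℝ)|) := mul_le_mul_of_nonneg_left h1 hc.le
    _ = c * 1 + c * |(l:ℝ)| := by ring
    _ ≤ 1 + h * |(l:ℝ)| := by
        exact add_le_add (by simp [c])
          (mul_le_mul_of_nonneg_right (min_le_right 1 h) (abs_nonneg _))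

theorem summable_sq_LambdaFun {h : ℝ} (hh : 0 < h) :
    Summable fun p : ℤ × ℤ => LambdaFun h p.1 p.2 ^ 2 := by
  obtain ⟨A, hA0, hA⟩ := exists_sq_timeDiff_heatK_le
  have hs : ∀ e : ℤ, Summable fun p : ℤ × ℤ =>
      timeDiff (fun s => heatK s (h * ((p.2 + e : ℤ) : ℝ))) 1 p.1.natAbs ^ 2 := fun e => by
    refine Summable.of_nonneg_of_le (fun _ => sq_nonneg _) (fun p => hA _ _) ?_
    refine Summable.mul_left A (Summable.mul_of_nonneg summable_inv_three_halves
      (g := fun l : ℤ => 1 / (1 + |h * ((l + e : ℤ) : ℝ)|) ^ 3) ?_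
      (fun _ => by simp only [Pi.zero_apply]; positivity)
      (fun _ => by simp only [Pi.zero_apply]; positivity))
    exact (summable_inv_one_add_cube hh).comp_injective (add_left_injective e)
  refine Summable.of_nonneg_of_le (fun _ => sq_nonneg _) (fun p => ?_)
    (((hs 1).add (hs (-1))).add ((hs 0).mul_left 2))
  have h1 := LambdaFun_eq hh.le p.1 p.2
  push_cast
  rw [add_zero, ← sub_eq_add_neg]
  set x := timeDiff (fun s => heatK s (h * ((p.2:ℝ) + 1))) 1 p.1.natAbs
  set y := timeDiff (fun s => heatK s (h * ((p.2:ℝ) - 1))) 1 p.1.natAbs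
  set z := timeDiff (fun s => heatK s (h * (p.2:ℝ))) 1 p.1.natAbs
  rw [show LambdaFun h p.1 p.2 = (x + y - 2 * z) / 2 by linarith]
  nlinarith [sq_nonneg (x - y), sq_nonneg (x + z), sq_nonneg (y + z)]

/-! ### Poisson summation and the method of images -/

/-- Real part of the Poisson summation formula for Gaussians. -/
theorem tsum_exp_mul_cos {τ : ℝ} (hτ : 0 < τ) (z : ℝ) :
    ∑' n : ℤ, Real.exp (-τ * (Real.pi * n) ^ 2) * Real.cos (Real.pi * n * z)
      = 2 * ∑' m : ℤ, heatK τ (z + 2 * m) := by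
  have ha : 0 < ((Real.pi * τ : ℝ) : ℂ).re := by rw [Complex.ofReal_re]; positivity
  have h := Complex.tsum_exp_neg_quadratic ha (Complex.I * ((z / 2 : ℝ) : ℂ))
  have hsum : Summable fun n : ℤ => Complex.exp (-Real.pi * ((Real.pi * τ : ℝ) : ℂ) * n ^ 2
      + 2 * Real.pi * (Complex.I * ((z / 2 : ℝ) : ℂ)) * n) := by
    have := (summable_jacobiTheta₂_term_iff ((z / 2 : ℝ) : ℂ) (Complex.I * ((Real.pi * τ : ℝ) : ℂ))).2
      (by simp; positivity)
    refine this.congr fun n => ?_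
    unfold jacobiTheta₂_term
    congr 1
    linear_combination (Real.pi * (Real.pi * τ : ℝ) * n ^ 2 : ℂ) * Complex.I_sq
  have h1 := congrArg Complex.re h
  rw [Complex.re_tsum hsum] at h1
  have hl : ∀ n : ℤ, (Complex.exp (-Real.pi * ((Real.pi * τ : ℝ) : ℂ) * n ^ 2
      + 2 * Real.pi * (Complex.I * ((z / 2 : ℝ) : ℂ)) * n)).re
      = Real.exp (-τ * (Real.pi * n) ^ 2) * Real.cos (Real.pi * n * z) := by
    intro n
    have : -Real.pi * ((Real.pi * τ : ℝ) : ℂ) * n ^ 2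
      + 2 * Real.pi * (Complex.I * ((z / 2 : ℝ) : ℂ)) * n
      = ((-τ * (Real.pi * n) ^ 2 : ℝ) : ℂ) + ((Real.pi * n * z : ℝ) : ℂ) * Complex.I := by
      push_cast; ring
    rw [this, Complex.exp_add, Complex.exp_mul_I, ← Complex.ofReal_exp, ← Complex.ofReal_cos,
      ← Complex.ofReal_sin, Complex.re_ofReal_mul, Complex.add_re, Complex.ofReal_re,
      Complex.re_ofReal_mul, Complex.I_re, mul_zero, add_zero]
  simp_rw [hl] at h1
  rw [h1]
  have hr : ∀ n : ℤ, Complex.exp (-Real.pi / ((Real.pi * τ : ℝ) : ℂ)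
      * (n + Complex.I * (Complex.I * ((z / 2 : ℝ) : ℂ))) ^ 2)
      = ((Real.exp (-(z - 2 * n) ^ 2 / (4 * τ)) : ℝ) : ℂ) := by
    intro n
    rw [Complex.ofReal_exp]
    congr 1
    rw [← mul_assoc, Complex.I_mul_I]
    have : (τ : ℂ) ≠ 0 := by exact_mod_cast hτ.ne'
    have : (Real.pi : ℂ) ≠ 0 := by exact_mod_cast Real.pi_ne_zero
    push_cast
    field_simp
    ring
  simp_rw [hr]
  have hpow : (1 : ℂ) / ((Real.pi * τ : ℝ) : ℂ) ^ (1 / 2 : ℂ) = ((2 * (√(4 * Real.pi * τ))⁻¹ : ℝ) : ℂ) := by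
    have e : (√(4 * Real.pi * τ)) = 2 * √(Real.pi * τ) := by
      rw [mul_assoc, Real.sqrt_mul (by norm_num), show (4:ℝ) = 2 ^ 2 by norm_num,
        Real.sqrt_sq (by norm_num)]
    rw [e, Real.sqrt_eq_rpow, mul_inv, mul_inv_cancel_left₀ two_ne_zero, Complex.ofReal_inv,
      Complex.ofReal_cpow (by positivity), one_div]
    simp
  rw [hpow, ← Complex.ofReal_tsum, ← Complex.ofReal_mul, Complex.ofReal_re, mul_assoc,
    ← tsum_mul_left]
  congr 1
  rw [← (Equiv.neg ℤ).tsum_eq]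
  refine tsum_congr fun m => ?_
  simp only [Equiv.neg_apply, heatK]
  push_cast
  rw [show z - 2 * -(m:ℝ) = z + 2 * m by ring]

/-- The bilateral series is even in n; halving it after removing the term n = 0 leaves the constant
-1/2. -/
theorem hasSum_exp_mul_cos {τ : ℝ} (hτ : 0 < τ) (z : ℝ) :
    HasSum (fun l : ℕ => Real.exp (-τ * (Real.pi * (l + 1)) ^ 2) * Real.cos (Real.pi * (l + 1) * z))
      ((∑' m : ℤ, heatK τ (z + 2 * m)) - 1 / 2) := by
  set f : ℤ → ℝ := fun n => Real.exp (-τ * (Real.pi * n) ^ 2) * Real.cos (Real.pi * n * z)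
  have hsum : Summable f := by
    have := (summable_jacobiTheta₂_term_iff (0 : ℂ) (Complex.I * ((Real.pi * τ : ℝ) : ℂ))).2
      (by simp; positivity)
    refine Summable.of_norm_bounded this.norm fun n => ?_
    rw [norm_mul, Real.norm_eq_abs (Real.cos _), jacobiTheta₂_term, Complex.norm_exp]
    refine (mul_le_of_le_one_right (norm_nonneg _) (Real.abs_cos_le_one _)).trans (le_of_eq ?_)
    rw [Real.norm_of_nonneg (Real.exp_pos _).le]
    congr 1
    have : 2 * Real.pi * Complex.I * n * 0 + Real.pi * Complex.I * n ^ 2 *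
      (Complex.I * ((Real.pi * τ : ℝ) : ℂ)) = ((-τ * (Real.pi * n) ^ 2 : ℝ) : ℂ) := by
      push_cast
      linear_combination (Real.pi * (Real.pi * τ) * n ^ 2 : ℂ) * Complex.I_sq
    rw [this, Complex.ofReal_re]
  have h1 := hsum.hasSum.nat_add_neg
  rw [show ∑' n, f n = _ from tsum_exp_mul_cos hτ z] at h1
  have h2 := (hasSum_nat_add_iff' 1).2 h1
  have h3 := h2.div_const 2
  have e1 : (fun l : ℕ => Real.exp (-τ * (Real.pi * (l + 1)) ^ 2) * Real.cos (Real.pi * (l + 1) * z))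
      = fun l : ℕ => (f ((l + 1 : ℕ) : ℤ) + f (-((l + 1 : ℕ) : ℤ))) / 2 := by
    funext l
    simp only [f]
    push_cast
    rw [show Real.pi * -((l:ℝ) + 1) * z = -(Real.pi * (l + 1) * z) by ring, Real.cos_neg,
      show Real.pi * -((l:ℝ) + 1) = -(Real.pi * (l + 1)) by ring, neg_sq]
    ring
  have e2 : (∑' m : ℤ, heatK τ (z + 2 * m)) - 1 / 2 = (2 * ∑' (m : ℤ), heatK τ (z + 2 * m) + f 0
      - ∑ i ∈ Finset.range 1, (f (i : ℤ) + f (-(i : ℤ)))) / 2 := by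
    simp [f]; ring
  rw [e1, e2]
  exact h3

theorem abs_add_half_pos (m : ℤ) : 0 < |(m:ℝ) + 1 / 2| := by
  rw [abs_pos]; intro h
  have : (2 * m + 1 : ℝ) = 0 := by linarith
  have : (2 * m + 1 : ℤ) = 0 := by exact_mod_cast this
  omega

/-- Sum of heat kernels over the lattice `z + 2ℤ`, with weights `e`. -/
noncomputable def imageSum (ϑ z : ℝ) (e : ℤ → ℝ) (s : ℝ) : ℝ := ∑' m : ℤ, e m * heatK (ϑ * s) (z + 2 * m)

/-- Lipschitz constant of `imageSum`. -/
noncomputable def imageConst (ϑ b : ℝ) : ℝ := ∑' m : ℤ, 48 * ϑ / b ^ 3 * (1 / |(m:ℝ) + 1 / 2| ^ 3)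

theorem imageConst_nonneg {ϑ b : ℝ} (hϑ : 0 < ϑ) (hb : 0 < b) : 0 ≤ imageConst ϑ b :=
  tsum_nonneg fun _ => by positivity

/-- A kept image lies at distance at least b|m + 1/2| from 0, so cubic decay makes the Lipschitz
constants summable over m. The shift 1/2 keeps the bound nonzero at m = 0. -/
theorem abs_weighted_heatK_sub_le {ϑ b z w : ℝ} (hϑ : 0 < ϑ) (hb : 0 < b) {m : ℤ}
    (he : w = 0 ∨ (w = 1 ∧ b * |(m:ℝ) + 1 / 2| ≤ |z + 2 * m|)) {s s' : ℝ} (hs : 0 ≤ s)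
    (hs' : 0 ≤ s') :
    |w * heatK (ϑ * s') (z + 2 * m) - w * heatK (ϑ * s) (z + 2 * m)|
      ≤ 48 * ϑ / b ^ 3 * (1 / |(m:ℝ) + 1 / 2| ^ 3) * |s' - s| := by
  have hm := abs_add_half_pos m
  rcases he with h | ⟨h, h2⟩
  · rw [h]; simp only [zero_mul, sub_zero, abs_zero]; positivity
  · rw [h, one_mul, one_mul]
    have hz : 0 < |z + 2 * m| := lt_of_lt_of_le (by positivity) h2
    refine (abs_heatK_sub_le_cube (by positivity) (by positivity) (abs_pos.1 hz)).trans ?_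
    rw [← mul_sub, abs_mul, abs_of_pos hϑ, ← mul_assoc]
    refine mul_le_mul_of_nonneg_right ?_ (abs_nonneg _)
    have h3 := pow_le_pow_left₀ (by positivity) h2 3
    calc _ ≤ 48 / (b * |(m:ℝ) + 1 / 2|) ^ 3 * ϑ :=
          mul_le_mul_of_nonneg_right
            (div_le_div_of_nonneg_left (by norm_num) (by positivity) h3) hϑ.le
      _ = _ := by rw [mul_pow]; field_simp

theorem summable_imageConst (ϑ b : ℝ) :
    Summable fun m : ℤ => 48 * ϑ / b ^ 3 * (1 / |(m:ℝ) + 1 / 2| ^ 3) :=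
  (summable_inv_int_cube (1 / 2)).mul_left _

theorem summable_imageSum {ϑ b z : ℝ} {e : ℤ → ℝ} (hϑ : 0 < ϑ) (hb : 0 < b)
    (he : ∀ m, e m = 0 ∨ (e m = 1 ∧ b * |(m:ℝ) + 1 / 2| ≤ |z + 2 * m|)) {s : ℝ} (hs : 0 ≤ s) :
    Summable fun m : ℤ => e m * heatK (ϑ * s) (z + 2 * m) := by
  refine Summable.of_norm_bounded ((summable_imageConst ϑ b).mul_right s) fun m => ?_
  have := abs_weighted_heatK_sub_le hϑ hb (he m) le_rfl hs
  simpa [heatK_zero, abs_of_nonneg hs] using this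

theorem abs_imageSum_sub_le {ϑ b z : ℝ} {e : ℤ → ℝ} (hϑ : 0 < ϑ) (hb : 0 < b)
    (he : ∀ m, e m = 0 ∨ (e m = 1 ∧ b * |(m:ℝ) + 1 / 2| ≤ |z + 2 * m|)) {s s' : ℝ} (hs : 0 ≤ s)
    (hs' : 0 ≤ s') :
    |imageSum ϑ z e s' - imageSum ϑ z e s| ≤ imageConst ϑ b * |s' - s| := by
  unfold imageSum imageConst
  rw [← (summable_imageSum hϑ hb he hs').tsum_sub (summable_imageSum hϑ hb he hs), ← tsum_mul_right]
  exact tsum_of_norm_bounded (f := fun m : ℤ => e m * heatK (ϑ * s') (z + 2 * m)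
      - e m * heatK (ϑ * s) (z + 2 * m)) ((summable_imageConst ϑ b).mul_right _).hasSum
    fun m => abs_weighted_heatK_sub_le hϑ hb (he m) hs hs'

theorem imageSum_zero (ϑ z : ℝ) (e : ℤ → ℝ) : imageSum ϑ z e 0 = 0 := by
  simp [imageSum, heatK_zero]

theorem abs_exp_sub_exp_le {γ T s s' : ℝ} (hs : 0 ≤ s) (hs' : 0 ≤ s') (hsT : s ≤ T) (hsT' : s' ≤ T) :
    |Real.exp (-γ * s') - Real.exp (-γ * s)| ≤ |γ| * Real.exp (|γ| * T) * |s' - s| := by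
  have := Convex.norm_image_sub_le_of_norm_hasDerivWithin_le
    (f := fun s => Real.exp (-γ * s)) (f' := fun s => Real.exp (-γ * s) * (-γ)) (s := Icc 0 T)
    (C := |γ| * Real.exp (|γ| * T))
    (fun u _ => by
      have h := ((hasDerivAt_id u).const_mul (-γ)).exp
      simp only [id, mul_one] at h
      exact h.hasDerivWithinAt)
    (fun u hu => by
      rw [norm_mul, norm_neg, Real.norm_eq_abs γ, mul_comm, Real.norm_of_nonneg (Real.exp_pos _).le]
      refine mul_le_mul_of_nonneg_left (Real.exp_le_exp.2 ?_) (abs_nonneg _)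
      exact mul_le_mul (neg_le_abs γ) hu.2 hu.1 (abs_nonneg _)) (convex_Icc _ _)
    (show s ∈ Icc 0 T from ⟨hs, hsT⟩) (show s' ∈ Icc 0 T from ⟨hs', hsT'⟩)
  simpa [Real.norm_eq_abs] using this

theorem exp_neg_mul_le {γ T s : ℝ} (hs : 0 ≤ s) (hsT : s ≤ T) :
    Real.exp (-γ * s) ≤ Real.exp (|γ| * T) :=
  Real.exp_le_exp.2 (mul_le_mul (neg_le_abs γ) hsT hs (abs_nonneg _))

theorem abs_damped_imageSum_sub_le {ϑ b z γ T : ℝ} {e : ℤ → ℝ} (hϑ : 0 < ϑ) (hb : 0 < b)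
    (he : ∀ m, e m = 0 ∨ (e m = 1 ∧ b * |(m:ℝ) + 1 / 2| ≤ |z + 2 * m|)) {s s' : ℝ} (hs : 0 ≤ s)
    (hs' : 0 ≤ s') (hsT : s ≤ T) (hsT' : s' ≤ T) :
    |Real.exp (-γ * s') * imageSum ϑ z e s' - Real.exp (-γ * s) * imageSum ϑ z e s|
      ≤ Real.exp (|γ| * T) * imageConst ϑ b * (1 + |γ| * T) * |s' - s| := by
  have h1 := abs_imageSum_sub_le hϑ hb he hs hs'
  have h2 := abs_imageSum_sub_le hϑ hb he le_rfl hs'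
  rw [imageSum_zero, sub_zero, sub_zero, abs_of_nonneg hs'] at h2
  have h3 := abs_exp_sub_exp_le (γ := γ) hs hs' hsT hsT'
  have h4 := exp_neg_mul_le (γ := γ) hs hsT
  have hL := imageConst_nonneg hϑ hb
  have hE := Real.exp_pos (|γ| * T)
  have h5 : |imageSum ϑ z e s'| ≤ imageConst ϑ b * T :=
    h2.trans (mul_le_mul_of_nonneg_left hsT' hL)
  calc _ = |(Real.exp (-γ * s') - Real.exp (-γ * s)) * imageSum ϑ z e s'
          + Real.exp (-γ * s) * (imageSum ϑ z e s' - imageSum ϑ z e s)| := by congr 1; ring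
    _ ≤ |γ| * Real.exp (|γ| * T) * |s' - s| * (imageConst ϑ b * T)
          + Real.exp (|γ| * T) * (imageConst ϑ b * |s' - s|) := by
        refine (abs_add_le _ _).trans (add_le_add ?_ ?_)
        · rw [abs_mul]
          exact mul_le_mul h3 h5 (abs_nonneg _) (by positivity)
        · rw [abs_mul, abs_of_pos (Real.exp_pos _)]
          exact mul_le_mul h4 h1 (abs_nonneg _) hE.le
    _ = _ := by ring

theorem intervalIntegrable_damped_imageSum {ϑ b z : ℝ} (γ : ℝ) {e : ℤ → ℝ} (hϑ : 0 < ϑ) (hb : 0 < b)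
    (he : ∀ m, e m = 0 ∨ (e m = 1 ∧ b * |(m:ℝ) + 1 / 2| ≤ |z + 2 * m|)) {t : ℝ} (ht : 0 ≤ t) :
    IntervalIntegrable (fun s => Real.exp (-γ * s) * imageSum ϑ z e s) volume 0 t := by
  refine ContinuousOn.intervalIntegrable ?_
  rw [uIcc_of_le ht]
  refine (LipschitzOnWith.of_dist_le_mul
    (K := (Real.exp (|γ| * t) * imageConst ϑ b * (1 + |γ| * t)).toNNReal) fun x hx y hy => ?_).continuousOn
  rw [Real.coe_toNNReal _ (by have := imageConst_nonneg hϑ hb; positivity), Real.dist_eq,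
    Real.dist_eq]
  exact abs_damped_imageSum_sub_le hϑ hb he hy.1 hx.1 hy.2 hx.2

/-- The integrand is Lipschitz and vanishes at 0, hence all quantities in `abs_timeDiff_le` are
O(Δ). -/
theorem abs_timeDiff_damped_imageSum_le {ϑ b z γ T Δ : ℝ} {e : ℤ → ℝ} (hϑ : 0 < ϑ) (hb : 0 < b)
    (he : ∀ m, e m = 0 ∨ (e m = 1 ∧ b * |(m:ℝ) + 1 / 2| ≤ |z + 2 * m|)) (hΔ : 0 < Δ) (n : ℕ)
    (hn : ((n:ℝ) + 1) * Δ ≤ T) :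
    |timeDiff (fun s => Real.exp (-γ * s) * imageSum ϑ z e s) Δ n|
      ≤ 2 * (Real.exp (|γ| * T) * imageConst ϑ b * (1 + |γ| * T)) * Δ ^ 2 := by
  have hT : 0 ≤ T := le_trans (by positivity) hn
  have hL := imageConst_nonneg hϑ hb
  have hnΔ : 0 ≤ (n:ℝ) * Δ := by positivity
  have := abs_timeDiff_le (f := fun s => Real.exp (-γ * s) * imageSum ϑ z e s) (Δ := Δ)
    (A := Real.exp (|γ| * T) * imageConst ϑ b * (1 + |γ| * T) * Δ) hΔ.le (by positivity) n
    (fun t ht _ => intervalIntegrable_damped_imageSum γ hϑ hb he ht)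
    (fun s hs hsΔ => by
      have h := abs_damped_imageSum_sub_le (γ := γ) (T := T) hϑ hb he le_rfl hs.le hT
        (by nlinarith)
      rw [imageSum_zero, mul_zero, sub_zero, sub_zero, abs_of_pos hs] at h
      exact h.trans (mul_le_mul_of_nonneg_left hsΔ (by positivity)))
    (fun s hs hsn => by
      have h := abs_damped_imageSum_sub_le (γ := γ) (T := T) (s := s) (s' := s + Δ) hϑ hb he hs.le
        (by linarith) (by nlinarith) (by nlinarith)
      rwa [add_sub_cancel_left, abs_of_pos hΔ] at h)
  refine this.trans (le_of_eq (by ring))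

/-! ### Periodic heat kernel: scaling and remainders -/

theorem heatK_of_nonpos {s : ℝ} (hs : s ≤ 0) (w : ℝ) : heatK s w = 0 := by
  unfold heatK
  rw [Real.sqrt_eq_zero_of_nonpos (mul_nonpos_of_nonneg_of_nonpos (by positivity) hs), inv_zero,
    zero_mul]

theorem heatK_mul {c : ℝ} (hc : 0 < c) (u z : ℝ) :
    heatK (c * u) z = (√c)⁻¹ * heatK u (z / √c) := by
  unfold heatK
  rw [show 4 * Real.pi * (c * u) = c * (4 * Real.pi * u) by ring, Real.sqrt_mul hc.le, mul_inv,
    neg_div, neg_div, div_pow, Real.sq_sqrt hc.le, div_div, mul_assoc,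
    show 4 * (c * u) = c * (4 * u) by ring]

/-- Parabolic scaling: s = Δu brings the time step to 1 and measures space in units of √(ϑΔ). -/
theorem timeDiff_heatK_scale {ϑ Δ : ℝ} (hϑ : 0 < ϑ) (hΔ : 0 < Δ) (z : ℝ) (n : ℕ) :
    timeDiff (fun s => heatK (ϑ * s) z) Δ n
      = √Δ / √ϑ * timeDiff (fun s => heatK s (z / √(ϑ * Δ))) 1 n := by
  have key : ∀ x : ℝ, ∫ s in (0:ℝ)..x * Δ, heatK (ϑ * s) z
      = √Δ / √ϑ * ∫ s in (0:ℝ)..x * 1, heatK s (z / √(ϑ * Δ)) := by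
    intro x
    have h := intervalIntegral.integral_comp_mul_left (a := 0) (b := x)
      (fun s => heatK (ϑ * s) z) hΔ.ne'
    have h2 : ∀ u, heatK (ϑ * (Δ * u)) z = (√(ϑ * Δ))⁻¹ * heatK u (z / √(ϑ * Δ)) := fun u => by
      rw [← mul_assoc, heatK_mul (by positivity)]
    simp_rw [h2] at h
    rw [intervalIntegral.integral_const_mul, mul_zero, smul_eq_mul, eq_inv_mul_iff_mul_eq₀ hΔ.ne'] at h
    rw [mul_comm x Δ, mul_one, ← h, Real.sqrt_mul hϑ.le, ← mul_assoc]
    congr 1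
    have := Real.sqrt_pos.2 hϑ
    have h3 := Real.sqrt_pos.2 hΔ
    field_simp
    rw [Real.sq_sqrt hΔ.le]
  unfold timeDiff
  rw [key, key, key]
  ring

theorem intervalIntegrable_damped_heatK {ϑ : ℝ} (γ : ℝ) (hϑ : 0 < ϑ) (z : ℝ) {t : ℝ} (ht : 0 ≤ t) :
    IntervalIntegrable (fun s => (Real.exp (-γ * s) - 1) * heatK (ϑ * s) z) volume 0 t := by
  refine (intervalIntegrable_heatK hϑ.le z le_rfl ht).continuousOn_mul ?_
  fun_prop

/-- The factor exp(-γs) - 1 is O(s) and compensates the singularity s^{-1/2} of the kernel, so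
increments over Δ are O(√Δ). -/
theorem abs_timeDiff_damping_le {ϑ z γ T Δ : ℝ} (hϑ : 0 < ϑ) (hΔ : 0 < Δ) (n : ℕ)
    (hn : ((n:ℝ) + 1) * Δ ≤ T) :
    |timeDiff (fun s => (Real.exp (-γ * s) - 1) * heatK (ϑ * s) z) Δ n|
      ≤ 4 * (|γ| * Real.exp (|γ| * T) / √ϑ) * (Δ * √Δ) := by
  have hT : 0 ≤ T := le_trans (by positivity) hn
  have hnΔ : 0 ≤ (n:ℝ) * Δ := by positivity
  have hϑs := Real.sqrt_pos.2 hϑ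
  have hΔs := Real.sqrt_pos.2 hΔ
  set c := |γ| * Real.exp (|γ| * T) with hc
  have hc0 : 0 ≤ c := by positivity
  have he : ∀ s, 0 < s → s ≤ T → |Real.exp (-γ * s) - 1| ≤ c * s := fun s hs hsT => by
    have := abs_exp_sub_exp_le (γ := γ) le_rfl hs.le hT hsT
    simpa [abs_of_pos hs] using this
  have hk : ∀ s, 0 < s → heatK (ϑ * s) z ≤ (√ϑ)⁻¹ * (√s)⁻¹ := fun s hs => by
    rw [← mul_inv, ← Real.sqrt_mul hϑ.le]; exact heatK_le (by positivity) z
  have hss : ∀ s : ℝ, 0 < s → s * (√s)⁻¹ = √s := fun s hs => by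
    have := Real.sqrt_pos.2 hs
    field_simp
    rw [Real.sq_sqrt hs.le]
  have hsmall : ∀ s, 0 < s → s ≤ Δ → c * s * ((√ϑ)⁻¹ * (√s)⁻¹) ≤ c / √ϑ * √Δ := fun s hs hsΔ => by
    calc _ = c / √ϑ * (s * (√s)⁻¹) := by ring
      _ ≤ _ := by
        rw [hss s hs]
        exact mul_le_mul_of_nonneg_left (Real.sqrt_le_sqrt hsΔ) (by positivity)
  have := abs_timeDiff_le (f := fun s => (Real.exp (-γ * s) - 1) * heatK (ϑ * s) z) (Δ := Δ)
    (A := 2 * (c / √ϑ) * √Δ) hΔ.le (by positivity) n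
    (fun t ht _ => intervalIntegrable_damped_heatK γ hϑ z ht)
    (fun s hs hsΔ => by
      rw [abs_mul, abs_of_nonneg (heatK_nonneg _ _)]
      refine (mul_le_mul (he s hs (by nlinarith)) (hk s hs) (heatK_nonneg _ _)
        (by positivity)).trans ((hsmall s hs hsΔ).trans ?_)
      have : 0 ≤ c / √ϑ * √Δ := by positivity
      linarith)
    (fun s hs hsn => by
      have e1 := abs_exp_sub_exp_le (γ := γ) (T := T) (s := s) (s' := s + Δ) hs.le (by linarith)
        (by nlinarith) (by nlinarith)
      rw [add_sub_cancel_left, abs_of_pos hΔ, ← hc] at e1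
      have p1 : |(Real.exp (-γ * (s + Δ)) - Real.exp (-γ * s)) * heatK (ϑ * (s + Δ)) z|
          ≤ c / √ϑ * √Δ := by
        rw [abs_mul, abs_of_nonneg (heatK_nonneg _ _)]
        refine (mul_le_mul e1 (hk (s + Δ) (by linarith)) (heatK_nonneg _ _) (by positivity)).trans ?_
        refine le_trans ?_ (hsmall Δ hΔ le_rfl)
        refine mul_le_mul_of_nonneg_left ?_ (by positivity)
        refine mul_le_mul_of_nonneg_left ?_ (by positivity)
        exact inv_anti₀ hΔs (Real.sqrt_le_sqrt (by linarith))
      have p2 : |(Real.exp (-γ * s) - 1) * (heatK (ϑ * (s + Δ)) z - heatK (ϑ * s) z)|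
          ≤ c / √ϑ * √Δ := by
        rw [abs_mul]
        have e2 := he s hs (by nlinarith)
        -- Near the origin the two kernels are bounded separately; beyond Δ the derivative bound
        -- gives s · Δ s^{-3/2} ≤ √Δ.
        rcases le_total s Δ with h | h
        · have e3 : |heatK (ϑ * (s + Δ)) z - heatK (ϑ * s) z| ≤ (√ϑ)⁻¹ * (√s)⁻¹ := by
            have k1 := hk (s + Δ) (by linarith)
            have k2 : (√ϑ)⁻¹ * (√(s + Δ))⁻¹ ≤ (√ϑ)⁻¹ * (√s)⁻¹ :=
              mul_le_mul_of_nonneg_left (inv_anti₀ (Real.sqrt_pos.2 hs)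
                (Real.sqrt_le_sqrt (by linarith))) (by positivity)
            rw [abs_le]
            constructor <;> linarith [hk s hs, heatK_nonneg (ϑ * (s + Δ)) z, heatK_nonneg (ϑ * s) z]
          exact (mul_le_mul e2 e3 (abs_nonneg _) (by positivity)).trans (hsmall s hs h)
        · have e3 := abs_heatK_sub_le_inv (s := ϑ * s) (s' := ϑ * (s + Δ)) z (by positivity)
            (mul_le_mul_of_nonneg_left (by linarith) hϑ.le)
          refine (mul_le_mul e2 e3 (abs_nonneg _) (by positivity)).trans ?_
          have hs' := Real.sqrt_pos.2 hs
          calc _ = c / √ϑ * (Δ * (√s)⁻¹) := by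
                rw [Real.sqrt_mul hϑ.le]; field_simp; ring
            _ ≤ c / √ϑ * (Δ * (√Δ)⁻¹) := by
                refine mul_le_mul_of_nonneg_left (mul_le_mul_of_nonneg_left
                  (inv_anti₀ hΔs (Real.sqrt_le_sqrt h)) hΔ.le) (by positivity)
            _ = _ := by rw [hss Δ hΔ]
      calc _ = |(Real.exp (-γ * (s + Δ)) - Real.exp (-γ * s)) * heatK (ϑ * (s + Δ)) z
            + (Real.exp (-γ * s) - 1) * (heatK (ϑ * (s + Δ)) z - heatK (ϑ * s) z)| := by
            congr 1; ring
        _ ≤ _ := (abs_add_le _ _).trans (by linarith))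
  refine this.trans (le_of_eq (by ring))

/-- Damped heat kernel of the lattice `z + 2ℤ`. -/
noncomputable def periodicHeat (ϑ γ z s : ℝ) : ℝ := Real.exp (-γ * s) * imageSum ϑ z (fun _ => 1) s

/-- Used for z near x + y: for grid points in [b, 1-b] every reflected image stays away from 0. -/
theorem image_separation {b z : ℝ} (hb : 0 < b) (hb' : b < 1 / 2) (h1 : 2 * b ≤ z)
    (h2 : z ≤ 2 - 2 * b) (m : ℤ) : b * |(m:ℝ) + 1 / 2| ≤ |z + 2 * m| := by
  rcases le_or_gt 0 m with h | h
  · have hm : (0:ℝ) ≤ m := by exact_mod_cast h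
    rw [abs_of_nonneg (by linarith), abs_of_nonneg (by linarith)]
    nlinarith
  · have hm : (m:ℝ) ≤ -1 := by exact_mod_cast (by omega : m ≤ -1)
    rw [abs_of_nonpos (by linarith), abs_of_nonpos (by linarith)]
    nlinarith

theorem image_separation_of_ne {b z : ℝ} (hb : 0 < b) (hb' : b < 1 / 2) (h : |z| ≤ 1) {m : ℤ}
    (hm : m ≠ 0) : b * |(m:ℝ) + 1 / 2| ≤ |z + 2 * m| := by
  rw [abs_le] at h
  rcases lt_or_gt_of_ne hm with h1 | h1
  · have hm : (m:ℝ) ≤ -1 := by exact_mod_cast (by omega : m ≤ -1)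
    rw [abs_of_nonpos (by linarith), abs_of_nonpos (by linarith)]
    nlinarith
  · have hm : (1:ℝ) ≤ m := by exact_mod_cast (by omega : 1 ≤ m)
    rw [abs_of_nonneg (by linarith), abs_of_nonneg (by linarith)]
    nlinarith

/-- Weights of the images different from the point itself. -/
noncomputable def offOrigin (m : ℤ) : ℝ := if m = 0 then 0 else 1

theorem offOrigin_spec {b z : ℝ} (hb : 0 < b) (hb' : b < 1 / 2) (h : |z| ≤ 1) (m : ℤ) :
    offOrigin m = 0 ∨ (offOrigin m = 1 ∧ b * |(m:ℝ) + 1 / 2| ≤ |z + 2 * m|) := by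
  unfold offOrigin
  split_ifs with h0
  · exact Or.inl rfl
  · exact Or.inr ⟨rfl, image_separation_of_ne hb hb' h h0⟩

/-- Free kernel, damping correction and remaining images; only the first term survives at order √Δ.
-/
theorem periodicHeat_eq {ϑ b z : ℝ} (γ : ℝ) (hϑ : 0 < ϑ) (hb : 0 < b) (hb' : b < 1 / 2)
    (h : |z| ≤ 1) (s : ℝ) : periodicHeat ϑ γ z s = (heatK (ϑ * s) z
      + (Real.exp (-γ * s) - 1) * heatK (ϑ * s) z) + Real.exp (-γ * s) * imageSum ϑ z offOrigin s := by
  have key : imageSum ϑ z (fun _ => 1) s = heatK (ϑ * s) z + imageSum ϑ z offOrigin s := by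
    unfold imageSum
    rcases le_or_gt 0 s with hs | hs
    · have h1 := (summable_imageSum hϑ hb (offOrigin_spec hb hb' h) hs).hasSum
      have h2 : HasSum (fun m : ℤ => if m = 0 then heatK (ϑ * s) z else 0) (heatK (ϑ * s) z) :=
        hasSum_ite_eq 0 _
      rw [← (h2.add h1).tsum_eq]
      refine tsum_congr fun m => ?_
      unfold offOrigin
      split_ifs with h0 <;> simp [h0]
    · have h0 : ∀ w, heatK (ϑ * s) w = 0 := heatK_of_nonpos (by nlinarith)
      simp [h0]
  unfold periodicHeat
  rw [key]; ring

theorem intervalIntegrable_periodicHeat {ϑ b z : ℝ} (γ : ℝ) (hϑ : 0 < ϑ) (hb : 0 < b)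
    (hb' : b < 1 / 2) (hz : |z| ≤ 1 ∨ (2 * b ≤ z ∧ z ≤ 2 - 2 * b)) {t : ℝ} (ht : 0 ≤ t) :
    IntervalIntegrable (periodicHeat ϑ γ z) volume 0 t := by
  rcases hz with h | ⟨h1, h2⟩
  · rw [funext (periodicHeat_eq γ hϑ hb hb' h)]
    exact ((intervalIntegrable_heatK hϑ.le z le_rfl ht).add
      (intervalIntegrable_damped_heatK γ hϑ z ht)).add
      (intervalIntegrable_damped_imageSum γ hϑ hb (offOrigin_spec hb hb' h) ht)
  · exact intervalIntegrable_damped_imageSum γ hϑ hb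
      (fun m => Or.inr ⟨rfl, image_separation hb hb' h1 h2 m⟩) ht

theorem exists_abs_timeDiff_periodicHeat_le {ϑ b T : ℝ} (γ : ℝ) (hϑ : 0 < ϑ) (hb : 0 < b)
    (hb' : b < 1 / 2) (hT : 0 < T) :
    ∃ C : ℝ, 0 ≤ C ∧ ∀ (Δ : ℝ) (n : ℕ), 0 < Δ → ((n:ℝ) + 1) * Δ ≤ T → ∀ z,
      (2 * b ≤ z → z ≤ 2 - 2 * b → |timeDiff (periodicHeat ϑ γ z) Δ n| ≤ C * (Δ * √Δ)) ∧
      (|z| ≤ 1 → |timeDiff (periodicHeat ϑ γ z) Δ n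
        - √Δ / √ϑ * timeDiff (fun s => heatK s (z / √(ϑ * Δ))) 1 n| ≤ C * (Δ * √Δ)) := by
  set C1 := 2 * (Real.exp (|γ| * T) * imageConst ϑ b * (1 + |γ| * T)) with hC1
  set C2 := 4 * (|γ| * Real.exp (|γ| * T) / √ϑ) with hC2
  have hL := imageConst_nonneg hϑ hb
  have h1 : 0 ≤ C1 := by positivity
  have h2 : 0 ≤ C2 := by positivity
  refine ⟨C1 * √T + C2, by positivity, fun Δ n hΔ hn z => ?_⟩
  have hΔT : Δ ≤ T := le_trans (by nlinarith [n.cast_nonneg (α := ℝ)]) hn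
  have h3 : C1 * Δ ^ 2 ≤ C1 * √T * (Δ * √Δ) := by
    calc C1 * Δ ^ 2 = C1 * (Δ * (√Δ * √Δ)) := by rw [Real.mul_self_sqrt hΔ.le, sq]
      _ ≤ C1 * (Δ * (√T * √Δ)) := by gcongr
      _ = _ := by ring
  have h4 : 0 ≤ C2 * (Δ * √Δ) := by positivity
  refine ⟨fun hz1 hz2 => ?_, fun hz => ?_⟩
  · refine (abs_timeDiff_damped_imageSum_le hϑ hb
      (fun m => Or.inr ⟨rfl, image_separation hb hb' hz1 hz2 m⟩) hΔ n hn).trans ?_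
    rw [← hC1]; linarith
  · rw [← timeDiff_heatK_scale hϑ hΔ, funext (periodicHeat_eq γ hϑ hb hb' hz),
      timeDiff_add (f := fun s => heatK (ϑ * s) z + (Real.exp (-γ * s) - 1) * heatK (ϑ * s) z) hΔ.le n
        (fun t ht _ => (intervalIntegrable_heatK hϑ.le z le_rfl ht).add
          (intervalIntegrable_damped_heatK γ hϑ z ht))
        (fun t ht _ => intervalIntegrable_damped_imageSum γ hϑ hb (offOrigin_spec hb hb' hz) ht),
      timeDiff_add hΔ.le n (fun t ht _ => intervalIntegrable_heatK hϑ.le z le_rfl ht)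
        (fun t ht _ => intervalIntegrable_damped_heatK γ hϑ z ht),
      add_assoc, add_sub_cancel_left]
    refine (abs_add_le _ _).trans ?_
    have k1 := abs_timeDiff_damping_le (z := z) (γ := γ) hϑ hΔ n hn
    have k2 := abs_timeDiff_damped_imageSum_le (γ := γ) hϑ hb (offOrigin_spec hb hb' hz) hΔ n hn
    rw [← hC1] at k2
    rw [← hC2] at k1
    linarith

/-! ### Spectral series of the covariance -/

theorem exists_eigenvalue_lower_bound {ϑ Γ : ℝ} (hϑ : 0 < ϑ) (hΓ : 0 < Γ + Real.pi ^ 2) :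
    ∃ c > 0, ∀ l : ℕ, c * ((l:ℝ) + 1) ^ 2 ≤ ϑ * (Real.pi ^ 2 * ((l:ℝ) + 1) ^ 2 + Γ) := by
  -- The two entries serve Γ ≥ 0 and Γ ≤ 0; in the second case Γ is absorbed because (l + 1)² ≥ 1.
  refine ⟨ϑ * min (Real.pi ^ 2) (Γ + Real.pi ^ 2), mul_pos hϑ (lt_min (by positivity) hΓ),
    fun l => ?_⟩
  rw [mul_assoc]
  refine mul_le_mul_of_nonneg_left ?_ hϑ.le
  have h1 : (1:ℝ) ≤ ((l:ℝ) + 1) ^ 2 := by nlinarith [l.cast_nonneg (α := ℝ)]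
  rcases le_total 0 Γ with h | h
  · rw [min_eq_left (by linarith)]; nlinarith
  · rw [min_eq_right (by linarith)]; nlinarith

theorem summable_inv_eigenvalue {ϑ Γ : ℝ} (hϑ : 0 < ϑ) (hΓ : 0 < Γ + Real.pi ^ 2) :
    Summable fun l : ℕ => 1 / (ϑ * (Real.pi ^ 2 * ((l:ℝ) + 1) ^ 2 + Γ)) := by
  obtain ⟨c, hc, h⟩ := exists_eigenvalue_lower_bound hϑ hΓ
  have h1 : Summable fun l : ℕ => 1 / ((l:ℝ) + 1) ^ 2 := by
    have := (summable_nat_add_iff 1).2 (Real.summable_one_div_nat_pow.2 (le_refl 2))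
    simpa using this
  refine Summable.of_nonneg_of_le (fun l => ?_) (fun l => ?_) (h1.mul_left (1 / c))
  · have := h l
    have h2 : 0 < c * ((l:ℝ) + 1) ^ 2 := by positivity
    exact one_div_nonneg.2 (h2.le.trans this)
  · rw [div_mul_div_comm, one_mul]
    exact one_div_le_one_div_of_le (by positivity) (h l)

/-- The product 2 sin sin is a difference of cosines at x - y and x + y, and the constants -1/2
cancel. -/
theorem hasSum_exp_eigenvalue {ϑ Γ s : ℝ} (hϑ : 0 < ϑ) (hs : 0 < s) (x y : ℝ) :
    HasSum (fun l : ℕ => Real.exp (-(ϑ * (Real.pi ^ 2 * ((l:ℝ) + 1) ^ 2 + Γ)) * s)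
      * (2 * Real.sin (Real.pi * (l + 1) * x) * Real.sin (Real.pi * (l + 1) * y)))
      (periodicHeat ϑ (ϑ * Γ) (x - y) s - periodicHeat ϑ (ϑ * Γ) (x + y) s) := by
  have h := ((hasSum_exp_mul_cos (τ := ϑ * s) (by positivity) (x - y)).sub
    (hasSum_exp_mul_cos (τ := ϑ * s) (by positivity) (x + y))).mul_left (Real.exp (-(ϑ * Γ) * s))
  have e2 : periodicHeat ϑ (ϑ * Γ) (x - y) s - periodicHeat ϑ (ϑ * Γ) (x + y) s
      = Real.exp (-(ϑ * Γ) * s) * (∑' m : ℤ, heatK (ϑ * s) (x - y + 2 * m) - 1 / 2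
        - (∑' m : ℤ, heatK (ϑ * s) (x + y + 2 * m) - 1 / 2)) := by
    simp only [periodicHeat, imageSum, one_mul]; ring
  have e1 : (fun l : ℕ => Real.exp (-(ϑ * (Real.pi ^ 2 * ((l:ℝ) + 1) ^ 2 + Γ)) * s)
      * (2 * Real.sin (Real.pi * (l + 1) * x) * Real.sin (Real.pi * (l + 1) * y)))
      = fun l : ℕ => Real.exp (-(ϑ * Γ) * s) * (Real.exp (-(ϑ * s) * (Real.pi * (l + 1)) ^ 2)
        * Real.cos (Real.pi * (l + 1) * (x - y)) - Real.exp (-(ϑ * s) * (Real.pi * (l + 1)) ^ 2)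
        * Real.cos (Real.pi * (l + 1) * (x + y))) := by
    funext l
    rw [show -(ϑ * (Real.pi ^ 2 * ((l:ℝ) + 1) ^ 2 + Γ)) * s
      = -(ϑ * Γ) * s + -(ϑ * s) * (Real.pi * ((l:ℝ) + 1)) ^ 2 by ring, Real.exp_add,
      mul_sub (Real.pi * ((l:ℝ) + 1)), mul_add (Real.pi * ((l:ℝ) + 1)) x, Real.cos_sub, Real.cos_add]
    ring
  rw [e1, e2]
  exact h

theorem integral_exp_neg_mul {c : ℝ} (hc : c ≠ 0) (t : ℝ) :
    ∫ s in (0:ℝ)..t, Real.exp (-c * s) = (1 - Real.exp (-c * t)) / c := by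
  have := intervalIntegral.integral_comp_mul_left (a := 0) (b := t) Real.exp (neg_ne_zero.2 hc)
  rw [this, integral_exp, mul_zero, Real.exp_zero, smul_eq_mul]
  field_simp
  ring

/-- Sum and integral are exchanged because ∫₀ᵗ exp(-λs) ds ≤ 1/λ is summable over the modes. -/
theorem hasSum_integral_exp_eigenvalue {ϑ Γ b t x y : ℝ} (hϑ : 0 < ϑ) (hΓ : 0 < Γ + Real.pi ^ 2)
    (hb : 0 < b) (hb' : b < 1 / 2) (hxy : |x - y| ≤ 1) (h1 : 2 * b ≤ x + y) (h2 : x + y ≤ 2 - 2 * b)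
    (ht : 0 ≤ t) :
    HasSum (fun l : ℕ => (∫ s in (0:ℝ)..t, Real.exp (-(ϑ * (Real.pi ^ 2 * ((l:ℝ) + 1) ^ 2 + Γ)) * s))
      * (2 * Real.sin (Real.pi * (l + 1) * x) * Real.sin (Real.pi * (l + 1) * y)))
      ((∫ s in (0:ℝ)..t, periodicHeat ϑ (ϑ * Γ) (x - y) s)
        - ∫ s in (0:ℝ)..t, periodicHeat ϑ (ϑ * Γ) (x + y) s) := by
  obtain ⟨c, hc, hlow⟩ := exists_eigenvalue_lower_bound hϑ hΓ
  set lam : ℕ → ℝ := fun l => ϑ * (Real.pi ^ 2 * ((l:ℝ) + 1) ^ 2 + Γ)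
  have hlam : ∀ l, 0 < lam l := fun l => lt_of_lt_of_le (by positivity) (hlow l)
  set w : ℕ → ℝ := fun l => 2 * Real.sin (Real.pi * (l + 1) * x) * Real.sin (Real.pi * (l + 1) * y)
  have hw : ∀ l, |w l| ≤ 2 := fun l => by
    simp only [w, abs_mul, abs_two]
    have := Real.abs_sin_le_one (Real.pi * (l + 1) * x)
    have := Real.abs_sin_le_one (Real.pi * (l + 1) * y)
    nlinarith [abs_nonneg (Real.sin (Real.pi * (l + 1) * x)),
      abs_nonneg (Real.sin (Real.pi * (l + 1) * y))]
  have hint : ∀ l, Integrable (fun s => Real.exp (-lam l * s) * w l) (volume.restrict (Ioc 0 t)) :=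
    fun l => by
      have : Continuous fun s => Real.exp (-lam l * s) * w l := by fun_prop
      exact (this.intervalIntegrable 0 t).1
  have hI : ∀ l, ∫ s in Ioc 0 t, Real.exp (-lam l * s) ≤ 1 / lam l := fun l => by
    rw [← intervalIntegral.integral_of_le ht, integral_exp_neg_mul (hlam l).ne']
    have := hlam l
    gcongr
    linarith [Real.exp_pos (-lam l * t)]
  have hsum : Summable fun l => ∫ s in Ioc 0 t, ‖Real.exp (-lam l * s) * w l‖ := by
    refine Summable.of_nonneg_of_le (fun l => integral_nonneg fun _ => norm_nonneg _) (fun l => ?_)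
      ((summable_inv_eigenvalue hϑ hΓ).mul_right 2)
    have : ∀ s, ‖Real.exp (-lam l * s) * w l‖ = Real.exp (-lam l * s) * |w l| := fun s => by
      rw [norm_mul, Real.norm_of_nonneg (Real.exp_pos _).le, Real.norm_eq_abs]
    simp_rw [this]
    rw [integral_mul_const]
    exact mul_le_mul (hI l) (hw l) (abs_nonneg _) (one_div_nonneg.2 (hlam l).le)
  have key := hasSum_integral_of_summable_integral_norm hint hsum
  have e2 : ∫ s in Ioc 0 t, ∑' l, Real.exp (-lam l * s) * w l
      = (∫ s in (0:ℝ)..t, periodicHeat ϑ (ϑ * Γ) (x - y) s)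
        - ∫ s in (0:ℝ)..t, periodicHeat ϑ (ϑ * Γ) (x + y) s := by
    rw [← intervalIntegral.integral_sub (intervalIntegrable_periodicHeat _ hϑ hb hb' (Or.inl hxy) ht)
      (intervalIntegrable_periodicHeat _ hϑ hb hb' (Or.inr ⟨h1, h2⟩) ht),
      intervalIntegral.integral_of_le ht]
    exact setIntegral_congr_fun measurableSet_Ioc fun s hs =>
      (hasSum_exp_eigenvalue (Γ := Γ) hϑ hs.1 x y).tsum_eq
  rw [e2] at key
  have e1 : (fun l : ℕ => (∫ s in (0:ℝ)..t, Real.exp (-lam l * s)) * w l)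
      = fun l : ℕ => ∫ s in Ioc 0 t, Real.exp (-lam l * s) * w l := by
    funext l
    rw [integral_mul_const, intervalIntegral.integral_of_le ht]
  rw [e1]
  exact key

theorem hasSum_timeDiff_exp_eigenvalue {ϑ Γ b x y Δ : ℝ} (hϑ : 0 < ϑ) (hΓ : 0 < Γ + Real.pi ^ 2)
    (hb : 0 < b) (hb' : b < 1 / 2) (hxy : |x - y| ≤ 1) (h1 : 2 * b ≤ x + y) (h2 : x + y ≤ 2 - 2 * b)
    (hΔ : 0 ≤ Δ) (n : ℕ) :
    HasSum (fun l : ℕ => timeDiff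
        (fun s => Real.exp (-(ϑ * (Real.pi ^ 2 * ((l:ℝ) + 1) ^ 2 + Γ)) * s)) Δ n
      * (2 * Real.sin (Real.pi * (l + 1) * x) * Real.sin (Real.pi * (l + 1) * y)))
      (timeDiff (periodicHeat ϑ (ϑ * Γ) (x - y)) Δ n
        - timeDiff (periodicHeat ϑ (ϑ * Γ) (x + y)) Δ n) := by
  have H := fun t (ht : 0 ≤ t) => hasSum_integral_exp_eigenvalue hϑ hΓ hb hb' hxy h1 h2 ht
  have h := ((H (((n:ℝ) + 1) * Δ) (by positivity)).add (H (|(n:ℝ) - 1| * Δ) (by positivity))).sub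
    ((H ((n:ℝ) * Δ) (by positivity)).mul_left 2)
  have e2 : timeDiff (periodicHeat ϑ (ϑ * Γ) (x - y)) Δ n
        - timeDiff (periodicHeat ϑ (ϑ * Γ) (x + y)) Δ n
      = (((∫ s in (0:ℝ)..((n:ℝ) + 1) * Δ, periodicHeat ϑ (ϑ * Γ) (x - y) s)
        - ∫ s in (0:ℝ)..((n:ℝ) + 1) * Δ, periodicHeat ϑ (ϑ * Γ) (x + y) s)
        + ((∫ s in (0:ℝ)..|(n:ℝ) - 1| * Δ, periodicHeat ϑ (ϑ * Γ) (x - y) s)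
        - ∫ s in (0:ℝ)..|(n:ℝ) - 1| * Δ, periodicHeat ϑ (ϑ * Γ) (x + y) s))
        - 2 * ((∫ s in (0:ℝ)..(n:ℝ) * Δ, periodicHeat ϑ (ϑ * Γ) (x - y) s)
        - ∫ s in (0:ℝ)..(n:ℝ) * Δ, periodicHeat ϑ (ϑ * Γ) (x + y) s) := by
    unfold timeDiff
    ring
  have e1 : ∀ l : ℕ, timeDiff
        (fun s => Real.exp (-(ϑ * (Real.pi ^ 2 * ((l:ℝ) + 1) ^ 2 + Γ)) * s)) Δ n
      * (2 * Real.sin (Real.pi * (l + 1) * x) * Real.sin (Real.pi * (l + 1) * y))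
      = ((∫ s in (0:ℝ)..((n:ℝ) + 1) * Δ, Real.exp (-(ϑ * (Real.pi ^ 2 * ((l:ℝ) + 1) ^ 2 + Γ)) * s))
      * (2 * Real.sin (Real.pi * (l + 1) * x) * Real.sin (Real.pi * (l + 1) * y))
      + (∫ s in (0:ℝ)..|(n:ℝ) - 1| * Δ, Real.exp (-(ϑ * (Real.pi ^ 2 * ((l:ℝ) + 1) ^ 2 + Γ)) * s))
      * (2 * Real.sin (Real.pi * (l + 1) * x) * Real.sin (Real.pi * (l + 1) * y)))
      - 2 * ((∫ s in (0:ℝ)..(n:ℝ) * Δ, Real.exp (-(ϑ * (Real.pi ^ 2 * ((l:ℝ) + 1) ^ 2 + Γ)) * s))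
      * (2 * Real.sin (Real.pi * (l + 1) * x) * Real.sin (Real.pi * (l + 1) * y))) := fun l => by
    unfold timeDiff
    ring
  rw [e2, funext e1]
  exact h

theorem timeDiff_exp {c Δ : ℝ} (hc : c ≠ 0) (n : ℕ) :
    timeDiff (fun s => Real.exp (-c * s)) Δ n = (2 * Real.exp (-c * (n * Δ))
      - Real.exp (-c * ((n + 1) * Δ)) - Real.exp (-c * (|(n:ℝ) - 1| * Δ))) / c := by
  unfold timeDiff
  rw [integral_exp_neg_mul hc, integral_exp_neg_mul hc, integral_exp_neg_mul hc]
  ring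

/-! ### Covariance of the weighted double increments -/

/-- The time-differenced covariance of the weighted spatial increments over `[x, x + δ]` and
`[y, y + δ]`, the weights being `a` at the right and `a⁻¹` at the left end points. -/
noncomputable def incrementCov (ϑ γ a δ Δ x y : ℝ) (n : ℕ) : ℝ :=
  a ^ 2 * (timeDiff (periodicHeat ϑ γ (x - y)) Δ n
      - timeDiff (periodicHeat ϑ γ (x + y + 2 * δ)) Δ n)
    - (timeDiff (periodicHeat ϑ γ (x - y + δ)) Δ n - timeDiff (periodicHeat ϑ γ (x + y + δ)) Δ n)
    - (timeDiff (periodicHeat ϑ γ (x - y - δ)) Δ n - timeDiff (periodicHeat ϑ γ (x + y + δ)) Δ n)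
    + a⁻¹ ^ 2 * (timeDiff (periodicHeat ϑ γ (x - y)) Δ n - timeDiff (periodicHeat ϑ γ (x + y)) Δ n)

theorem hasSum_incrementCov {ϑ Γ b a δ x y Δ : ℝ} (hϑ : 0 < ϑ) (hΓ : 0 < Γ + Real.pi ^ 2)
    (hb : 0 < b) (hb' : b < 1 / 2) (ha : a ≠ 0) (hδ : 0 ≤ δ) (hx : b ≤ x) (hx' : x + δ ≤ 1 - b)
    (hy : b ≤ y) (hy' : y + δ ≤ 1 - b) (hΔ : 0 ≤ Δ) (n : ℕ) :
    HasSum (fun l : ℕ => timeDiff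
        (fun s => Real.exp (-(ϑ * (Real.pi ^ 2 * ((l:ℝ) + 1) ^ 2 + Γ)) * s)) Δ n
      * ((√2 * (a * Real.sin (Real.pi * (l + 1) * (x + δ)) - a⁻¹ * Real.sin (Real.pi * (l + 1) * x)))
        * (√2 * (a * Real.sin (Real.pi * (l + 1) * (y + δ))
          - a⁻¹ * Real.sin (Real.pi * (l + 1) * y)))))
      (incrementCov ϑ (ϑ * Γ) a δ Δ x y n) := by
  have H : ∀ p q : ℝ, b ≤ p → p ≤ 1 - b → b ≤ q → q ≤ 1 - b → _ := fun p q h1 h2 h3 h4 =>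
    hasSum_timeDiff_exp_eigenvalue (x := p) (y := q) hϑ hΓ hb hb'
      (by rw [abs_le]; constructor <;> linarith) (by linarith) (by linarith) hΔ n
  have h := (((((H (x + δ) (y + δ) (by linarith) hx' (by linarith) hy').mul_left (a ^ 2))).sub
    (H (x + δ) y (by linarith) hx' hy (by linarith))).sub
    (H x (y + δ) hx (by linarith) (by linarith) hy')).add
    ((H x y hx (by linarith) hy (by linarith)).mul_left (a⁻¹ ^ 2))
  rw [show x + δ - (y + δ) = x - y by ring, show x + δ + (y + δ) = x + y + 2 * δ by ring,
    show x + δ - y = x - y + δ by ring, show x + δ + y = x + y + δ by ring,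
    show x - (y + δ) = x - y - δ by ring, show x + (y + δ) = x + y + δ by ring] at h
  have e2 : ∀ (A B C D : ℝ), (√2 * (a * A - a⁻¹ * B)) * (√2 * (a * C - a⁻¹ * D))
      = a ^ 2 * (2 * A * C) - 2 * A * D - 2 * B * C + a⁻¹ ^ 2 * (2 * B * D) := fun A B C D => by
    have h2 : √2 * √2 = 2 := Real.mul_self_sqrt (by norm_num)
    have h3 : a * a⁻¹ = 1 := mul_inv_cancel₀ ha
    linear_combination (a * A - a⁻¹ * B) * (a * C - a⁻¹ * D) * h2 - 2 * (A * D + B * C) * h3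
  simp_rw [e2]
  refine Eq.mp (congrArg (fun f => HasSum f _) (funext fun l => ?_)) h
  ring

/-- With a = exp(-κδ/4) this gives (a - a⁻¹)² = O(δ²) = O(Δ), small enough to neglect the asymmetry
of the weights. -/
theorem abs_exp_sub_inv_le {κ δ : ℝ} (h0 : 0 ≤ δ) (h1 : δ ≤ 1) :
    |Real.exp (-(κ * δ / 4)) - (Real.exp (-(κ * δ / 4)))⁻¹|
      ≤ Real.exp (|κ|) * (|κ| * Real.exp |κ|) * δ := by
  have h := abs_exp_sub_exp_le (γ := κ / 2) (T := 1) (s := 0) (s' := δ) le_rfl h0 zero_le_one h1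
  rw [← Real.exp_neg, neg_neg]
  have e : Real.exp (-(κ * δ / 4)) - Real.exp (κ * δ / 4)
      = Real.exp (κ * δ / 4) * (Real.exp (-(κ / 2) * δ) - Real.exp (-(κ / 2) * 0)) := by
    rw [mul_sub, ← Real.exp_add, ← Real.exp_add]; congr 2 <;> ring
  rw [e, abs_mul, Real.abs_exp, mul_assoc]
  have hk : κ * δ ≤ |κ| := le_trans (le_abs_self _) (by
    rw [abs_mul, abs_of_nonneg h0]; exact mul_le_of_le_one_right (abs_nonneg _) h1)
  have hk0 := abs_nonneg κ
  refine mul_le_mul (Real.exp_le_exp.2 (by linarith)) (h.trans ?_) (abs_nonneg _) (Real.exp_pos _).le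
  rw [sub_zero, abs_of_nonneg h0, mul_one, abs_div, abs_two]
  have h3 : |κ| / 2 ≤ |κ| := by linarith
  gcongr

theorem exp_sq_le {κ δ : ℝ} (h0 : 0 ≤ δ) (h1 : δ ≤ 1) :
    Real.exp (-(κ * δ / 4)) ^ 2 ≤ Real.exp |κ| ∧ (Real.exp (-(κ * δ / 4)))⁻¹ ^ 2 ≤ Real.exp |κ| := by
  have hk : |κ * δ| ≤ |κ| := by
    rw [abs_mul, abs_of_nonneg h0]; exact mul_le_of_le_one_right (abs_nonneg _) h1
  have hk' := abs_le.1 hk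
  rw [← Real.exp_neg, ← Real.exp_nat_mul, ← Real.exp_nat_mul]
  push_cast
  have hk0 := abs_nonneg κ
  exact ⟨Real.exp_le_exp.2 (by linarith), Real.exp_le_exp.2 (by linarith)⟩

/-- The terms in x - y form a second spatial difference of the scaled kernel, that is Λ; the terms
in x + y are pure remainders. Uniformity in positions and lags yields the entrywise error needed in
the limit theorem. -/
theorem exists_abs_incrementCov_sub_le {ϑ b T : ℝ} (γ κ r : ℝ) (hϑ : 0 < ϑ) (hb : 0 < b)
    (hb' : b < 1 / 2) (hT : 0 < T) (hr : 0 ≤ r) :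
    ∃ C : ℝ, ∀ (Δ δ x y : ℝ) (i j : ℤ), 0 < Δ → ((i.natAbs : ℝ) + 1) * Δ ≤ T → δ = r * √Δ →
      b ≤ x → x + δ ≤ 1 - b → b ≤ y → y + δ ≤ 1 - b → x - y = j * δ →
      |incrementCov ϑ γ (Real.exp (-(κ * δ / 4))) δ Δ x y i.natAbs
        - √Δ * (-(2 / √ϑ) * LambdaFun (r / √ϑ) i j)| ≤ C * (Δ * √Δ) := by
  obtain ⟨C, hC0, hC⟩ := exists_abs_timeDiff_periodicHeat_le γ hϑ hb hb' hT
  obtain ⟨A, hA0, hA⟩ := exists_abs_timeDiff_heatK_le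
  set K := Real.exp (|κ|) * (|κ| * Real.exp |κ|) with hK
  -- The 4 counts the three kernel comparisons with weights 2, 1, 1; the exponentials bound a² and
  -- a⁻² on two reflected terms; the final 2 is the middle reflected term. The rest bounds (a -
  -- a⁻¹)² B.
  refine ⟨(4 + 2 * Real.exp |κ| + 2) * C + (K * r) ^ 2 * (C * T + A / √ϑ), ?_⟩
  intro Δ δ x y i j hΔ hi hδ hx hx' hy hy' hxy
  have hsΔ : 0 < √Δ := Real.sqrt_pos.2 hΔ
  have hsϑ : 0 < √ϑ := Real.sqrt_pos.2 hϑ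
  have hδ0 : 0 ≤ δ := by rw [hδ]; positivity
  have hδ1 : δ ≤ 1 := by linarith
  set n := i.natAbs with hn
  have hΔT : Δ ≤ T := le_trans (by nlinarith [n.cast_nonneg (α := ℝ)]) hi
  set a := Real.exp (-(κ * δ / 4)) with ha
  have ha0 : a ≠ 0 := (Real.exp_pos _).ne'
  obtain ⟨ha1, ha2⟩ := exp_sq_le (κ := κ) hδ0 hδ1
  have ha3 := abs_exp_sub_inv_le (κ := κ) hδ0 hδ1
  rw [← ha] at ha1 ha2 ha3
  set F : ℝ → ℝ := fun w => timeDiff (fun s => heatK s w) 1 n with hF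
  set B : ℝ → ℝ := fun z => timeDiff (periodicHeat ϑ γ z) Δ n with hB
  have hdiff : ∀ m : ℝ, |m * δ| ≤ 1 →
      |B (m * δ) - √Δ / √ϑ * F (r / √ϑ * m)| ≤ C * (Δ * √Δ) := fun m hm => by
    have := (hC Δ n hΔ hi (m * δ)).2 hm
    rwa [show m * δ / √(ϑ * Δ) = r / √ϑ * m by
      rw [Real.sqrt_mul hϑ.le, hδ]; field_simp] at this
  have hsum : ∀ z, 2 * b ≤ z → z ≤ 2 - 2 * b → |B z| ≤ C * (Δ * √Δ) := fun z =>
    (hC Δ n hΔ hi z).1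
  have d0 := hdiff j (by rw [← hxy, abs_le]; constructor <;> linarith)
  have d1 := hdiff (j + 1) (by rw [add_mul, ← hxy, abs_le]; constructor <;> linarith)
  have d2 := hdiff (j - 1) (by rw [sub_mul, ← hxy, abs_le]; constructor <;> linarith)
  have s0 := hsum (x + y) (by linarith) (by linarith)
  have s1 := hsum (x + y + δ) (by linarith) (by linarith)
  have s2 := hsum (x + y + 2 * δ) (by linarith) (by linarith)
  have hFj : |F (r / √ϑ * j)| ≤ A := (hA n _).trans (div_le_self hA0 (by
    have h1 : (1:ℝ) ≤ 1 + n := by linarith [n.cast_nonneg (α := ℝ)]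
    have h2 : 1 ≤ √(1 + (n:ℝ)) := Real.one_le_sqrt.2 h1
    nlinarith))
  have hΛ := LambdaFun_eq (h := r / √ϑ) (by positivity) i j
  -- The coefficient a² + a⁻² is split as 2 + (a - a⁻¹)², and the 2 completes the second difference.
  have e : incrementCov ϑ γ a δ Δ x y n - √Δ * (-(2 / √ϑ) * LambdaFun (r / √ϑ) i j)
      = 2 * (B (j * δ) - √Δ / √ϑ * F (r / √ϑ * j))
        - (B ((j + 1) * δ) - √Δ / √ϑ * F (r / √ϑ * (j + 1)))
        - (B ((j - 1) * δ) - √Δ / √ϑ * F (r / √ϑ * (j - 1)))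
        + (a - a⁻¹) ^ 2 * B (j * δ)
        - a ^ 2 * B (x + y + 2 * δ) - a⁻¹ ^ 2 * B (x + y) + 2 * B (x + y + δ) := by
    have h3 : a * a⁻¹ = 1 := mul_inv_cancel₀ ha0
    have e1 : (j + 1 : ℝ) * δ = x - y + δ := by rw [add_mul, ← hxy]; ring
    have e2 : (j - 1 : ℝ) * δ = x - y - δ := by rw [sub_mul, ← hxy]; ring
    rw [e1, e2, ← hxy]
    have h4 : √Δ * (-(2 / √ϑ) * LambdaFun (r / √ϑ) i j) = -(√Δ / √ϑ) * (2 * LambdaFun (r / √ϑ) i j) := by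
      ring
    rw [h4, hΛ]
    simp only [incrementCov, hB, hF, hn]
    linear_combination 2 * timeDiff (periodicHeat ϑ γ (x - y)) Δ i.natAbs * h3
  have q1 : (a - a⁻¹) ^ 2 ≤ (K * r) ^ 2 * Δ := by
    rw [← sq_abs]
    calc _ ≤ (K * δ) ^ 2 := pow_le_pow_left₀ (abs_nonneg _) ha3 2
      _ = _ := by
        rw [hδ, ← mul_assoc, mul_pow (K * r) (√Δ), Real.sq_sqrt hΔ.le]
  have q2 : |B (j * δ)| ≤ (C * T + A / √ϑ) * √Δ := by
    have h1 : |B (j * δ)| ≤ C * (Δ * √Δ) + √Δ / √ϑ * A := by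
      have : |√Δ / √ϑ * F (r / √ϑ * j)| ≤ √Δ / √ϑ * A := by
        rw [abs_mul, abs_of_pos (by positivity : 0 < √Δ / √ϑ)]; gcongr
      have := abs_add_le (B (j * δ) - √Δ / √ϑ * F (r / √ϑ * j)) (√Δ / √ϑ * F (r / √ϑ * j))
      rw [sub_add_cancel] at this
      linarith
    have h2 : C * (Δ * √Δ) ≤ C * (T * √Δ) := by gcongr
    calc _ ≤ _ := h1
      _ ≤ C * (T * √Δ) + √Δ / √ϑ * A := by linarith
      _ = _ := by ring
  have q3 : |(a - a⁻¹) ^ 2 * B (j * δ)| ≤ (K * r) ^ 2 * (C * T + A / √ϑ) * (Δ * √Δ) := by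
    rw [abs_mul, abs_of_nonneg (sq_nonneg (a - a⁻¹))]
    calc _ ≤ ((K * r) ^ 2 * Δ) * ((C * T + A / √ϑ) * √Δ) :=
          mul_le_mul q1 q2 (abs_nonneg _) (by positivity)
      _ = _ := by ring
  have q4 : |a ^ 2 * B (x + y + 2 * δ)| ≤ Real.exp |κ| * (C * (Δ * √Δ)) := by
    rw [abs_mul, abs_of_nonneg (sq_nonneg a)]
    exact mul_le_mul ha1 s2 (abs_nonneg _) (Real.exp_pos _).le
  have q5 : |a⁻¹ ^ 2 * B (x + y)| ≤ Real.exp |κ| * (C * (Δ * √Δ)) := by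
    rw [abs_mul, abs_of_nonneg (sq_nonneg a⁻¹)]
    exact mul_le_mul ha2 s0 (abs_nonneg _) (Real.exp_pos _).le
  rw [e]
  have t0 := abs_le.1 d0
  have t1 := abs_le.1 d1
  have t2 := abs_le.1 d2
  have t3 := abs_le.1 q3
  have t4 := abs_le.1 q4
  have t5 := abs_le.1 q5
  have t6 := abs_le.1 s1
  have e7 : ((4 + 2 * Real.exp |κ| + 2) * C + (K * r) ^ 2 * (C * T + A / √ϑ)) * (Δ * √Δ)
      = 6 * (C * (Δ * √Δ)) + 2 * (Real.exp |κ| * (C * (Δ * √Δ)))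
        + (K * r) ^ 2 * (C * T + A / √ϑ) * (Δ * √Δ) := by ring
  rw [e7, abs_le]
  constructor <;> linarith

/-! ### Ornstein-Uhlenbeck modes as limits of Gaussian sums -/

/-- Discrete variation of constants: exp(-c(t - s_k))V(s_k) telescopes, and on each cell the
integrated equation replaces the increment of V by that of σB up to a drift error. No regularity of
B is needed. -/
theorem abs_ornsteinUhlenbeck_sub_riemann_le {c σ η S ω : ℝ} {V B : ℝ → ℝ} {K : ℕ} (hc : 0 < c)
    (hη : 0 ≤ η) (hcη : c * η ≤ 1) (hV : Continuous V)
    (h : ∀ t, 0 ≤ t → V t = V 0 - c * (∫ s in (0:ℝ)..t, V s) + σ * B t)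
    (hS : ∀ s, 0 ≤ s → s ≤ K * η → |V s| ≤ S)
    (hω : ∀ s s', 0 ≤ s → s ≤ K * η → 0 ≤ s' → s' ≤ K * η → |s - s'| ≤ η → |V s - V s'| ≤ ω) :
    |V (K * η) - (Real.exp (-c * (K * η)) * V 0 + ∑ k ∈ Finset.range K,
        σ * Real.exp (-c * (K * η - k * η)) * (B ((k + 1) * η) - B (k * η)))|
      ≤ K * η * (c ^ 2 * η * S + c * ω) := by
  have hsum := Finset.sum_range_sub (fun k : ℕ => Real.exp (-c * (K * η - k * η)) * V (k * η)) K
  simp only [sub_self, mul_zero, Real.exp_zero, one_mul, Nat.cast_zero, zero_mul, sub_zero] at hsum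
  have e : V (K * η) - (Real.exp (-c * (K * η)) * V 0 + ∑ k ∈ Finset.range K,
        σ * Real.exp (-c * (K * η - k * η)) * (B ((k + 1) * η) - B (k * η)))
      = ∑ k ∈ Finset.range K, Real.exp (-c * (K * η - k * η))
        * ((Real.exp (c * η) - 1 - c * η) * V ((k + 1) * η)
          - c * ∫ s in (k * η)..((k + 1) * η), (V s - V ((k + 1) * η))) := by
    rw [← sub_sub, ← hsum, ← Finset.sum_sub_distrib]
    refine Finset.sum_congr rfl fun k _ => ?_
    have i : ∀ x y, IntervalIntegrable V volume x y := fun x y => hV.intervalIntegrable x y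
    have h1 := h (k * η) (by positivity)
    have h2 := h ((k + 1) * η) (by positivity)
    have h3 := intervalIntegral.integral_interval_sub_left (i 0 ((k + 1) * η)) (i 0 (k * η))
    rw [intervalIntegral.integral_sub (i _ _) (by simp), intervalIntegral.integral_const, smul_eq_mul]
    have h4 : Real.exp (-c * (K * η - (k + 1) * η))
        = Real.exp (-c * (K * η - k * η)) * Real.exp (c * η) := by
      rw [← Real.exp_add]; congr 1; ring
    push_cast
    rw [h4, ← h3]
    linear_combination Real.exp (-c * (K * η - k * η)) * (h2 - h1)
  rw [e]
  have hb : ∀ k ∈ Finset.range K, |Real.exp (-c * (K * η - k * η))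
        * ((Real.exp (c * η) - 1 - c * η) * V ((k + 1) * η)
          - c * ∫ s in (k * η)..((k + 1) * η), (V s - V ((k + 1) * η)))|
      ≤ η * (c ^ 2 * η * S + c * ω) := by
    intro k hk
    have hk1 : ((k:ℝ) + 1) ≤ K := by exact_mod_cast Finset.mem_range.1 hk
    have hk2 : ((k:ℝ) + 1) * η ≤ K * η := mul_le_mul_of_nonneg_right hk1 hη
    have hk0 : (0:ℝ) ≤ k * η := by positivity
    have hkk : (k:ℝ) * η ≤ (k + 1) * η := by nlinarith
    rw [abs_mul, Real.abs_exp]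
    have g1 : Real.exp (-c * (K * η - k * η)) ≤ 1 := Real.exp_le_one_iff.2 (by nlinarith)
    have g2 : |(Real.exp (c * η) - 1 - c * η) * V ((k + 1) * η)| ≤ (c * η) ^ 2 * S := by
      rw [abs_mul]
      have := Real.abs_exp_sub_one_sub_id_le (x := c * η) (by rwa [abs_of_nonneg (by positivity)])
      exact mul_le_mul this (hS _ (by positivity) hk2) (abs_nonneg _) (sq_nonneg _)
    have g3 : |∫ s in (k * η)..((k + 1) * η), (V s - V ((k + 1) * η))| ≤ ω * η := by
      have := intervalIntegral.norm_integral_le_of_norm_le_const (a := (k:ℝ) * η) (b := (k + 1) * η)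
        (C := ω) (f := fun s => V s - V ((k + 1) * η)) (fun s hs => by
          rw [uIoc_of_le hkk] at hs
          exact hω _ _ (by linarith [hs.1]) (hs.2.trans hk2) (by linarith) hk2
            (by rw [abs_le]; constructor <;> linarith [hs.1, hs.2]))
      rwa [show ((k:ℝ) + 1) * η - k * η = η by ring, abs_of_nonneg hη] at this
    have g4 : |(Real.exp (c * η) - 1 - c * η) * V ((k + 1) * η)
          - c * ∫ s in (k * η)..((k + 1) * η), (V s - V ((k + 1) * η))| ≤ η * (c ^ 2 * η * S + c * ω) := by
      refine (abs_sub _ _).trans ?_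
      rw [abs_mul c, abs_of_pos hc]
      have := mul_le_mul_of_nonneg_left g3 hc.le
      nlinarith
    exact (mul_le_of_le_one_left (abs_nonneg _) g1).trans g4
  refine (Finset.abs_sum_le_sum_abs _ _).trans ((Finset.sum_le_sum hb).trans ?_)
  rw [Finset.sum_const, Finset.card_range, nsmul_eq_mul, ← mul_assoc]

theorem tendsto_ornsteinUhlenbeck_riemann {c σ Δ : ℝ} {V B : ℝ → ℝ} (hc : 0 < c) (hΔ : 0 ≤ Δ)
    (hV : Continuous V)
    (h : ∀ t, 0 ≤ t → V t = V 0 - c * (∫ s in (0:ℝ)..t, V s) + σ * B t) (n : ℕ) :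
    Tendsto (fun m : ℕ => Real.exp (-c * (n * Δ)) * V 0 + ∑ k ∈ Finset.range (n * (m + 1)),
        σ * Real.exp (-c * (n * Δ - k * (Δ / (m + 1))))
          * (B ((k + 1) * (Δ / (m + 1))) - B (k * (Δ / (m + 1))))) atTop (𝓝 (V (n * Δ))) := by
  set t := (n:ℝ) * Δ with ht
  have ht0 : 0 ≤ t := by positivity
  obtain ⟨S, hS⟩ := (isCompact_Icc (a := (0:ℝ)) (b := t)).exists_bound_of_continuousOn
    hV.continuousOn
  have huc := (isCompact_Icc (a := (0:ℝ)) (b := t)).uniformContinuousOn_of_continuous hV.continuousOn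
  rw [Metric.uniformContinuousOn_iff_le] at huc
  have hη : Tendsto (fun m : ℕ => Δ / ((m:ℝ) + 1)) atTop (𝓝 0) := by
    have := (tendsto_one_div_add_atTop_nhds_zero_nat (𝕜 := ℝ)).const_mul Δ
    simpa [div_eq_mul_inv] using this
  rw [Metric.tendsto_nhds]
  intro ε hε
  -- Chosen so that the part tcω of the limiting error is at most ε/2; the added 1 keeps the
  -- denominator positive.
  set ω := ε / (2 * (t * c + 1)) with hω
  obtain ⟨d, hd, hdω⟩ := huc ω (by positivity)
  have hlim : Tendsto (fun m : ℕ => t * (c ^ 2 * (Δ / ((m:ℝ) + 1)) * S + c * ω)) atTop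
      (𝓝 (t * (c ^ 2 * 0 * S + c * ω))) :=
    ((((hη.const_mul (c ^ 2)).mul_const S).add_const (c * ω)).const_mul t)
  have hlt : t * (c ^ 2 * 0 * S + c * ω) < ε := by
    have h1 : t * c * ω ≤ ε / 2 := by
      rw [hω, ← div_div, mul_div_assoc', div_le_iff₀ (by positivity)]
      nlinarith [mul_nonneg ht0 hc.le]
    linarith [show t * (c ^ 2 * 0 * S + c * ω) = t * c * ω by ring]
  have hcη : Tendsto (fun m : ℕ => c * (Δ / ((m:ℝ) + 1))) atTop (𝓝 (c * 0)) := hη.const_mul c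
  filter_upwards [hlim.eventually_lt_const hlt, hη.eventually_lt_const hd,
    hcη.eventually_lt_const (show c * 0 < 1 by simp)] with m h1 h2 h3
  have hm : ((n * (m + 1) : ℕ) : ℝ) * (Δ / (m + 1)) = t := by
    push_cast; rw [ht]; field_simp
  have key := abs_ornsteinUhlenbeck_sub_riemann_le (c := c) (σ := σ) (η := Δ / (m + 1)) (S := S) (ω := ω)
    (V := V) (B := B) (K := n * (m + 1)) hc (by positivity) h3.le hV h
    (by rw [hm]; exact fun s h0 h1 => hS s ⟨h0, h1⟩)
    (by
      rw [hm]
      exact fun s s' a1 a2 a3 a4 a5 => hdω s ⟨a1, a2⟩ s' ⟨a3, a4⟩ (a5.trans h2.le))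
  rw [hm] at key
  rw [dist_comm, Real.dist_eq]
  exact key.trans_lt h1

/-- A geometric sum; the ratio of mesh to denominator converges by the derivative of exp at 0. -/
theorem tendsto_riemann_exp {c Δ : ℝ} (hc : c ≠ 0) (hΔ : 0 < Δ) (n : ℕ) :
    Tendsto (fun m : ℕ => Δ / (m + 1) * ∑ k ∈ Finset.range (n * (m + 1)),
      Real.exp (c * (k * (Δ / (m + 1))))) atTop (𝓝 ((Real.exp (c * (n * Δ)) - 1) / c)) := by
  have hη : Tendsto (fun m : ℕ => c * (Δ / ((m:ℝ) + 1))) atTop (𝓝[≠] 0) := by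
    rw [tendsto_nhdsWithin_iff]
    refine ⟨?_, Eventually.of_forall fun m => by
      have : (0:ℝ) < Δ / (m + 1) := by positivity
      exact mul_ne_zero hc this.ne'⟩
    have := (tendsto_one_div_add_atTop_nhds_zero_nat (𝕜 := ℝ)).const_mul (c * Δ)
    simpa [div_eq_mul_inv, mul_assoc] using this
  have hd := (hasDerivAt_iff_tendsto_slope.1 (Real.hasDerivAt_exp 0)).comp hη
  rw [Real.exp_zero] at hd
  have h2 := ((hd.inv₀ one_ne_zero).const_mul ((Real.exp (c * (n * Δ)) - 1) / c))
  rw [inv_one, mul_one] at h2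
  refine h2.congr fun m => ?_
  have hm : (0:ℝ) < Δ / (m + 1) := by positivity
  have hq : Real.exp (c * (Δ / (m + 1))) ≠ 1 := by
    rw [Ne, Real.exp_eq_one_iff]; exact mul_ne_zero hc hm.ne'
  have hq' : Real.exp (c * (Δ / (m + 1))) - 1 ≠ 0 := sub_ne_zero.2 hq
  have e1 : ∀ k : ℕ, Real.exp (c * (k * (Δ / (m + 1)))) = Real.exp (c * (Δ / (m + 1))) ^ k := fun k => by
    rw [← Real.exp_nat_mul]; congr 1; ring
  have e2 : Real.exp (c * (n * Δ)) = Real.exp (c * (Δ / (m + 1))) ^ (n * (m + 1)) := by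
    rw [← e1]; congr 2; push_cast; field_simp
  simp_rw [e1]
  rw [geom_sum_eq hq, e2]
  simp only [Function.comp, slope_def_field, Real.exp_zero, sub_zero, inv_div]
  field_simp

theorem charFun_map_one {Ω : Type*} [MeasurableSpace Ω] {P : Measure Ω} {Z : Ω → ℝ}
    (hZ : AEMeasurable Z P) :
    charFun (P.map Z) 1 = ∫ ω, Complex.exp ((Z ω : ℂ) * Complex.I) ∂P := by
  rw [charFun_apply_real, integral_map hZ (by fun_prop)]
  simp

theorem HasLaw.charFun_map_const_mul {Ω : Type*} [MeasurableSpace Ω] {P : Measure Ω} {Z : Ω → ℝ}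
    {v : ℝ≥0} (hZ : HasLaw Z (gaussianReal 0 v) P) (a : ℝ) :
    charFun (P.map fun ω => a * Z ω) 1 = Complex.exp (-((a ^ 2 * v : ℝ) : ℂ) / 2) := by
  rw [charFun_map_mul_comp hZ.aemeasurable, hZ.map_eq, charFun_gaussianReal]
  congr 1
  push_cast
  ring

/-- A linear functional of the initial value and of the increments of the path `x.1` over the
first `K` cells of the grid of mesh `η`. -/
noncomputable def pathFunctional (A : ℝ) (c : ℕ → ℝ) (K : ℕ) (η : ℝ≥0) (x : (ℝ≥0 → ℝ) × ℝ) : ℝ :=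
  A * x.2 + ∑ k ∈ Finset.range K, c k * (x.1 (((k + 1 : ℕ) : ℝ≥0) * η) - x.1 ((k : ℝ≥0) * η))

theorem measurable_pathFunctional (A : ℝ) (c : ℕ → ℝ) (K : ℕ) (η : ℝ≥0) :
    Measurable (pathFunctional A c K η) := by
  unfold pathFunctional
  fun_prop

/-- Independence of the initial value and of the Brownian increments makes the variances add; the
sum η Σ c_k² is a discrete Itô isometry. -/
theorem charFun_map_pathFunctional {Ω : Type*} [MeasurableSpace Ω] {P : Measure Ω}
    [IsProbabilityMeasure P] {B : ℝ≥0 → Ω → ℝ} {U : Ω → ℝ} {v : ℝ≥0} (hBm : ∀ t, Measurable (B t))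
    (hU : Measurable U) (hB : IsPreBrownianReal B P) (hUl : HasLaw U (gaussianReal 0 v) P)
    (hind : IndepFun (fun ω => (fun t => B t ω : ℝ≥0 → ℝ)) U P) (A : ℝ) (c : ℕ → ℝ) (K : ℕ)
    (η : ℝ≥0) :
    charFun (P.map fun ω => pathFunctional A c K η (fun t => B t ω, U ω)) 1
      = Complex.exp (-((A ^ 2 * v + η * ∑ k ∈ Finset.range K, c k ^ 2 : ℝ) : ℂ) / 2) := by
  have h1 : IndepFun (fun ω => A * U ω) (fun ω => ∑ k ∈ Finset.range K,
      c k * (B (((k + 1 : ℕ) : ℝ≥0) * η) ω - B ((k : ℝ≥0) * η) ω)) P :=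
    (hind.comp (φ := fun f : ℝ≥0 → ℝ => ∑ k ∈ Finset.range K,
      c k * (f (((k + 1 : ℕ) : ℝ≥0) * η) - f ((k : ℝ≥0) * η))) (ψ := fun x => A * x)
      (by fun_prop) (by fun_prop)).symm
  unfold pathFunctional
  rw [h1.charFun_map_fun_add_eq_mul (by fun_prop) (by fun_prop), Pi.mul_apply,
    HasLaw.charFun_map_const_mul hUl]
  have h2 : iIndepFun (fun k ω => c k * (B (((k + 1 : ℕ) : ℝ≥0) * η) ω - B ((k : ℝ≥0) * η) ω)) P := by
    have hm : Monotone fun k : ℕ => (k : ℝ≥0) * η := fun i j hij => by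
      dsimp only; gcongr
    exact (hB.hasIndepIncrements.nat hm).comp (fun k x => c k * x) (fun k => by fun_prop)
  rw [iIndepFun.charFun_map_fun_finsetSum_eq_prod (s := Finset.range K) (fun k _ => by fun_prop)
    (h2.restrict _), Finset.prod_apply]
  have h3 : ∀ k ∈ Finset.range K, charFun (P.map fun ω =>
      c k * (B (((k + 1 : ℕ) : ℝ≥0) * η) ω - B ((k : ℝ≥0) * η) ω)) 1
      = Complex.exp (-((c k ^ 2 * η : ℝ) : ℂ) / 2) := fun k _ => by
    have h := hB.hasLaw_sub (((k + 1 : ℕ) : ℝ≥0) * η) ((k : ℝ≥0) * η)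
    have e : nndist (((k + 1 : ℕ) : ℝ≥0) * η).1 ((k : ℝ≥0) * η).1 = η := by
      rw [NNReal.val_eq_coe, NNReal.val_eq_coe, ← NNReal.coe_inj, coe_nndist, Real.dist_eq]
      push_cast
      rw [show ((k:ℝ) + 1) * η - k * η = η by ring, abs_of_nonneg (NNReal.coe_nonneg η)]
    have h' : HasLaw (fun ω => B (((k + 1 : ℕ) : ℝ≥0) * η) ω - B ((k : ℝ≥0) * η) ω)
        (gaussianReal 0 η) P := by
      rw [e] at h; exact h
    exact HasLaw.charFun_map_const_mul h' (c k)
  rw [Finset.prod_congr rfl h3, ← Complex.exp_sum, ← Complex.exp_add]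
  congr 1
  push_cast
  rw [Finset.mul_sum, ← Finset.sum_div, Finset.sum_neg_distrib, ← add_div, neg_add]
  congr 3
  exact Finset.sum_congr rfl fun k _ => mul_comm _ _

theorem integral_exp_sum_pathFunctional {Ω : Type*} [MeasurableSpace Ω] {P : Measure Ω}
    [IsProbabilityMeasure P] {B : ℕ → ℝ≥0 → Ω → ℝ} {U : ℕ → Ω → ℝ} {v : ℕ → ℝ≥0}
    (hBm : ∀ l t, Measurable (B l t)) (hU : ∀ l, Measurable (U l))
    (hB : ∀ l, IsPreBrownianReal (B l) P) (hUl : ∀ l, HasLaw (U l) (gaussianReal 0 (v l)) P)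
    (hmodes : iIndepFun (fun l ω => ((fun t => B l t ω : ℝ≥0 → ℝ), U l ω)) P)
    (hind : ∀ l, IndepFun (fun ω => (fun t => B l t ω : ℝ≥0 → ℝ)) (U l) P)
    (A : ℕ → ℝ) (c : ℕ → ℕ → ℝ) (K : ℕ) (η : ℝ≥0) (n : ℕ) :
    ∫ ω, Complex.exp (((∑ l ∈ Finset.range n,
        pathFunctional (A l) (c l) K η (fun t => B l t ω, U l ω) : ℝ) : ℂ) * Complex.I) ∂P
      = Complex.exp (-((∑ l ∈ Finset.range n,
        (A l ^ 2 * v l + η * ∑ k ∈ Finset.range K, c l k ^ 2) : ℝ) : ℂ) / 2) := by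
  have hm : ∀ l, Measurable fun ω => pathFunctional (A l) (c l) K η (fun t => B l t ω, U l ω) :=
    fun l => (measurable_pathFunctional _ _ _ _).comp
      ((measurable_pi_iff.2 fun t => hBm l t).prodMk (hU l))
  have h2 : iIndepFun (fun l ω => pathFunctional (A l) (c l) K η (fun t => B l t ω, U l ω)) P :=
    hmodes.comp (fun l x => pathFunctional (A l) (c l) K η x)
      (fun l => measurable_pathFunctional _ _ _ _)
  rw [← charFun_map_one (Finset.measurable_fun_sum _ fun l _ => hm l).aemeasurable, iIndepFun.charFun_map_fun_finsetSum_eq_prod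
    (s := Finset.range n) (fun k _ => (hm k).aemeasurable) (h2.restrict _), Finset.prod_apply,
    Finset.prod_congr rfl fun l _ => charFun_map_pathFunctional (hBm l) (hU l) (hB l) (hUl l)
      (hind l) (A l) (c l) K η, ← Complex.exp_sum]
  congr 1
  push_cast
  rw [← Finset.sum_div, Finset.sum_neg_distrib]

/-- Weight of the increment over the `k`-th cell in the discretised mild solution, summed against
the weights `a` over the times `τ p * Δ`. -/
noncomputable def mildWeight {ι : Type*} [Fintype ι] (c σ Δ : ℝ) (a : ι → ℝ) (τ : ι → ℕ) (m k : ℕ) : ℝ :=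
  ∑ p, a p * if k < τ p * (m + 1) then σ * Real.exp (-c * (τ p * Δ - k * (Δ / (m + 1)))) else 0

theorem sum_range_ite_lt (f : ℕ → ℝ) {n K : ℕ} (h : n ≤ K) :
    ∑ k ∈ Finset.range K, (if k < n then f k else 0) = ∑ k ∈ Finset.range n, f k := by
  rw [← Finset.sum_filter]
  congr 1
  ext k
  simp only [Finset.mem_filter, Finset.mem_range]
  omega

theorem pathFunctional_mildWeight {ι : Type*} [Fintype ι] (c σ : ℝ) (Δ : ℝ≥0) (a : ι → ℝ)
    {τ : ι → ℕ} {L : ℕ} (hτ : ∀ p, τ p ≤ L) (m : ℕ) (f : ℝ≥0 → ℝ) (x : ℝ) :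
    pathFunctional (∑ p, a p * Real.exp (-c * (τ p * Δ))) (mildWeight c σ Δ a τ m) (L * (m + 1))
        (Δ / (m + 1)) (f, x)
      = ∑ p, a p * (Real.exp (-c * (τ p * Δ)) * x + ∑ k ∈ Finset.range (τ p * (m + 1)),
        σ * Real.exp (-c * (τ p * Δ - k * (Δ / (m + 1))))
          * (f (Real.toNNReal ((k + 1) * (Δ / (m + 1)))) - f (Real.toNNReal (k * (Δ / (m + 1)))))) := by
  have e1 : ∀ k : ℕ, Real.toNNReal (k * ((Δ : ℝ) / (m + 1))) = (k : ℝ≥0) * (Δ / (m + 1)) := fun k => by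
    rw [← Real.toNNReal_coe (r := (k : ℝ≥0) * (Δ / (m + 1)))]; push_cast; rfl
  have e2 : ∀ k : ℕ, Real.toNNReal ((k + 1) * ((Δ : ℝ) / (m + 1)))
      = ((k + 1 : ℕ) : ℝ≥0) * (Δ / (m + 1)) := fun k => by
    rw [← e1]; push_cast; rfl
  simp only [e1, e2]
  unfold pathFunctional mildWeight
  simp only [mul_add (a _), Finset.sum_add_distrib, Finset.sum_mul]
  congr 1
  · exact Finset.sum_congr rfl fun p _ => by ring
  rw [Finset.sum_comm]
  refine Finset.sum_congr rfl fun p _ => ?_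
  rw [Finset.mul_sum, ← sum_range_ite_lt _ (Nat.mul_le_mul_right (m + 1) (hτ p))]
  refine Finset.sum_congr rfl fun k _ => ?_
  split_ifs <;> ring

/-- Two times share the cells before the smaller one. The resulting integral and the variance of the
initial value combine to the stationary covariance, as p + q - 2 min(p, q) = |p - q|. -/
theorem tendsto_variance_mildWeight {ι : Type*} [Fintype ι] {c σ Δ : ℝ} (hc : 0 < c) (hΔ : 0 < Δ)
    (a : ι → ℝ) {τ : ι → ℕ} {L : ℕ} (hτ : ∀ p, τ p ≤ L) :
    Tendsto (fun m : ℕ => (∑ p, a p * Real.exp (-c * (τ p * Δ))) ^ 2 * (σ ^ 2 / (2 * c))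
        + Δ / (m + 1) * ∑ k ∈ Finset.range (L * (m + 1)), mildWeight c σ Δ a τ m k ^ 2) atTop
      (𝓝 (∑ p, ∑ q, a p * a q * (σ ^ 2 / (2 * c) * Real.exp (-c * (|(τ p : ℝ) - τ q| * Δ))))) := by
  have e1 : ∀ m : ℕ, Δ / (m + 1) * ∑ k ∈ Finset.range (L * (m + 1)), mildWeight c σ Δ a τ m k ^ 2
      = ∑ p, ∑ q, a p * a q * (σ ^ 2 * Real.exp (-c * ((τ p + τ q) * Δ)))
        * (Δ / (m + 1) * ∑ k ∈ Finset.range (min (τ p) (τ q) * (m + 1)),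
          Real.exp (2 * c * (k * (Δ / (m + 1))))) := fun m => by
    have : ∀ k, mildWeight c σ Δ a τ m k ^ 2 = ∑ p, ∑ q, a p * a q
        * (σ ^ 2 * Real.exp (-c * ((τ p + τ q) * Δ)))
        * (if k < min (τ p) (τ q) * (m + 1) then Real.exp (2 * c * (k * (Δ / (m + 1)))) else 0) :=
      fun k => by
        unfold mildWeight
        rw [sq, Finset.sum_mul_sum]
        refine Finset.sum_congr rfl fun p _ => Finset.sum_congr rfl fun q _ => ?_
        rw [min_mul_of_nonneg _ _ (Nat.zero_le _)]
        by_cases h1 : k < τ p * (m + 1) <;> by_cases h2 : k < τ q * (m + 1)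
        · rw [if_pos h1, if_pos h2, if_pos (lt_min h1 h2)]
          have : Real.exp (-c * (τ p * Δ - k * (Δ / (m + 1))))
              * Real.exp (-c * (τ q * Δ - k * (Δ / (m + 1))))
              = Real.exp (-c * ((τ p + τ q) * Δ)) * Real.exp (2 * c * (k * (Δ / (m + 1)))) := by
            rw [← Real.exp_add, ← Real.exp_add]; congr 1; ring
          linear_combination a p * a q * σ ^ 2 * this
        all_goals
          simp only [lt_min_iff, h1, h2, and_true, and_false, if_true, if_false]; ring
    simp_rw [this]
    rw [Finset.sum_comm, Finset.mul_sum]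
    refine Finset.sum_congr rfl fun p _ => ?_
    rw [Finset.sum_comm, Finset.mul_sum]
    refine Finset.sum_congr rfl fun q _ => ?_
    rw [← Finset.mul_sum, sum_range_ite_lt _ (Nat.mul_le_mul_right (m + 1)
      ((min_le_left _ _).trans (hτ p)))]
    ring
  have e2 : (∑ p, a p * Real.exp (-c * (τ p * Δ))) ^ 2 * (σ ^ 2 / (2 * c))
      = ∑ p, ∑ q, a p * a q * (Real.exp (-c * ((τ p + τ q) * Δ)) * (σ ^ 2 / (2 * c))) := by
    rw [sq, Finset.sum_mul_sum, Finset.sum_mul]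
    refine Finset.sum_congr rfl fun p _ => ?_
    rw [Finset.sum_mul]
    refine Finset.sum_congr rfl fun q _ => ?_
    rw [show -c * ((τ p + τ q) * Δ) = -c * (τ p * Δ) + -c * (τ q * Δ) by ring, Real.exp_add]
    ring
  simp_rw [e1, e2, ← Finset.sum_add_distrib]
  refine tendsto_finsetSum _ fun p _ => tendsto_finsetSum _ fun q _ => ?_
  have h := ((tendsto_riemann_exp (c := 2 * c) (by positivity) hΔ (min (τ p) (τ q))).const_mul
    (a p * a q * (σ ^ 2 * Real.exp (-c * ((τ p + τ q) * Δ))))).const_add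
    (a p * a q * (Real.exp (-c * ((τ p + τ q) * Δ)) * (σ ^ 2 / (2 * c))))
  have e3 : a p * a q * (σ ^ 2 / (2 * c) * Real.exp (-c * (|(τ p : ℝ) - τ q| * Δ)))
      = a p * a q * (Real.exp (-c * ((τ p + τ q) * Δ)) * (σ ^ 2 / (2 * c)))
        + a p * a q * (σ ^ 2 * Real.exp (-c * ((τ p + τ q) * Δ)))
          * ((Real.exp (2 * c * ((min (τ p) (τ q) : ℕ) * Δ)) - 1) / (2 * c)) := by
    have : Real.exp (-c * (|(τ p : ℝ) - τ q| * Δ))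
        = Real.exp (-c * ((τ p + τ q) * Δ)) * Real.exp (2 * c * ((min (τ p) (τ q) : ℕ) * Δ)) := by
      rw [← Real.exp_add]; congr 1
      push_cast
      rcases le_total (τ p : ℝ) (τ q) with h | h
      · rw [min_eq_left h, abs_of_nonpos (by linarith)]; ring
      · rw [min_eq_right h, abs_of_nonneg (by linarith)]; ring
    rw [this]; ring
  rw [e3]
  exact h

theorem ae_tendsto_pathFunctional_mildWeight {Ω : Type*} [MeasurableSpace Ω] {μ : Measure Ω}
    {c σ : ℝ} {Δ : ℝ≥0} (hc : 0 < c) {B U : ℝ≥0 → Ω → ℝ}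
    (hcont : ∀ᵐ ω ∂μ, Continuous fun t => U t ω)
    (hou : ∀ᵐ ω ∂μ, ∀ t : ℝ≥0, U t ω
      = U 0 ω - c * (∫ s in (0 : ℝ)..(t : ℝ), U (Real.toNNReal s) ω) + σ * B t ω)
    {ι : Type*} [Fintype ι] (a : ι → ℝ) {τ : ι → ℕ} {L : ℕ} (hτ : ∀ p, τ p ≤ L) :
    ∀ᵐ ω ∂μ, Tendsto (fun m : ℕ => pathFunctional (∑ p, a p * Real.exp (-c * (τ p * Δ)))
        (mildWeight c σ Δ a τ m) (L * (m + 1)) (Δ / (m + 1)) (fun t => B t ω, U 0 ω)) atTop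
      (𝓝 (∑ p, a p * U (τ p * Δ) ω)) := by
  filter_upwards [hcont, hou] with ω h1 h2
  simp_rw [pathFunctional_mildWeight c σ Δ a hτ]
  refine tendsto_finsetSum _ fun p _ => Tendsto.const_mul (a p) ?_
  have h := tendsto_ornsteinUhlenbeck_riemann (c := c) (σ := σ) (Δ := Δ)
    (V := fun s => U (Real.toNNReal s) ω) (B := fun s => B (Real.toNNReal s) ω) hc Δ.2
    (h1.comp continuous_real_toNNReal) (fun t ht => by
      have := h2 (Real.toNNReal t)
      rw [Real.coe_toNNReal t ht] at this
      simpa using this) (τ p)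
  have e : Real.toNNReal ((τ p : ℝ) * Δ) = τ p * Δ := by
    rw [← Real.toNNReal_coe (r := (τ p : ℝ≥0) * Δ)]; push_cast; rfl
  simp only [e, Real.toNNReal_zero] at h
  exact h

/-- Finite linear combinations of the modes at grid times are centred Gaussian. -/
theorem integral_exp_sum_modes {Ω : Type*} [MeasurableSpace Ω] {μ : Measure Ω}
    [IsProbabilityMeasure μ] {σ ϑ₂ ϑ₁ ϑ₀ : ℝ} {β u : ℕ → ℝ≥0 → Ω → ℝ} {X : ℝ≥0 → ℝ → Ω → ℝ}
    (hX : IsStationarySPDESolution σ ϑ₂ ϑ₁ ϑ₀ β u X μ)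
    (hpos : ∀ l : ℕ, 0 < spdeEigenvalue ϑ₂ ϑ₁ ϑ₀ (l + 1)) {Δ : ℝ≥0} (hΔ : 0 < Δ)
    {ι : Type*} [Fintype ι] (a : ℕ → ι → ℝ) {τ : ι → ℕ} {L : ℕ} (hτ : ∀ p, τ p ≤ L) (n : ℕ) :
    ∫ ω, Complex.exp (((∑ l ∈ Finset.range n, ∑ p, a l p * u l (τ p * Δ) ω : ℝ) : ℂ)
        * Complex.I) ∂μ
      = Complex.exp (-((∑ l ∈ Finset.range n, ∑ p, ∑ q, a l p * a l q
        * (σ ^ 2 / (2 * spdeEigenvalue ϑ₂ ϑ₁ ϑ₀ (l + 1)) * Real.exp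
          (-spdeEigenvalue ϑ₂ ϑ₁ ϑ₀ (l + 1) * (|(τ p : ℝ) - τ q| * Δ))) : ℝ) : ℂ) / 2) := by
  set c : ℕ → ℝ := fun l => spdeEigenvalue ϑ₂ ϑ₁ ϑ₀ (l + 1) with hc
  set Z : ℕ → ℕ → Ω → ℝ := fun m l ω => pathFunctional (∑ p, a l p * Real.exp (-c l * (τ p * Δ)))
        (mildWeight (c l) σ Δ (a l) τ m) (L * (m + 1)) (Δ / (m + 1)) (fun t => β l t ω, u l 0 ω)
  have hZm : ∀ m l, Measurable (Z m l) := fun m l => (measurable_pathFunctional _ _ _ _).comp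
      ((measurable_pi_iff.2 fun t => hX.measurable_noise l t).prodMk (hX.measurable_mode l 0))
  have hZ : ∀ l, ∀ᵐ ω ∂μ, Tendsto (fun m => Z m l ω) atTop (𝓝 (∑ p, a l p * u l (τ p * Δ) ω)) :=
    fun l => ae_tendsto_pathFunctional_mildWeight (hpos l) (hX.continuous_mode l)
      (hX.ornstein_uhlenbeck l) (a l) hτ
  have hint := fun m : ℕ => integral_exp_sum_pathFunctional hX.measurable_noise
    (fun l => hX.measurable_mode l 0) (fun l => (hX.isBrownian l).toIsPreBrownianReal) hX.initial_law
    hX.indep_modes hX.indep_initial (fun l => ∑ p, a l p * Real.exp (-c l * (τ p * Δ)))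
    (fun l => mildWeight (c l) σ Δ (a l) τ m) (L * (m + 1)) (Δ / (m + 1)) n
  have h1 : Tendsto (fun m => ∫ ω, Complex.exp (((∑ l ∈ Finset.range n, Z m l ω : ℝ) : ℂ)
      * Complex.I) ∂μ) atTop (𝓝 (∫ ω, Complex.exp (((∑ l ∈ Finset.range n,
        ∑ p, a l p * u l (τ p * Δ) ω : ℝ) : ℂ) * Complex.I) ∂μ)) := by
    refine tendsto_integral_of_dominated_convergence (fun _ => 1) (fun m => ?_)
      (integrable_const _) (fun m => ?_) ?_
    · have := Finset.measurable_fun_sum (Finset.range n) fun l _ => hZm m l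
      exact Measurable.aestronglyMeasurable (by fun_prop)
    · exact Eventually.of_forall fun ω => (Complex.norm_exp_ofReal_mul_I _).le
    · filter_upwards [ae_all_iff.2 hZ] with ω hω
      have h := tendsto_finsetSum (Finset.range n) fun l _ => hω l
      exact (Complex.continuous_exp.comp
        (Complex.continuous_ofReal.mul continuous_const)).continuousAt.tendsto.comp h
  -- The same sequence is evaluated through its explicit Gaussian value, whose variance converges.
  refine tendsto_nhds_unique h1 ?_
  simp only [Z, hint]
  have h2 : Tendsto (fun m : ℕ => ∑ l ∈ Finset.range n,
      ((∑ p, a l p * Real.exp (-c l * (τ p * Δ))) ^ 2 * (σ ^ 2 / (2 * c l))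
        + (Δ : ℝ) / (m + 1) * ∑ k ∈ Finset.range (L * (m + 1)),
          mildWeight (c l) σ Δ (a l) τ m k ^ 2)) atTop _ :=
    tendsto_finsetSum (Finset.range n) fun l _ =>
      tendsto_variance_mildWeight (hpos l) (NNReal.coe_pos.2 hΔ) (a l) hτ
  have h3 : Continuous fun x : ℝ => Complex.exp (-(x : ℂ) / 2) := by fun_prop
  refine (h3.continuousAt.tendsto.comp h2).congr fun m => ?_
  simp only [Function.comp]
  congr 4
  refine Finset.sum_congr rfl fun l _ => ?_
  rw [Real.coe_toNNReal _ (by have := hpos l; positivity)]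
  push_cast
  rfl

/-! ### Gaussian law of the weighted increments -/

theorem exists_common_seq_tendsto_ae {Ω J : Type*} [MeasurableSpace Ω] {μ : Measure Ω}
    {f : J → ℕ → Ω → ℝ} {g : J → Ω → ℝ} (s : Finset J)
    (h : ∀ j ∈ s, TendstoInMeasure μ (f j) atTop (g j)) :
    ∃ ns : ℕ → ℕ, StrictMono ns ∧
      ∀ j ∈ s, ∀ᵐ ω ∂μ, Tendsto (fun n => f j (ns n) ω) atTop (𝓝 (g j ω)) := by
  classical
  induction s using Finset.induction_on with
  | empty => exact ⟨id, strictMono_id, by simp⟩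
  | insert j s hj ih =>
    obtain ⟨ns, hns, H⟩ := ih fun i hi => h i (Finset.mem_insert_of_mem hi)
    obtain ⟨ms, hms, H'⟩ := ((h j (Finset.mem_insert_self j s)).comp
      hns.tendsto_atTop).exists_seq_tendsto_ae
    refine ⟨ns ∘ ms, hns.comp hms, fun i hi => ?_⟩
    rcases Finset.mem_insert.1 hi with rfl | hi
    · exact H'
    · filter_upwards [H i hi] with ω hω
      exact hω.comp hms.tendsto_atTop

/-- Times σ²/2, this is the covariance of two time increments of one stationary mode, which links
`timeDiff` to the process. -/
theorem timeDiff_exp_natAbs {c Δ : ℝ} (hc : c ≠ 0) (i j : ℕ) :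
    timeDiff (fun s => Real.exp (-c * s)) Δ ((i : ℤ) - j).natAbs
      = (2 * Real.exp (-c * (|(i : ℝ) - j| * Δ)) - Real.exp (-c * (|(i : ℝ) + 1 - j| * Δ))
        - Real.exp (-c * (|(i : ℝ) - (j + 1)| * Δ))) / c := by
  rw [timeDiff_exp hc]
  have hn : ((((i : ℤ) - j).natAbs : ℕ) : ℝ) = |(i : ℝ) - j| := by
    rw [Nat.cast_natAbs]; push_cast; rfl
  rw [hn]
  rcases le_or_gt (i : ℝ) j with h | h
  · rw [abs_of_nonpos (sub_nonpos.2 h), abs_of_nonpos (by linarith : (i : ℝ) - (j + 1) ≤ 0),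
      show -((i : ℝ) - j) - 1 = -((i : ℝ) + 1 - j) by ring, abs_neg,
      show -((i : ℝ) - j) + 1 = -((i : ℝ) - (j + 1)) by ring]
    ring
  · have h' : (j : ℝ) + 1 ≤ i := by exact_mod_cast h
    rw [abs_of_pos (sub_pos.2 h), abs_of_nonneg (by linarith : 0 ≤ (i : ℝ) + 1 - j),
      show (i : ℝ) - j - 1 = (i : ℝ) - (j + 1) by ring]
    rw [show (i : ℝ) - j + 1 = (i : ℝ) + 1 - j by ring]

/-- Increment of the weighted eigenfunction with number `l + 1`. -/
noncomputable def eigenIncrement (κ b : ℝ) (M l k : ℕ) : ℝ :=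
  √2 * (Real.exp (-(κ * spaceStep b M / 4))
      * Real.sin (Real.pi * (l + 1) * (spacePoint b M k + spaceStep b M))
    - (Real.exp (-(κ * spaceStep b M / 4)))⁻¹ * Real.sin (Real.pi * (l + 1) * spacePoint b M k))

theorem spacePoint_succ (b : ℝ) (M k : ℕ) :
    spacePoint b M (k + 1) = spacePoint b M k + spaceStep b M := by
  unfold spacePoint; push_cast; ring

theorem spaceStep_pos {b : ℝ} (hb' : b < 1 / 2) {M : ℕ} (hM : 0 < M) : 0 < spaceStep b M := by
  have : (0:ℝ) < M := by exact_mod_cast hM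
  exact div_pos (by linarith) this

theorem le_spacePoint {b : ℝ} (hb' : b < 1 / 2) {M : ℕ} (hM : 0 < M) (k : ℕ) :
    b ≤ spacePoint b M k :=
  le_add_of_nonneg_right (mul_nonneg k.cast_nonneg (spaceStep_pos hb' hM).le)

theorem spacePoint_le {b : ℝ} (hb' : b < 1 / 2) {M k : ℕ} (hM : 0 < M) (hk : k ≤ M) :
    spacePoint b M k ≤ 1 - b := by
  have h0 : (0:ℝ) < M := by exact_mod_cast hM
  have h1 : (k:ℝ) * spaceStep b M ≤ M * spaceStep b M :=
    mul_le_mul_of_nonneg_right (by exact_mod_cast hk) (spaceStep_pos hb' hM).le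
  have h2 : (M:ℝ) * spaceStep b M = 1 - 2 * b := mul_div_cancel₀ _ h0.ne'
  unfold spacePoint
  linarith

/-- The weight, centred at the midpoint of the cell, removes the position from the factors
exp(-κy/2) and leaves exp(∓κδ/4) at the two ends. -/
theorem eigenIncrement_eq (ϑ₂ ϑ₁ b : ℝ) (M l k : ℕ) :
    Real.exp (spdeKappa ϑ₂ ϑ₁ / 4 * (spacePoint b M k + spacePoint b M (k + 1)))
      * (spdeEigenfunction ϑ₂ ϑ₁ (l + 1) (spacePoint b M (k + 1))
        - spdeEigenfunction ϑ₂ ϑ₁ (l + 1) (spacePoint b M k))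
      = eigenIncrement (spdeKappa ϑ₂ ϑ₁) b M l k := by
  rw [spacePoint_succ]
  unfold spdeEigenfunction eigenIncrement
  generalize spacePoint b M k = y
  generalize spaceStep b M = δ
  generalize spdeKappa ϑ₂ ϑ₁ = κ
  rw [← Real.exp_neg]
  have h1 : Real.exp (-(κ * δ / 4))
      = Real.exp (κ / 4 * (y + (y + δ))) * Real.exp (-(κ * (y + δ)) / 2) := by
    rw [← Real.exp_add]; congr 1; ring
  have h2 : Real.exp (- -(κ * δ / 4)) = Real.exp (κ / 4 * (y + (y + δ))) * Real.exp (-(κ * y) / 2) := by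
    rw [← Real.exp_add]; congr 1; ring
  rw [h1, h2]
  push_cast
  ring

/-- The weighted double increments `exp (κ (y_k + y_{k+1}) / 4) D_{ik}`. -/
noncomputable def weightedIncrement {Ω : Type*} (X : ℝ≥0 → ℝ → Ω → ℝ) (κ b : ℝ) (T : ℝ≥0) (M N : ℕ)
    (ω : Ω) (p : Fin N × Fin M) : ℝ :=
  Real.exp (κ / 4 * (spacePoint b M p.2 + spacePoint b M (p.2 + 1)))
    * doubleIncrement X b T M N p.1 p.2 ω

/-- Partial sums of the spectral representation. -/
noncomputable def spectralSum {Ω : Type*} (ϑ₂ ϑ₁ : ℝ) (u : ℕ → ℝ≥0 → Ω → ℝ) (n : ℕ) (t : ℝ≥0) (x : ℝ)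
    (ω : Ω) : ℝ :=
  ∑ l ∈ Finset.range n, u l t ω * spdeEigenfunction ϑ₂ ϑ₁ (l + 1) x

theorem weightedIncrement_spectralSum {Ω : Type*} (ϑ₂ ϑ₁ b : ℝ) (u : ℕ → ℝ≥0 → Ω → ℝ) (n : ℕ)
    (T : ℝ≥0) (M N : ℕ) (ω : Ω) (p : Fin N × Fin M) :
    weightedIncrement (spectralSum ϑ₂ ϑ₁ u n) (spdeKappa ϑ₂ ϑ₁) b T M N ω p
      = ∑ l ∈ Finset.range n, eigenIncrement (spdeKappa ϑ₂ ϑ₁) b M l p.2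
        * (u l (timePoint T N (p.1 + 1)) ω - u l (timePoint T N p.1) ω) := by
  unfold weightedIncrement doubleIncrement spectralSum
  rw [← Finset.sum_sub_distrib, ← Finset.sum_sub_distrib, ← Finset.sum_add_distrib, Finset.mul_sum]
  refine Finset.sum_congr rfl fun l _ => ?_
  rw [← eigenIncrement_eq]
  ring

theorem sum_prod_bool_quadForm {J : Type*} [Fintype J] (f : J → ℝ) (g : J → J → Bool → Bool → ℝ) :
    ∑ p : J × Bool, ∑ q : J × Bool, (bif p.2 then f p.1 else -f p.1) * (bif q.2 then f q.1 else -f q.1)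
        * g p.1 q.1 p.2 q.2
      = ∑ p, ∑ q, f p * f q * (g p q true true - g p q true false - g p q false true
        + g p q false false) := by
  simp only [Fintype.sum_prod_type, Fintype.sum_bool, cond_true, cond_false]
  refine Finset.sum_congr rfl fun p _ => ?_
  rw [← Finset.sum_add_distrib]
  exact Finset.sum_congr rfl fun q _ => by ring

theorem aemeasurable_weightedIncrement {Ω : Type*} [MeasurableSpace Ω] {μ : Measure Ω}
    {σ ϑ₂ ϑ₁ ϑ₀ b : ℝ} {β u : ℕ → ℝ≥0 → Ω → ℝ} {X : ℝ≥0 → ℝ → Ω → ℝ}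
    (hX : IsStationarySPDESolution σ ϑ₂ ϑ₁ ϑ₀ β u X μ) (hb : 0 < b) (hb' : b < 1 / 2) (κ : ℝ)
    (T : ℝ≥0) (M N : ℕ) :
    AEMeasurable (weightedIncrement X κ b T M N) μ := by
  refine aemeasurable_pi_iff.2 fun p => ?_
  have hM : 0 < M := p.2.pos
  have h : ∀ t k, k ≤ M → AEMeasurable (X t (spacePoint b M k)) μ := fun t k hk =>
    (hX.series t _ ⟨hb.le.trans (le_spacePoint hb' hM k),
      (spacePoint_le hb' hM hk).trans (by linarith)⟩).aemeasurable fun n =>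
      (Finset.measurable_fun_sum _ fun l _ => (hX.measurable_mode l t).mul_const _).aemeasurable
  unfold weightedIncrement doubleIncrement
  exact ((((h _ _ p.2.2).sub (h _ _ p.2.2.le)).sub (h _ _ p.2.2)).add (h _ _ p.2.2.le)).const_mul _

/-- Finitely many grid values are involved, so one subsequence of the spectral sums converges almost
surely at all of them, and dominated convergence passes the Gaussian characteristic functions to the
limit. -/
theorem integral_exp_sum_weightedIncrement {Ω : Type*} [MeasurableSpace Ω] {μ : Measure Ω}
    [IsProbabilityMeasure μ] {σ ϑ₂ ϑ₁ ϑ₀ b : ℝ} {β u : ℕ → ℝ≥0 → Ω → ℝ} {X : ℝ≥0 → ℝ → Ω → ℝ}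
    (hX : IsStationarySPDESolution σ ϑ₂ ϑ₁ ϑ₀ β u X μ)
    (hpos : ∀ l : ℕ, 0 < spdeEigenvalue ϑ₂ ϑ₁ ϑ₀ (l + 1)) (hb : 0 < b) (hb' : b < 1 / 2)
    {T : ℝ≥0} {M N : ℕ} (hΔ : 0 < timeStep T N) (S : Fin N × Fin M → Fin N × Fin M → ℝ)
    (hS : ∀ p q, HasSum (fun l => σ ^ 2 / 2 * (timeDiff
        (fun s => Real.exp (-spdeEigenvalue ϑ₂ ϑ₁ ϑ₀ (l + 1) * s)) (timeStep T N) (gridSub p q).1.natAbs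
      * (eigenIncrement (spdeKappa ϑ₂ ϑ₁) b M l p.2 * eigenIncrement (spdeKappa ϑ₂ ϑ₁) b M l q.2)))
      (S p q)) (w : Fin N × Fin M → ℝ) :
    ∫ ω, Complex.exp (((∑ p, w p * weightedIncrement X (spdeKappa ϑ₂ ϑ₁) b T M N ω p : ℝ) : ℂ)
        * Complex.I) ∂μ
      = Complex.exp (-((∑ p, ∑ q, w p * w q * S p q : ℝ) : ℂ) / 2) := by
  set κ := spdeKappa ϑ₂ ϑ₁
  set Δ := timeStep T N
  obtain ⟨ns, hns, hae⟩ := exists_common_seq_tendsto_ae (μ := μ)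
    (f := fun (z : ℕ × ℕ) n => spectralSum ϑ₂ ϑ₁ u n (timePoint T N z.1) (spacePoint b M z.2))
    (g := fun z => X (timePoint T N z.1) (spacePoint b M z.2))
    -- The filter empties the set when M = 0, where the bounds on the grid points are not available
    -- and no index p exists.
    (Finset.range (N + 1) ×ˢ ((Finset.range (M + 1)).filter fun _ => 0 < M)) (fun z hz => by
      simp only [Finset.mem_product, Finset.mem_filter, Finset.mem_range] at hz
      exact hX.series _ _ ⟨hb.le.trans (le_spacePoint hb' hz.2.2 _),
        (spacePoint_le hb' hz.2.2 (by omega)).trans (by linarith)⟩)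
  have hae' : ∀ᵐ ω ∂μ, ∀ p, Tendsto (fun n => weightedIncrement (spectralSum ϑ₂ ϑ₁ u (ns n)) κ b T M N ω p)
      atTop (𝓝 (weightedIncrement X κ b T M N ω p)) := by
    refine ae_all_iff.2 fun p => ?_
    have hM : 0 < M := p.2.pos
    have h : ∀ i k, i ≤ N → k ≤ M → _ := fun i k hi hk => hae (i, k) (by
      simp only [Finset.mem_product, Finset.mem_filter, Finset.mem_range]; omega)
    filter_upwards [h (p.1 + 1) (p.2 + 1) p.1.2 p.2.2, h (p.1 + 1) p.2 p.1.2 p.2.2.le,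
      h p.1 (p.2 + 1) p.1.2.le p.2.2, h p.1 p.2 p.1.2.le p.2.2.le] with ω h1 h2 h3 h4
    exact (((h1.sub h2).sub h3).add h4).const_mul _
  have hlim : Tendsto (fun n => ∫ ω, Complex.exp (((∑ p, w p
      * weightedIncrement (spectralSum ϑ₂ ϑ₁ u (ns n)) κ b T M N ω p : ℝ) : ℂ) * Complex.I) ∂μ) atTop
      (𝓝 (∫ ω, Complex.exp (((∑ p, w p * weightedIncrement X κ b T M N ω p : ℝ) : ℂ)
        * Complex.I) ∂μ)) := by
    refine tendsto_integral_of_dominated_convergence (fun _ => 1) (fun n => ?_)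
      (integrable_const _) (fun n => ?_) ?_
    · have hm := fun l t => hX.measurable_mode l t
      simp only [κ, weightedIncrement_spectralSum]
      exact Measurable.aestronglyMeasurable (by fun_prop)
    · exact Eventually.of_forall fun ω => (Complex.norm_exp_ofReal_mul_I _).le
    · filter_upwards [hae'] with ω hω
      have h : Tendsto (fun n => ∑ p, w p
          * weightedIncrement (spectralSum ϑ₂ ϑ₁ u (ns n)) κ b T M N ω p) atTop
          (𝓝 (∑ p, w p * weightedIncrement X κ b T M N ω p)) :=
        tendsto_finsetSum _ fun p _ => (hω p).const_mul (w p)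
      exact (Complex.continuous_exp.comp
        (Complex.continuous_ofReal.mul continuous_const)).continuousAt.tendsto.comp h
  refine tendsto_nhds_unique hlim ?_
  have hval : ∀ n, ∫ ω, Complex.exp (((∑ p, w p
      * weightedIncrement (spectralSum ϑ₂ ϑ₁ u n) κ b T M N ω p : ℝ) : ℂ) * Complex.I) ∂μ
      = Complex.exp (-((∑ l ∈ Finset.range n, ∑ p, ∑ q, w p * w q * (σ ^ 2 / 2 * (timeDiff
        (fun s => Real.exp (-spdeEigenvalue ϑ₂ ϑ₁ ϑ₀ (l + 1) * s)) Δ (gridSub p q).1.natAbs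
      * (eigenIncrement κ b M l p.2 * eigenIncrement κ b M l q.2))) : ℝ) : ℂ) / 2) := fun n => by
    -- The Boolean marks the end point of a time increment: true for the later time with sign +,
    -- false for the earlier with sign -.
    have h := integral_exp_sum_modes hX hpos hΔ (ι := (Fin N × Fin M) × Bool)
      (fun l z => bif z.2 then w z.1 * eigenIncrement κ b M l z.1.2
        else -(w z.1 * eigenIncrement κ b M l z.1.2))
      (τ := fun z => bif z.2 then z.1.1 + 1 else z.1.1) (L := N)
      (by rintro ⟨p, _ | _⟩ <;> have := p.1.2 <;> simp) n
    have e1 : ∀ ω, ∑ p, w p * weightedIncrement (spectralSum ϑ₂ ϑ₁ u n) κ b T M N ω p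
        = ∑ l ∈ Finset.range n, ∑ z : (Fin N × Fin M) × Bool,
          (bif z.2 then w z.1 * eigenIncrement κ b M l z.1.2
            else -(w z.1 * eigenIncrement κ b M l z.1.2))
          * u l (((bif z.2 then z.1.1 + 1 else z.1.1 : ℕ) : ℝ≥0) * Δ) ω := fun ω => by
      simp only [κ, weightedIncrement_spectralSum, Finset.mul_sum]
      rw [Finset.sum_comm]
      refine Finset.sum_congr rfl fun l _ => ?_
      refine Eq.trans ?_ (Fintype.sum_prod_type _).symm
      simp only [Fintype.sum_bool, cond_true, cond_false]
      refine Finset.sum_congr rfl fun p _ => ?_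
      simp only [timePoint, Δ]
      ring
    simp_rw [e1, h]
    congr 4
    refine Finset.sum_congr rfl fun l _ => ?_
    rw [sum_prod_bool_quadForm (fun p => w p * eigenIncrement κ b M l p.2) (fun p q s s' =>
      σ ^ 2 / (2 * spdeEigenvalue ϑ₂ ϑ₁ ϑ₀ (l + 1)) * Real.exp (-spdeEigenvalue ϑ₂ ϑ₁ ϑ₀ (l + 1)
        * (|((bif s then p.1 + 1 else p.1 : ℕ) : ℝ) - ((bif s' then q.1 + 1 else q.1 : ℕ) : ℝ)| * Δ)))]
    refine Finset.sum_congr rfl fun p _ => Finset.sum_congr rfl fun q _ => ?_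
    simp only [gridSub]
    rw [timeDiff_exp_natAbs (hpos l).ne']
    simp only [cond_true, cond_false]
    push_cast
    rw [show ((p.1 : ℕ) : ℝ) + 1 - (((q.1 : ℕ) : ℝ) + 1) = (p.1 : ℕ) - (q.1 : ℕ) by ring]
    have := (hpos l).ne'
    field_simp
    ring
  simp_rw [hval]
  have h2 := (hasSum_sum (s := Finset.univ) fun p _ => hasSum_sum (s := Finset.univ) fun q _ =>
    (hS p q).mul_left (w p * w q)).tendsto_sum_nat
  have h3 : Continuous fun x : ℝ => Complex.exp (-(x : ℂ) / 2) := by fun_prop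
  exact (h3.continuousAt.tendsto.comp h2).comp hns.tendsto_atTop

/-! ### Identification of the constants and conclusion -/

theorem psiFun_pos {ϑ₂ r : ℝ} (hϑ : 0 < ϑ₂) (hr : 0 < r) : 0 < psiFun ϑ₂ r := by
  unfold psiFun
  have h1 : Real.exp (-(r ^ 2 / (4 * ϑ₂))) < 1 := Real.exp_lt_one_iff.2 (by
    have : 0 < r ^ 2 / (4 * ϑ₂) := by positivity
    linarith)
  have h2 : 0 ≤ ∫ z in Ioi (r / (2 * √ϑ₂)), Real.exp (-z ^ 2) :=
    integral_nonneg fun z => (Real.exp_pos _).le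
  have h3 : 0 ≤ r / √ϑ₂ * ∫ z in Ioi (r / (2 * √ϑ₂)), Real.exp (-z ^ 2) := by positivity
  exact mul_pos (by positivity) (by linarith)

/-- The factor Λ_{0,0}² in ψ² cancels the denominator of C, leaving twice the square sum of v. -/
theorem CFun_mul_psiFun_sq {ϑ₂ r : ℝ} (σ : ℝ) (hϑ : 0 < ϑ₂) (hr : 0 < r) :
    2 * ∑' z : ℤ × ℤ, (-(σ ^ 2 / √ϑ₂) * LambdaFun (r / √ϑ₂) z.1 z.2) ^ 2
      = CFun (r / √ϑ₂) * psiFun ϑ₂ r ^ 2 * σ ^ 4 := by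
  have hψ := psiFun_pos hϑ hr
  have he := psiFun_eq hϑ hr
  have hs : √ϑ₂ ≠ 0 := (Real.sqrt_pos.2 hϑ).ne'
  have hΛ : LambdaFun (r / √ϑ₂) 0 0 ≠ 0 := fun h => by
    rw [h, zero_div, neg_zero] at he; exact hψ.ne' he
  simp_rw [mul_pow]
  rw [tsum_mul_left, he, CFun]
  field_simp

theorem sqrt_mul_realizedVariation_sub {Ω : Type*} (X : ℝ≥0 → ℝ → Ω → ℝ) (κ b ψ : ℝ) (T : ℝ≥0)
    {M N : ℕ} (hM : 0 < M) (hN : 0 < N) (ω : Ω) :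
    √((M:ℝ) * N) * (realizedVariation X κ b T M N ω - ψ)
      = ∑ p, ((√(√((M:ℝ) * N) * √(timeStep T N : ℝ)))⁻¹ * weightedIncrement X κ b T M N ω p) ^ 2
        - √((M:ℝ) * N) * ψ := by
  have hM' : (0:ℝ) < M := by exact_mod_cast hM
  have hN' : (0:ℝ) < N := by exact_mod_cast hN
  have hs : 0 < √((M:ℝ) * N) := by positivity
  have hss : √((M:ℝ) * N) * √((M:ℝ) * N) = M * N := Real.mul_self_sqrt (by positivity)
  rw [mul_sub]
  congr 1
  have e1 : ∀ p : Fin N × Fin M,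
      ((√(√((M:ℝ) * N) * √(timeStep T N : ℝ)))⁻¹ * weightedIncrement X κ b T M N ω p) ^ 2
      = (√((M:ℝ) * N) * √(timeStep T N : ℝ))⁻¹ * (Real.exp (κ / 2 * (spacePoint b M p.2
        + spacePoint b M (p.2 + 1))) * doubleIncrement X b T M N p.1 p.2 ω ^ 2) := fun p => by
    unfold weightedIncrement
    rw [mul_pow, mul_pow, inv_pow, Real.sq_sqrt (by positivity), ← Real.exp_nat_mul]
    congr 3
    push_cast; ring_nf
  simp_rw [e1]
  rw [← Finset.mul_sum, Fintype.sum_prod_type_right]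
  unfold realizedVariation
  rw [Finset.sum_range, ← mul_assoc]
  congr 1
  · generalize √((M:ℝ) * N) = s at hs hss
    rw [← hss]
    field_simp
  · exact Finset.sum_congr rfl fun k _ => by rw [Finset.sum_range]

theorem mainTheorem6 {Ω : Type*} [MeasurableSpace Ω] (μ : Measure Ω) [IsProbabilityMeasure μ]
    (σ ϑ₂ ϑ₁ ϑ₀ : ℝ) (hσ : 0 < σ ^ 2) (hϑ₂ : 0 < ϑ₂)
    (hΓ : 0 < ϑ₁ ^ 2 / (4 * ϑ₂ ^ 2) - ϑ₀ / ϑ₂ + Real.pi ^ 2)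
    (β u : ℕ → ℝ≥0 → Ω → ℝ) (X : ℝ≥0 → ℝ → Ω → ℝ)
    (hX : IsStationarySPDESolution σ ϑ₂ ϑ₁ ϑ₀ β u X μ)
    (T : ℝ≥0) (hT : 0 < T) (b : ℝ) (hb : 0 < b) (hb' : b < 1 / 2)
    (M N : ℕ → ℕ) (hM : Tendsto M atTop atTop) (hN : Tendsto N atTop atTop)
    (r : ℝ) (hr : 0 < r) (hδΔ : ∀ n, spaceStep b (M n) / √(timeStep T (N n) : ℝ) = r) :
    (Summable fun p : ℤ × ℤ => LambdaFun (r / √ϑ₂) p.1 p.2 ^ 2) ∧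
    TendstoInDistribution
      (fun n ω => √((M n : ℝ) * (N n : ℝ)) *
        (realizedVariation X (spdeKappa ϑ₂ ϑ₁) b T (M n) (N n) ω - psiFun ϑ₂ r * σ ^ 2))
      atTop (id : ℝ → ℝ) (fun _ => μ)
      (gaussianReal 0
        (Real.toNNReal (CFun (r / √ϑ₂) * psiFun ϑ₂ r ^ 2 * σ ^ 4))) := by
  have hsϑ : 0 < √ϑ₂ := Real.sqrt_pos.2 hϑ₂
  have hsum := summable_sq_LambdaFun (h := r / √ϑ₂) (by positivity)
  refine ⟨hsum, ?_⟩
  set κ := spdeKappa ϑ₂ ϑ₁ with hκ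
  set Γ := spdeGamma ϑ₂ ϑ₁ ϑ₀ with hΓdef
  have hΓ' : 0 < Γ + Real.pi ^ 2 := hΓ
  obtain ⟨c₀, hc₀, hlow⟩ := exists_eigenvalue_lower_bound hϑ₂ hΓ'
  have hev : ∀ l : ℕ, spdeEigenvalue ϑ₂ ϑ₁ ϑ₀ (l + 1) = ϑ₂ * (Real.pi ^ 2 * ((l:ℝ) + 1) ^ 2 + Γ) :=
    fun l => by unfold spdeEigenvalue; push_cast; rfl
  have hpos : ∀ l : ℕ, 0 < spdeEigenvalue ϑ₂ ϑ₁ ϑ₀ (l + 1) := fun l => by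
    rw [hev]; exact lt_of_lt_of_le (by positivity) (hlow l)
  -- Division by zero gives 0, so a vanishing M or N would make the ratio 0 instead of r > 0.
  have hM0 : ∀ n, 0 < M n := fun n => Nat.pos_of_ne_zero fun h => by
    have := hδΔ n
    simp [spaceStep, h] at this
    exact hr.ne this
  have hN0 : ∀ n, 0 < N n := fun n => Nat.pos_of_ne_zero fun h => by
    have := hδΔ n
    simp [timeStep, h] at this
    exact hr.ne this
  have hM' : ∀ n, (0:ℝ) < M n := fun n => by exact_mod_cast hM0 n
  have hN' : ∀ n, (0:ℝ) < N n := fun n => by exact_mod_cast hN0 n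
  set Δ : ℕ → ℝ≥0 := fun n => timeStep T (N n) with hΔdef
  have hΔ0 : ∀ n, 0 < Δ n := fun n => div_pos hT (by exact_mod_cast hN0 n)
  have hΔ : ∀ n, (0:ℝ) < Δ n := fun n => NNReal.coe_pos.2 (hΔ0 n)
  have hNΔ : ∀ n, (N n : ℝ) * Δ n = T := fun n => by
    simp only [hΔdef, timeStep]
    push_cast
    exact mul_div_cancel₀ _ (hN' n).ne'
  have hδ : ∀ n, spaceStep b (M n) = r * √(Δ n : ℝ) := fun n => by
    rw [← hδΔ n, div_mul_cancel₀]
    exact (Real.sqrt_pos.2 (hΔ n)).ne'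
  obtain ⟨C, hC⟩ := exists_abs_incrementCov_sub_le (ϑ₂ * Γ) κ r hϑ₂ hb hb' (NNReal.coe_pos.2 hT) hr.le
  set cov : ∀ n, Fin (N n) × Fin (M n) → Fin (N n) × Fin (M n) → ℝ := fun n p q =>
    σ ^ 2 / 2 * incrementCov ϑ₂ (ϑ₂ * Γ) (Real.exp (-(κ * spaceStep b (M n) / 4))) (spaceStep b (M n))
      (Δ n) (spacePoint b (M n) p.2) (spacePoint b (M n) q.2) (gridSub p q).1.natAbs with hcov
  have hS : ∀ n (p q : Fin (N n) × Fin (M n)), HasSum (fun l => σ ^ 2 / 2 * (timeDiff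
        (fun s => Real.exp (-spdeEigenvalue ϑ₂ ϑ₁ ϑ₀ (l + 1) * s)) (Δ n) (gridSub p q).1.natAbs
      * (eigenIncrement κ b (M n) l p.2 * eigenIncrement κ b (M n) l q.2))) (cov n p q) :=
    fun n p q => by
      simp_rw [hev]
      refine (hasSum_incrementCov hϑ₂ hΓ' hb hb' (Real.exp_pos _).ne'
        (spaceStep_pos hb' (hM0 n)).le (le_spacePoint hb' (hM0 n) _) ?_
        (le_spacePoint hb' (hM0 n) _) ?_ (hΔ n).le _).mul_left _
      · rw [← spacePoint_succ]; exact spacePoint_le hb' (hM0 n) p.2.2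
      · rw [← spacePoint_succ]; exact spacePoint_le hb' (hM0 n) q.2.2
  -- Normalising each increment by (D n)^{-1/2} turns √(MN) times the statistic into a plain sum of
  -- squares, and √(MN) times the covariance into `cov` / √Δ.
  set D : ℕ → ℝ := fun n => √((M n : ℝ) * N n) * √(Δ n : ℝ) with hD
  have hD0 : ∀ n, 0 < D n := fun n => mul_pos (Real.sqrt_pos.2 (mul_pos (hM' n) (hN' n)))
    (Real.sqrt_pos.2 (hΔ n))
  have hclt := tendstoInDistribution_sum_sq_of_toeplitz μ hM hN
    (v := fun z => -(σ ^ 2 / √ϑ₂) * LambdaFun (r / √ϑ₂) z.1 z.2)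
    (by simp_rw [mul_pow]; exact hsum.mul_left _)
    (fun n ω p => (√(D n))⁻¹ * weightedIncrement X κ b T (M n) (N n) ω p)
    (fun n => by
      have h := aemeasurable_weightedIncrement hX hb hb' κ T (M n) (N n)
      exact aemeasurable_pi_iff.2 fun p => (aemeasurable_pi_iff.1 h p).const_mul _)
    (fun n => Matrix.of fun p q => (D n)⁻¹ * cov n p q)
    -- Symmetry is read off the spectral series, which is visibly symmetric, by uniqueness of its
    -- sum.
    (fun n => Matrix.IsHermitian.ext fun p q => by
      have h1 := hS n p q
      have h2 := hS n q p
      have e : (gridSub q p).1.natAbs = (gridSub p q).1.natAbs := by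
        simp only [gridSub]; omega
      rw [e] at h2
      simp_rw [mul_comm (eigenIncrement κ b (M n) _ q.2)] at h2
      simp [Matrix.of_apply, h1.unique h2])
    (fun n w => by
      have h := integral_exp_sum_weightedIncrement hX hpos hb hb' (hΔ0 n) (cov n) (hS n)
        (fun p => w p * (√(D n))⁻¹)
      have e1 : ∀ ω, ∑ p, w p * ((√(D n))⁻¹ * weightedIncrement X κ b T (M n) (N n) ω p)
          = ∑ p, w p * (√(D n))⁻¹ * weightedIncrement X κ b T (M n) (N n) ω p := fun ω =>
        Finset.sum_congr rfl fun p _ => (mul_assoc _ _ _).symm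
      have e2 : ∑ p, ∑ q, w p * w q * (Matrix.of fun p q => (D n)⁻¹ * cov n p q) p q
          = ∑ p, ∑ q, w p * (√(D n))⁻¹ * (w q * (√(D n))⁻¹) * cov n p q := by
        refine Finset.sum_congr rfl fun p _ => Finset.sum_congr rfl fun q _ => ?_
        have : (√(D n))⁻¹ * (√(D n))⁻¹ = (D n)⁻¹ := by
          rw [← mul_inv, Real.mul_self_sqrt (hD0 n).le]
        rw [Matrix.of_apply, ← this]
        ring
      simp_rw [e1]
      rw [e2]
      exact h)
    (fun n => σ ^ 2 / 2 * C * Δ n)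
    (by
      -- From NΔ = T and Mδ = 1 - 2b with δ = r√Δ: Δ²MN = TMΔ = T(1 - 2b)²/(r²M).
      have e : ∀ n, σ ^ 2 / 2 * C * Δ n * √((M n : ℝ) * N n)
          = σ ^ 2 / 2 * C * √(T * (1 - 2 * b) ^ 2 / r ^ 2 / M n) := fun n => by
        rw [mul_assoc]
        congr 1
        rw [eq_comm, Real.sqrt_eq_iff_mul_self_eq_of_pos (by have := hΔ n; have := hM' n; have := hN' n; positivity)]
        have h1 : (1 - 2 * b) = r * √(Δ n : ℝ) * M n := by
          rw [← hδ n, spaceStep, div_mul_cancel₀ _ (hM' n).ne']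
        have h2 := Real.mul_self_sqrt (mul_pos (hM' n) (hN' n)).le
        have h3 := Real.sq_sqrt (hΔ n).le
        rw [h1, ← hNΔ n, mul_mul_mul_comm, h2, mul_pow, mul_pow, h3]
        have := (hM' n).ne'
        field_simp
      simp_rw [e]
      have h1 : Tendsto (fun n => T * (1 - 2 * b) ^ 2 / r ^ 2 / (M n : ℝ)) atTop (𝓝 0) :=
        (tendsto_natCast_atTop_atTop.comp hM).const_div_atTop _
      have h2 := (Real.continuous_sqrt.tendsto 0).comp h1
      rw [Real.sqrt_zero] at h2
      have h3 := h2.const_mul (σ ^ 2 / 2 * C)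
      rw [mul_zero] at h3
      exact h3)
    (fun n p q => by
      have hi : (((gridSub p q).1.natAbs : ℕ) : ℝ) + 1 ≤ N n := by
        have h1 := p.1.2
        have h2 := q.1.2
        have : (gridSub p q).1.natAbs + 1 ≤ N n := by simp only [gridSub]; omega
        exact_mod_cast this
      have hb2 := hC (Δ n) (spaceStep b (M n)) (spacePoint b (M n) p.2) (spacePoint b (M n) q.2)
        (gridSub p q).1 (gridSub p q).2 (hΔ n)
        ((mul_le_mul_of_nonneg_right hi (hΔ n).le).trans_eq (hNΔ n)) (hδ n)
        (le_spacePoint hb' (hM0 n) _)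
        (by rw [← spacePoint_succ]; exact spacePoint_le hb' (hM0 n) p.2.2)
        (le_spacePoint hb' (hM0 n) _)
        (by rw [← spacePoint_succ]; exact spacePoint_le hb' (hM0 n) q.2.2)
        (by simp only [gridSub, spacePoint]; push_cast; ring)
      have hs : 0 < √(Δ n : ℝ) := Real.sqrt_pos.2 (hΔ n)
      have hMN : √((M n : ℝ) * N n) ≠ 0 := (Real.sqrt_pos.2 (mul_pos (hM' n) (hN' n))).ne'
      have e : √((M n : ℝ) * N n) * (Matrix.of fun p q => (D n)⁻¹ * cov n p q) p q
          - -(σ ^ 2 / √ϑ₂) * LambdaFun (r / √ϑ₂) (gridSub p q).1 (gridSub p q).2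
          = σ ^ 2 / 2 / √(Δ n : ℝ) * (incrementCov ϑ₂ (ϑ₂ * Γ)
            (Real.exp (-(κ * spaceStep b (M n) / 4))) (spaceStep b (M n)) (Δ n)
            (spacePoint b (M n) p.2) (spacePoint b (M n) q.2) (gridSub p q).1.natAbs
            - √(Δ n : ℝ) * (-(2 / √ϑ₂)
              * LambdaFun (r / √ϑ₂) (gridSub p q).1 (gridSub p q).2)) := by
        rw [Matrix.of_apply]
        simp only [hcov, hD]
        field_simp
      rw [e, abs_mul, abs_of_pos (by positivity)]
      calc _ ≤ σ ^ 2 / 2 / √(Δ n : ℝ) * (C * (Δ n * √(Δ n : ℝ))) := by gcongr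
        _ = _ := by field_simp)
  rw [CFun_mul_psiFun_sq σ hϑ₂ hr] at hclt
  have hfun : (fun n ω => √((M n : ℝ) * (N n : ℝ)) *
        (realizedVariation X κ b T (M n) (N n) ω - psiFun ϑ₂ r * σ ^ 2))
      = fun n ω => ∑ p, ((√(D n))⁻¹ * weightedIncrement X κ b T (M n) (N n) ω p) ^ 2
        - √((M n : ℝ) * N n) * (-(σ ^ 2 / √ϑ₂)
          * LambdaFun (r / √ϑ₂) (0 : ℤ × ℤ).1 (0 : ℤ × ℤ).2) := by
    funext n ω
    rw [sqrt_mul_realizedVariation_sub X κ b _ T (hM0 n) (hN0 n), psiFun_eq hϑ₂ hr]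
    simp only [hD, hΔdef, Prod.fst_zero, Prod.snd_zero]
    ring
  rw [hfun]
  exact hclt
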